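/- Let $n\ge 2$, $\nu>0$, $\mathbb T=\mathbb R/2\pi\mathbb Z$, and let $u_0\in C^\infty(\mathbb T^n,\mathbb R^n)$ with $\operatorname{div}u_0=0$. For a smooth vector field $v:\mathbb T^n\to\mathbb R^n$ put $$\|v\|_{\mathsf A,0}=\sum_{k\in\mathbb Z^n\setminus\{0\}}|a_k|,\qquad a_k=(2\pi)^{-n}\int_{\mathbb T^n}v(x)\,e^{-ik\cdot x}\,dx\in\mathbb C^n,$$ where $|\cdot|$ is the $\ell^2$-norm on $\mathbb C^n$. For $S\in(0,\infty]$, a smooth solution on $[0,S)$ is a function $u\in C^\infty([0,S),C^\infty(\mathbb T^n)^n)$ (that is, $u$ is smooth on $\mathbb T^n\times[0,S)$, with one-sided time derivatives at $t=0$) such that, for some pressure $p\in C^\infty([0,S),C^\infty(\mathbb T^n))$, $$\partial_t u=\nu\Delta u-(u\cdot\nabla)u-\nabla p,\qquad \operatorname{div}u=0\qquad\text{on }\mathbb T^n\times[0,S),\qquad u(\cdot,0)=u_0.$$ Then there are $T^*\in(0,\infty]$ and a smooth solution $u$ on $[0,T^*)$ with the following properties. 1. $T^*=\infty$ if $\|u_0\|_{\mathsf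 A,0}\le\nu$, and $T^*\ge 2\nu/\|u_0\|_{\mathsf A,0}^2$ if $\|u_0\|_{\mathsf A,0}>\nu$. 2. $u$ is unique: for every $S\in(0,\infty]$, every smooth solution on $[0,S)$ coincides with $u$ on $[0,\min(S,T^*))$. 3. If $0\le T<\infty$, $0\le C<\infty$ and $\|u(\cdot,t)\|_{\mathsf A,0}\le C$ for all $t\in[0,T]$ with $t<T^*$, then $T^*>T$. -/

import Mathlib

open scoped ContDiff ENNReal NNReal

/-!
Functions on the torus `𝕋ⁿ = (ℝ / 2πℤ)ⁿ` are represented by functions on `ℝⁿ` that are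
`2π`-periodic in every coordinate.
-/

namespace PeriodicNS

/-- `f` is `2π`-periodic in each of the `n` coordinates, i.e. a function on `(ℝ / 2πℤ)ⁿ`. -/
def IsPeriodic {n : ℕ} {F : Type*} (f : EuclideanSpace ℝ (Fin n) → F) : Prop :=
  ∀ (x : EuclideanSpace ℝ (Fin n)) (i : Fin n),
    f (x + EuclideanSpace.single i (2 * Real.pi)) = f x

/-- The divergence `∑ᵢ ∂ᵢ vᵢ` of a vector field on `ℝⁿ`. -/
noncomputable def divergence {n : ℕ}
    (v : EuclideanSpace ℝ (Fin n) → EuclideanSpace ℝ (Fin n))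
    (x : EuclideanSpace ℝ (Fin n)) : ℝ :=
  ∑ i : Fin n, (fderiv ℝ v x (EuclideanSpace.single i 1)) i

/-- A period cell `[0, 2π)ⁿ` of the torus. -/
def periodCell (n : ℕ) : Set (EuclideanSpace ℝ (Fin n)) :=
  {x | ∀ i, x i ∈ Set.Ico 0 (2 * Real.pi)}

/-- The Fourier coefficient `a_k = (2π)⁻ⁿ ∫_{𝕋ⁿ} v(x) e^{-i k·x} dx ∈ ℂⁿ` of a vector field. -/
noncomputable def fourierCoefficient {n : ℕ}
    (v : EuclideanSpace ℝ (Fin n) → EuclideanSpace ℝ (Fin n)) (k : Fin n → ℤ) :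
    EuclideanSpace ℂ (Fin n) :=
  WithLp.toLp 2 fun j => ((2 * Real.pi : ℝ) ^ n : ℂ)⁻¹ *
    ∫ x in periodCell n, Complex.exp (-(Complex.I * ∑ i, (k i : ℂ) * (x i : ℂ))) * (v x j : ℂ)

/-- `‖v‖_{A,0} = ∑_{k ≠ 0} |a_k|`, where `|·|` is the `ℓ²` norm on `ℂⁿ`; the sum is taken
in `[0, ∞]`. -/
noncomputable def normA0 {n : ℕ}
    (v : EuclideanSpace ℝ (Fin n) → EuclideanSpace ℝ (Fin n)) : ℝ≥0∞ :=
  ∑' k : {k : Fin n → ℤ // k ≠ 0}, ‖fourierCoefficient v k.1‖ₑ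

/-- The time interval `[0, T)` with `T ∈ [0, ∞]`. -/
def timeInterval (T : ℝ≥0∞) : Set ℝ :=
  {t | 0 ≤ t ∧ ENNReal.ofReal t < T}

/-- `u ∈ C^∞([0, T), C^∞(𝕋ⁿ)ⁿ)` solves the unforced periodic Navier–Stokes equation
`∂ₜ u = ν Δ u - (u · ∇) u - ∇ p`, `div u = 0`, `u(·, 0) = u₀`, on `𝕋ⁿ × [0, T)` for some
pressure `p ∈ C^∞([0, T), C^∞(𝕋ⁿ))`.  At `t = 0` the time derivatives are one-sided.
The values of `u t` for `t` outside of `[0, T)` are irrelevant. -/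
structure IsSmoothSolution {n : ℕ} (ν : ℝ)
    (u₀ : EuclideanSpace ℝ (Fin n) → EuclideanSpace ℝ (Fin n)) (T : ℝ≥0∞)
    (u : ℝ → EuclideanSpace ℝ (Fin n) → EuclideanSpace ℝ (Fin n)) : Prop where
  smooth : ContDiffOn ℝ ∞ (fun z : ℝ × EuclideanSpace ℝ (Fin n) => u z.1 z.2)
    (timeInterval T ×ˢ Set.univ)
  periodic : ∀ t ∈ timeInterval T, IsPeriodic (u t)
  div_free : ∀ t ∈ timeInterval T, ∀ x, divergence (u t) x = 0
  initial : ∀ x, u 0 x = u₀ x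
  momentum : ∃ p : ℝ → EuclideanSpace ℝ (Fin n) → ℝ,
    ContDiffOn ℝ ∞ (fun z : ℝ × EuclideanSpace ℝ (Fin n) => p z.1 z.2)
      (timeInterval T ×ˢ Set.univ) ∧
    (∀ t ∈ timeInterval T, IsPeriodic (p t)) ∧
    ∀ t ∈ timeInterval T, ∀ x,
      HasDerivWithinAt (fun s => u s x)
        (ν • Laplacian.laplacian (u t) x - fderiv ℝ (u t) x (u t x) - gradient (p t) x)
        (timeInterval T) t

end PeriodicNS

/-!
Maximal smooth solutions of the Navier–Stokes equation on the torus, for initial values measured by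
the sum `‖u₀‖₀ = ∑_{k ≠ 0} |a_k|` of the absolute values of the Fourier coefficients.

On the Fourier side the equation reads `a_k' = P_k (-ν |k|² a_k - i ∑_l (k · a_l) a_{k-l})`, where
`P_k` is the orthogonal projection onto `k^⊥` (`nsField`). Write `‖a‖ₘ = ∑_{k ≠ 0} |k|^m |a_k|`
(`wsum`). As `l · a_l = 0`, the factor `k · a_l` equals `(k - l) · a_l`, and the term with `l = 0`
only rotates the phase of `a_k`, so that `‖a‖₀' ≤ ‖a‖₀ ‖a‖₁ - ν ‖a‖₂` with constant one. Since
`‖a‖₁ ≤ ‖a‖₂`, the bound `‖a‖₀ ≤ ν` persists forever (`wsum_zero_le_of_le`). In general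
`‖a‖₀ ‖a‖₁ ≤ ν ‖a‖₂ + ‖a‖₀³ / (4ν)`, and comparison with `y' = y³ / (4ν)` bounds `‖a‖₀` up to any
time below `2ν / ‖u₀‖₀²` (`wsum_zero_le_sqrt`). As long as `‖a‖₀` is bounded, so are all the norms
`‖a‖ₘ` (`wsum_le_exp`).

These estimates hold uniformly for the Galerkin systems, in which only finitely many frequencies are
kept. A time dependent factor in `[0, 1]` in front of the field does no harm to them either, so the
field can be cut off, which makes the Galerkin systems globally solvable. The Galerkin solutions
converge (`wsum_galerkin_sub_le`) to a solution that is rapidly decreasing in `k` and smooth in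
time, as its time derivative is a polynomial in it (`exists_fourier_solution`,
`smoothFamily_component`). Its Fourier series is a smooth solution, with the pressure given by the
part of the advection that `P_k` removes (`isSmoothSolution_of_fourier`). Fourier inversion for `u₀`
gives `exists_isSmoothSolution`.

Uniqueness is the energy estimate for the difference of two solutions
(`IsSolutionOn.eq_of_initial_eq`). It allows all solutions to be glued to one on the maximal
interval; the pressures are glued after normalisation at a point (`exists_isSolutionOn_of_local`).
Finally, if `‖u(t)‖₀ ≤ C` up to a finite maximal time, the solution could be restarted shortly
before that time with a life span that depends only on `C`, and extended beyond
(`lt_maximalTime_of_normA0_le`).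
-/

namespace PeriodicNS

open Set MeasureTheory ComplexConjugate Filter Topology

variable {n : ℕ}

/-! ### Integral inequalities on a time interval -/

theorem hasDerivWithinAt_integral_Icc {E : Type*} [NormedAddCommGroup E] [NormedSpace ℝ E]
    [CompleteSpace E] {T t : ℝ} {f : ℝ → E} (hf : ContinuousOn f (Icc 0 T)) (ht : t ∈ Icc 0 T) :
    HasDerivWithinAt (fun s => ∫ r in (0 : ℝ)..s, f r) (f t) (Icc 0 T) t := by
  have : Fact (t ∈ Icc 0 T) := ⟨ht⟩
  refine intervalIntegral.integral_hasDerivWithinAt_right (s := Icc 0 T) (t := Icc 0 T) ?_ ?_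
    (hf t ht)
  · apply ContinuousOn.intervalIntegrable
    rw [uIcc_of_le ht.1]
    exact hf.mono (Icc_subset_Icc le_rfl ht.2)
  · exact hf.stronglyMeasurableAtFilter_nhdsWithin measurableSet_Icc t

theorem le_of_hasDerivWithinAt_nonpos {T : ℝ} {f f' : ℝ → ℝ}
    (hf : ∀ t ∈ Icc 0 T, HasDerivWithinAt f (f' t) (Icc 0 T) t) (hf' : ∀ t ∈ Icc 0 T, f' t ≤ 0)
    {t : ℝ} (ht : t ∈ Icc 0 T) : f t ≤ f 0 := by
  have : AntitoneOn f (Icc 0 T) := by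
    refine antitoneOn_of_hasDerivWithinAt_nonpos (f' := f') (convex_Icc _ _)
      (fun t ht => (hf t ht).continuousWithinAt) (fun t ht => ?_) (fun t ht => ?_)
    · exact (hf t (interior_subset ht)).mono interior_subset
    · exact hf' t (interior_subset ht)
  exact this ⟨le_rfl, ht.1.trans ht.2⟩ ht ht.1

/-- A differential inequality for a norm, which need not be differentiable where it vanishes: if
`⟪x, x'⟫ ≤ ‖x‖ g - c ‖x‖²`, then `‖x‖' ≤ g - c ‖x‖` in integrated form. -/
theorem norm_le_add_integral {E : Type*} [NormedAddCommGroup E] [InnerProductSpace ℝ E] {T : ℝ}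
    {x x' : ℝ → E} {c g : ℝ → ℝ}
    (hx : ∀ t ∈ Icc 0 T, HasDerivWithinAt x (x' t) (Icc 0 T) t)
    (hc : ContinuousOn c (Icc 0 T)) (hg : ContinuousOn g (Icc 0 T))
    (hc0 : ∀ t ∈ Icc 0 T, 0 ≤ c t) (hg0 : ∀ t ∈ Icc 0 T, 0 ≤ g t)
    (h : ∀ t ∈ Icc 0 T, inner ℝ (x t) (x' t) ≤ ‖x t‖ * g t - c t * ‖x t‖ ^ 2)
    {t : ℝ} (ht : t ∈ Icc 0 T) :
    ‖x t‖ ≤ ‖x 0‖ + ∫ s in (0 : ℝ)..t, (g s - c s * ‖x s‖) := by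
  have hxc : ContinuousOn x (Icc 0 T) := fun t ht => (hx t ht).continuousWithinAt
  have hsub : Icc 0 t ⊆ Icc 0 T := Icc_subset_Icc le_rfl ht.2
  have hI : ∀ {f : ℝ → ℝ}, ContinuousOn f (Icc 0 T) → IntervalIntegrable f volume 0 t := by
    intro f hf
    apply ContinuousOn.intervalIntegrable
    rw [uIcc_of_le ht.1]
    exact hf.mono hsub
  -- The norm is regularised to `√(‖x‖² + ε²)`, which is differentiable.
  have key : ∀ ε > 0, ‖x t‖ ≤ ‖x 0‖ + ε + ((∫ s in (0 : ℝ)..t, (g s - c s * ‖x s‖)) +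
      ε * ∫ s in (0 : ℝ)..t, c s) := by
    intro ε hε
    have hpos : ∀ s, 0 < ‖x s‖ ^ 2 + ε ^ 2 := fun s => by positivity
    have hd : ∀ s ∈ Icc 0 T, HasDerivWithinAt
        (fun s => √(‖x s‖ ^ 2 + ε ^ 2) - ∫ r in (0 : ℝ)..s, (g r - c r * ‖x r‖ + ε * c r))
        (2 * inner ℝ (x s) (x' s) / (2 * √(‖x s‖ ^ 2 + ε ^ 2)) -
          (g s - c s * ‖x s‖ + ε * c s)) (Icc 0 T) s := by
      intro s hs
      refine HasDerivWithinAt.sub ?_ ?_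
      · exact (((hx s hs).norm_sq).add_const (ε ^ 2)).sqrt (hpos s).ne'
      · exact hasDerivWithinAt_integral_Icc
          ((hg.sub (hc.mul hxc.norm)).add (continuousOn_const.mul hc)) hs
    have h1 := le_of_hasDerivWithinAt_nonpos hd (fun s hs => ?_) ht
    · simp only [intervalIntegral.integral_same, sub_zero] at h1
      have h0 := intervalIntegral.integral_add (hI (f := fun r => g r - c r * ‖x r‖)
        (hg.sub (hc.mul hxc.norm))) (hI (f := fun r => ε * c r) (continuousOn_const.mul hc))
      rw [h0, intervalIntegral.integral_const_mul] at h1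
      have h2 : ‖x t‖ ≤ √(‖x t‖ ^ 2 + ε ^ 2) := Real.le_sqrt_of_sq_le (by nlinarith)
      have h3 : √(‖x 0‖ ^ 2 + ε ^ 2) ≤ ‖x 0‖ + ε := by
        exact Real.sqrt_le_iff.2 ⟨by positivity, by
          nlinarith [mul_nonneg (norm_nonneg (x 0)) hε.le]⟩
      linarith
    · set r := √(‖x s‖ ^ 2 + ε ^ 2) with hr
      have hr0 : 0 < r := Real.sqrt_pos.2 (hpos s)
      have hr2 : r ^ 2 = ‖x s‖ ^ 2 + ε ^ 2 := Real.sq_sqrt (hpos s).le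
      have hxr : ‖x s‖ ≤ r := Real.le_sqrt_of_sq_le (by nlinarith)
      have hεr : ε ≤ r := Real.le_sqrt_of_sq_le (by nlinarith [sq_nonneg ‖x s‖])
      rw [mul_div_mul_left _ _ two_ne_zero, sub_nonpos, div_le_iff₀ hr0]
      refine (h s hs).trans ?_
      have e1 : ‖x s‖ * g s ≤ r * g s := mul_le_mul_of_nonneg_right hxr (hg0 s hs)
      have e2 : r * (‖x s‖ - ε) ≤ ‖x s‖ ^ 2 := by
        have : ‖x s‖ ^ 2 = r ^ 2 - ε ^ 2 := by linarith
        rw [this]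
        nlinarith [mul_nonneg hr0.le (sub_nonneg.2 hxr), mul_nonneg (sub_nonneg.2 hεr) hε.le]
      have e3 := mul_le_mul_of_nonneg_left e2 (hc0 s hs)
      nlinarith
  have hlim : Filter.Tendsto (fun ε : ℝ => ‖x 0‖ + ε + ((∫ s in (0 : ℝ)..t, (g s - c s * ‖x s‖)) +
      ε * ∫ s in (0 : ℝ)..t, c s)) (nhdsWithin 0 (Ioi 0))
      (nhds (‖x 0‖ + 0 + ((∫ s in (0 : ℝ)..t, (g s - c s * ‖x s‖)) +
      0 * ∫ s in (0 : ℝ)..t, c s))) := by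
    apply Filter.Tendsto.mono_left _ nhdsWithin_le_nhds
    apply Continuous.tendsto
    fun_prop
  have := ge_of_tendsto hlim (Filter.eventually_of_mem self_mem_nhdsWithin key)
  simpa using this

/-- Gronwall's inequality in integral form. -/
theorem le_exp_of_le_add_integral {T K b y₀ : ℝ} {y h : ℝ → ℝ} (hK : 0 ≤ K) (hb : 0 ≤ b)
    (hh : ContinuousOn h (Icc 0 T)) (hy₀ : 0 ≤ y₀)
    (hy : ∀ t ∈ Icc 0 T, y t ≤ y₀ + ∫ s in (0 : ℝ)..t, h s)
    (hle : ∀ t ∈ Icc 0 T, h t ≤ K * y t + b) {t : ℝ} (ht : t ∈ Icc 0 T) :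
    y t ≤ (y₀ + b * T) * Real.exp (K * T) := by
  have hd : ∀ s ∈ Icc 0 T, HasDerivWithinAt
      (fun s => (y₀ + ∫ r in (0 : ℝ)..s, h r) * Real.exp (-(K * s)) - b * s)
      (h s * Real.exp (-(K * s)) + (y₀ + ∫ r in (0 : ℝ)..s, h r) * (Real.exp (-(K * s)) * -(K * 1))
        - b * 1) (Icc 0 T) s := by
    intro s hs
    refine HasDerivWithinAt.sub (HasDerivWithinAt.mul
      ((hasDerivWithinAt_integral_Icc hh hs).const_add _) ?_) ?_
    · exact (((hasDerivWithinAt_id s _).const_mul K).fun_neg).exp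
    · exact (hasDerivWithinAt_id s _).const_mul b
  have h1 := le_of_hasDerivWithinAt_nonpos hd (fun s hs => ?_) ht
  · simp only [intervalIntegral.integral_same, mul_zero, neg_zero, Real.exp_zero, add_zero, mul_one,
      sub_zero] at h1
    have h2 : y₀ + ∫ r in (0 : ℝ)..t, h r ≤ (y₀ + b * t) * Real.exp (K * t) := by
      have := mul_le_mul_of_nonneg_right (sub_le_iff_le_add.1 h1) (Real.exp_pos (K * t)).le
      rwa [mul_assoc, ← Real.exp_add, neg_add_cancel, Real.exp_zero, mul_one] at this
    refine (hy t ht).trans (h2.trans ?_)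
    have : b * t ≤ b * T := mul_le_mul_of_nonneg_left ht.2 hb
    have hbT : 0 ≤ y₀ + b * T := add_nonneg hy₀ (mul_nonneg hb (ht.1.trans ht.2))
    gcongr
    exact ht.2
  · have e0 : 0 < Real.exp (-(K * s)) := Real.exp_pos _
    have e1 : Real.exp (-(K * s)) ≤ 1 := Real.exp_le_one_iff.2 (by nlinarith [hs.1])
    have e2 : h s ≤ K * (y₀ + ∫ r in (0 : ℝ)..s, h r) + b :=
      (hle s hs).trans (by gcongr; exact hy s hs)
    nlinarith [mul_le_mul_of_nonneg_left e2 e0.le, mul_nonneg hb (sub_nonneg.2 e1)]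

/-- The comparison principle for `y' ≤ y³ / (4ν)`: the solutions of `y' = y³ / (4ν)` satisfy
`(y⁻²)' = -1 / (2ν)`. -/
theorem le_of_le_add_integral_cube {T ν y₁ : ℝ} {y h : ℝ → ℝ} (hν : 0 < ν) (hy₁ : 0 < y₁)
    (hT : T * y₁ ^ 2 < 2 * ν) (hyc : ContinuousOn y (Icc 0 T)) (hh : ContinuousOn h (Icc 0 T))
    (hy0 : ∀ t ∈ Icc 0 T, 0 ≤ y t)
    (hy : ∀ t ∈ Icc 0 T, y t ≤ y₁ + ∫ s in (0 : ℝ)..t, h s)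
    (hle : ∀ t ∈ Icc 0 T, h t ≤ y t ^ 3 / (4 * ν)) {t : ℝ} (ht : t ∈ Icc 0 T) :
    y t ≤ √((1 / y₁ ^ 2 - T / (2 * ν))⁻¹) := by
  -- `Y ≥ y` is differentiable with `Y' = y³ / (4ν) ≤ Y³ / (4ν)`, so `-Y⁻² - t / (2ν)` decreases.
  set Y : ℝ → ℝ := fun t => y₁ + ∫ s in (0 : ℝ)..t, y s ^ 3 / (4 * ν) with hY
  have hcc : ContinuousOn (fun s => y s ^ 3 / (4 * ν)) (Icc 0 T) := (hyc.pow 3).div_const _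
  have hyY : ∀ t ∈ Icc 0 T, y t ≤ Y t := by
    intro t ht
    have hsub : Icc 0 t ⊆ Icc 0 T := Icc_subset_Icc le_rfl ht.2
    refine (hy t ht).trans (add_le_add_right (intervalIntegral.integral_mono_on ht.1 ?_ ?_ ?_) _)
    · exact (hh.mono hsub).intervalIntegrable_of_Icc ht.1
    · exact (hcc.mono hsub).intervalIntegrable_of_Icc ht.1
    · exact fun s hs => hle s (hsub hs)
  have hYpos : ∀ t ∈ Icc 0 T, 0 < Y t := by
    intro t ht
    have : 0 ≤ ∫ s in (0 : ℝ)..t, y s ^ 3 / (4 * ν) :=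
      intervalIntegral.integral_nonneg ht.1 fun s hs =>
        div_nonneg (pow_nonneg (hy0 s ⟨hs.1, hs.2.trans ht.2⟩) 3) (by positivity)
    simp only [hY]; linarith
  have hd : ∀ s ∈ Icc 0 T, HasDerivWithinAt (fun s => -(Y s ^ 2)⁻¹ - s / (2 * ν))
      (-(-(((2 : ℕ) : ℝ) * Y s ^ (2 - 1) * (y s ^ 3 / (4 * ν))) / (Y s ^ 2) ^ 2) - 1 / (2 * ν))
      (Icc 0 T) s := by
    intro s hs
    refine HasDerivWithinAt.sub ?_ ((hasDerivWithinAt_id s _).div_const _)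
    exact ((((hasDerivWithinAt_integral_Icc hcc hs).const_add _).pow 2).inv
      (pow_ne_zero 2 (hYpos s hs).ne')).neg
  have h1 := le_of_hasDerivWithinAt_nonpos hd (fun s hs => ?_) ht
  · have h0 : Y 0 = y₁ := by simp [hY]
    simp only [h0, zero_div, sub_zero] at h1
    have hδ : 0 < 1 / y₁ ^ 2 - T / (2 * ν) := by
      rw [sub_pos, div_lt_div_iff₀ (by positivity) (by positivity)]; linarith
    have h2 : 1 / y₁ ^ 2 - T / (2 * ν) ≤ (Y t ^ 2)⁻¹ := by
      have : t / (2 * ν) ≤ T / (2 * ν) := by gcongr; exact ht.2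
      rw [one_div]; linarith
    refine (hyY t ht).trans (Real.le_sqrt_of_sq_le ?_)
    have := inv_anti₀ hδ h2
    rwa [inv_inv] at this
  · have hp := hYpos s hs
    have h3 : y s ^ 3 ≤ Y s ^ 3 := pow_le_pow_left₀ (hy0 s hs) (hyY s hs) 3
    have e : -(-(((2 : ℕ) : ℝ) * Y s ^ (2 - 1) * (y s ^ 3 / (4 * ν))) / (Y s ^ 2) ^ 2)
        = y s ^ 3 / Y s ^ 3 * (1 / (2 * ν)) := by
      field_simp; norm_num; ring
    rw [e, sub_nonpos]
    have : y s ^ 3 / Y s ^ 3 ≤ 1 := (div_le_one (by positivity)).2 h3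
    exact mul_le_of_le_one_left (by positivity) this

/-- The comparison principle for `y' ≤ (y - ν) A`: the bound `y ≤ ν` persists, as
`(y - ν) e^{-∫ A}` does not increase. -/
theorem le_of_le_add_integral_sub_mul {T ν y₀ : ℝ} {y h A : ℝ → ℝ} (hy₀ : y₀ ≤ ν)
    (hyc : ContinuousOn y (Icc 0 T)) (hh : ContinuousOn h (Icc 0 T)) (hA : ContinuousOn A (Icc 0 T))
    (hA0 : ∀ t ∈ Icc 0 T, 0 ≤ A t)
    (hy : ∀ t ∈ Icc 0 T, y t ≤ y₀ + ∫ s in (0 : ℝ)..t, h s)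
    (hle : ∀ t ∈ Icc 0 T, h t ≤ (y t - ν) * A t) {t : ℝ} (ht : t ∈ Icc 0 T) :
    y t ≤ ν := by
  have hcc : ContinuousOn (fun s => (y s - ν) * A s) (Icc 0 T) :=
    (hyc.sub continuousOn_const).mul hA
  have hyW : ∀ t ∈ Icc 0 T, y t - ν ≤ ∫ s in (0 : ℝ)..t, (y s - ν) * A s := by
    intro t ht
    have hsub : Icc 0 t ⊆ Icc 0 T := Icc_subset_Icc le_rfl ht.2
    have := intervalIntegral.integral_mono_on (μ := volume) ht.1
      ((hh.mono hsub).intervalIntegrable_of_Icc ht.1)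
      ((hcc.mono hsub).intervalIntegrable_of_Icc ht.1) fun s hs => hle s (hsub hs)
    linarith [hy t ht]
  have hd : ∀ s ∈ Icc 0 T, HasDerivWithinAt
      (fun s => (∫ r in (0 : ℝ)..s, (y r - ν) * A r) * Real.exp (-∫ r in (0 : ℝ)..s, A r))
      ((y s - ν) * A s * Real.exp (-∫ r in (0 : ℝ)..s, A r) +
        (∫ r in (0 : ℝ)..s, (y r - ν) * A r) * (Real.exp (-∫ r in (0 : ℝ)..s, A r) * -A s))
      (Icc 0 T) s := fun s hs =>
    (hasDerivWithinAt_integral_Icc hcc hs).mul (hasDerivWithinAt_integral_Icc hA hs).fun_neg.exp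
  have h1 := le_of_hasDerivWithinAt_nonpos hd (fun s hs => ?_) ht
  · simp only [intervalIntegral.integral_same, zero_mul] at h1
    have := nonpos_of_mul_nonpos_left h1 (Real.exp_pos _)
    linarith [hyW t ht]
  · have e0 := Real.exp_pos (-∫ r in (0 : ℝ)..s, A r)
    have := mul_le_mul_of_nonneg_right (hyW s hs) (mul_nonneg (hA0 s hs) e0.le)
    nlinarith

/-! ### Fourier coefficients: wave vectors, Leray projection, advection -/

/-- The wave vector `k ∈ ℤⁿ`, seen as a vector of `ℂⁿ`. Thus `inner ℂ (kvec k) v` is the bilinear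
product `k · v`. -/
noncomputable def kvec (k : Fin n → ℤ) : EuclideanSpace ℂ (Fin n) :=
  WithLp.toLp 2 fun i => (k i : ℂ)

theorem kvec_add (k l : Fin n → ℤ) : kvec (k + l) = kvec k + kvec l := by
  ext i; simp [kvec]

theorem kvec_sub (k l : Fin n → ℤ) : kvec (k - l) = kvec k - kvec l := by
  ext i; simp [kvec]

theorem kvec_neg (k : Fin n → ℤ) : kvec (-k) = -kvec k := by
  ext i; simp [kvec]

@[simp] theorem kvec_zero : kvec (0 : Fin n → ℤ) = 0 := by
  ext i; simp [kvec]

theorem inner_kvec (k : Fin n → ℤ) (v : EuclideanSpace ℂ (Fin n)) :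
    inner ℂ (kvec k) v = ∑ i, (k i : ℂ) * v i := by
  simp [kvec, PiLp.inner_apply, mul_comm]

theorem norm_kvec_sq (k : Fin n → ℤ) : ‖kvec k‖ ^ 2 = ∑ i, (k i : ℝ) ^ 2 := by
  simp [kvec, EuclideanSpace.norm_sq_eq]

theorem abs_le_norm_kvec (k : Fin n → ℤ) (i : Fin n) : |(k i : ℝ)| ≤ ‖kvec k‖ := by
  have := PiLp.norm_apply_le (kvec k) i
  simpa [kvec] using this

theorem one_le_norm_kvec {k : Fin n → ℤ} (hk : k ≠ 0) : 1 ≤ ‖kvec k‖ := by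
  obtain ⟨i, hi⟩ := Function.ne_iff.1 hk
  refine le_trans ?_ (abs_le_norm_kvec k i)
  exact_mod_cast Int.one_le_abs hi

/-- The Leray projection at frequency `k`: the orthogonal projection of `ℂⁿ` onto `k^⊥`,
which is the identity if `k = 0`. -/
noncomputable def leray (k : Fin n → ℤ) : EuclideanSpace ℂ (Fin n) →L[ℂ] EuclideanSpace ℂ (Fin n) :=
  (ℂ ∙ kvec k)ᗮ.starProjection

theorem leray_apply (k : Fin n → ℤ) (v : EuclideanSpace ℂ (Fin n)) :
    leray k v = v - (inner ℂ (kvec k) v / (‖kvec k‖ ^ 2 : ℝ)) • kvec k := by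
  rw [leray, Submodule.starProjection_orthogonal]
  simp [Submodule.starProjection_singleton]

theorem inner_kvec_leray (k : Fin n → ℤ) (v : EuclideanSpace ℂ (Fin n)) :
    inner ℂ (kvec k) (leray k v) = 0 :=
  Submodule.mem_orthogonal_singleton_iff_inner_right.1 (Submodule.starProjection_apply_mem _ v)

theorem inner_leray_right {k : Fin n → ℤ} {v : EuclideanSpace ℂ (Fin n)}
    (hv : inner ℂ (kvec k) v = 0) (w : EuclideanSpace ℂ (Fin n)) :
    inner ℂ v (leray k w) = inner ℂ v w := by
  rw [leray_apply, inner_sub_right, inner_smul_right, ← inner_conj_symm v (kvec k), hv]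
  simp

theorem norm_leray_le (k : Fin n → ℤ) (v : EuclideanSpace ℂ (Fin n)) : ‖leray k v‖ ≤ ‖v‖ :=
  Submodule.norm_starProjection_apply_le _ v

theorem leray_neg_freq (k : Fin n → ℤ) : leray (-k) = leray k := by
  ext1 v
  simp [leray_apply, kvec_neg, neg_div, sub_eq_add_neg]

/-- Coordinatewise complex conjugation of `ℂⁿ`. -/
noncomputable def conjVec (v : EuclideanSpace ℂ (Fin n)) : EuclideanSpace ℂ (Fin n) :=
  WithLp.toLp 2 fun i => conj (v i)

@[simp] theorem conjVec_apply (v : EuclideanSpace ℂ (Fin n)) (i : Fin n) :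
    conjVec v i = conj (v i) := rfl

@[simp] theorem conjVec_conjVec (v : EuclideanSpace ℂ (Fin n)) : conjVec (conjVec v) = v := by
  ext i; simp

theorem conjVec_add (v w : EuclideanSpace ℂ (Fin n)) :
    conjVec (v + w) = conjVec v + conjVec w := by
  ext i; simp

theorem conjVec_sub (v w : EuclideanSpace ℂ (Fin n)) :
    conjVec (v - w) = conjVec v - conjVec w := by
  ext i; simp

theorem conjVec_smul (c : ℂ) (v : EuclideanSpace ℂ (Fin n)) :
    conjVec (c • v) = conj c • conjVec v := by
  ext i; simp

theorem conjVec_smul_real (c : ℝ) (v : EuclideanSpace ℂ (Fin n)) :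
    conjVec (c • v) = c • conjVec v := by
  ext i; simp

theorem conjVec_kvec (k : Fin n → ℤ) : conjVec (kvec k) = kvec k := by
  ext i; simp [kvec]

theorem conjVec_sum {ι : Type*} (s : Finset ι) (f : ι → EuclideanSpace ℂ (Fin n)) :
    conjVec (∑ i ∈ s, f i) = ∑ i ∈ s, conjVec (f i) := by
  ext i; simp

theorem continuous_conjVec : Continuous (conjVec (n := n)) := by
  have : conjVec (n := n) = fun v => WithLp.toLp 2 fun i => conj (v i) := rfl
  rw [this]
  fun_prop

theorem inner_kvec_conjVec (k : Fin n → ℤ) (v : EuclideanSpace ℂ (Fin n)) :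
    inner ℂ (kvec k) (conjVec v) = conj (inner ℂ (kvec k) v) := by
  simp [inner_kvec]

theorem leray_conjVec (k : Fin n → ℤ) (v : EuclideanSpace ℂ (Fin n)) :
    leray k (conjVec v) = conjVec (leray k v) := by
  simp only [leray_apply, conjVec_sub, conjVec_smul, inner_kvec_conjVec, conjVec_kvec, map_div₀,
    Complex.conj_ofReal]

/-- The Fourier coefficients of a real vector field satisfy `a_{-k} = conj a_k`. -/
def IsRealFamily (a : (Fin n → ℤ) → EuclideanSpace ℂ (Fin n)) : Prop :=
  ∀ k, a (-k) = conjVec (a k)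

/-- The Fourier coefficients of a divergence free vector field satisfy `k · a_k = 0`. -/
def IsDivFreeFamily (a : (Fin n → ℤ) → EuclideanSpace ℂ (Fin n)) : Prop :=
  ∀ k, inner ℂ (kvec k) (a k) = 0

/-- `-i` times the Fourier coefficient of `div (b ⊗ a)`, where `a` and `b` are given by their
Fourier coefficients. -/
noncomputable def advection (a b : (Fin n → ℤ) → EuclideanSpace ℂ (Fin n)) (k : Fin n → ℤ) :
    EuclideanSpace ℂ (Fin n) :=
  ∑' l, inner ℂ (kvec k) (a l) • b (k - l)

theorem advection_eq_sum {a b : (Fin n → ℤ) → EuclideanSpace ℂ (Fin n)} {K : Finset (Fin n → ℤ)}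
    (ha : ∀ k ∉ K, a k = 0) (k : Fin n → ℤ) :
    advection a b k = ∑ l ∈ K, inner ℂ (kvec k) (a l) • b (k - l) :=
  tsum_eq_sum fun l hl => by simp [ha l hl]

/-- `∑_{k ∈ K, k ≠ 0} |k|^m |a_k|`. -/
noncomputable def wsum (m : ℕ) (K : Finset (Fin n → ℤ))
    (a : (Fin n → ℤ) → EuclideanSpace ℂ (Fin n)) : ℝ :=
  ∑ k ∈ K.erase 0, ‖kvec k‖ ^ m * ‖a k‖

/-- `∑_{l ∈ K, l ≠ 0} |a_l| |k - l| |b_{k-l}|`, which bounds the part of the advection at the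
frequency `k` that is not due to the mean of `a`. -/
noncomputable def advBound (K : Finset (Fin n → ℤ)) (a b : (Fin n → ℤ) → EuclideanSpace ℂ (Fin n))
    (k : Fin n → ℤ) : ℝ :=
  ∑ l ∈ K.erase 0, ‖a l‖ * (‖kvec (k - l)‖ * ‖b (k - l)‖)

theorem wsum_nonneg (m : ℕ) (K : Finset (Fin n → ℤ)) (a : (Fin n → ℤ) → EuclideanSpace ℂ (Fin n)) :
    0 ≤ wsum m K a :=
  Finset.sum_nonneg fun _ _ => by positivity

theorem advBound_nonneg (K : Finset (Fin n → ℤ)) (a b : (Fin n → ℤ) → EuclideanSpace ℂ (Fin n))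
    (k : Fin n → ℤ) : 0 ≤ advBound K a b k :=
  Finset.sum_nonneg fun _ _ => by positivity

theorem wsum_le_wsum_succ (m : ℕ) (K : Finset (Fin n → ℤ))
    (a : (Fin n → ℤ) → EuclideanSpace ℂ (Fin n)) : wsum m K a ≤ wsum (m + 1) K a := by
  refine Finset.sum_le_sum fun k hk => ?_
  have := one_le_norm_kvec (Finset.ne_of_mem_erase hk)
  gcongr
  omega

theorem norm_le_wsum (m : ℕ) {K : Finset (Fin n → ℤ)} {k : Fin n → ℤ} (hk : k ∈ K) (hk0 : k ≠ 0)
    (a : (Fin n → ℤ) → EuclideanSpace ℂ (Fin n)) : ‖kvec k‖ ^ m * ‖a k‖ ≤ wsum m K a :=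
  Finset.single_le_sum (f := fun k => ‖kvec k‖ ^ m * ‖a k‖) (fun _ _ => by positivity)
    (Finset.mem_erase.2 ⟨hk0, hk⟩)

/-- Since `l · a_l = 0`, one has `k · a_l = (k - l) · a_l`: in the estimate of the advection the
derivative falls on `b`. -/
theorem norm_advection_sub_le {a b : (Fin n → ℤ) → EuclideanSpace ℂ (Fin n)}
    {K : Finset (Fin n → ℤ)} (ha : ∀ k ∉ K, a k = 0) (hdiv : IsDivFreeFamily a) (k : Fin n → ℤ) :
    ‖advection a b k - inner ℂ (kvec k) (a 0) • b k‖ ≤ advBound K a b k := by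
  have h : advection a b k - inner ℂ (kvec k) (a 0) • b k =
      ∑ l ∈ K.erase 0, inner ℂ (kvec k) (a l) • b (k - l) := by
    rw [advection_eq_sum ha, sub_eq_iff_eq_add]
    by_cases h0 : (0 : Fin n → ℤ) ∈ K
    · rw [← Finset.sum_erase_add _ _ h0, sub_zero]
    · rw [Finset.erase_eq_of_notMem h0, ha 0 h0]
      simp
  rw [h]
  refine (norm_sum_le _ _).trans (Finset.sum_le_sum fun l _ => ?_)
  have e : inner ℂ (kvec k) (a l) = inner ℂ (kvec (k - l)) (a l) := by
    rw [kvec_sub, inner_sub_left, hdiv l, sub_zero]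
  rw [norm_smul, e]
  calc _ ≤ (‖kvec (k - l)‖ * ‖a l‖) * ‖b (k - l)‖ := by
        gcongr; exact norm_inner_le_norm _ _
    _ = _ := by ring

/-- Young's inequality for a convolution on the finite set `K`: the pairs `(l, k - l)` are
reindexed as `(l, j)`, where only `j ∈ K` contributes. -/
theorem sum_mul_conv_le {G : Type*} [AddCommGroup G] [DecidableEq G] (K : Finset G) {w p q : G → ℝ}
    (hw : ∀ k, 0 ≤ w k) (hp : ∀ k, 0 ≤ p k) (hq : ∀ k, 0 ≤ q k) (hqK : ∀ k ∉ K, q k = 0) :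
    ∑ k ∈ K, w k * ∑ l ∈ K, p l * q (k - l) ≤ ∑ l ∈ K, ∑ j ∈ K, w (l + j) * (p l * q j) := by
  simp_rw [Finset.mul_sum]
  rw [Finset.sum_comm]
  refine Finset.sum_le_sum fun l _ => ?_
  calc ∑ k ∈ K, w k * (p l * q (k - l))
      = ∑ j ∈ K.image (fun k => k - l), w (l + j) * (p l * q j) := by
        rw [Finset.sum_image (fun x _ y _ h => sub_left_injective h)]
        simp
    _ = ∑ j ∈ (K.image (fun k => k - l)).filter (· ∈ K), w (l + j) * (p l * q j) := by
        refine (Finset.sum_filter_of_ne fun j _ hj => ?_).symm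
        by_contra hjK
        simp [hqK j hjK] at hj
    _ ≤ _ := by
        refine Finset.sum_le_sum_of_subset_of_nonneg (fun j hj => (Finset.mem_filter.1 hj).2)
          fun j _ _ => ?_
        exact mul_nonneg (hw _) (mul_nonneg (hp _) (hq _))

theorem sum_advBound_le (K : Finset (Fin n → ℤ)) (a b : (Fin n → ℤ) → EuclideanSpace ℂ (Fin n))
    (hb : ∀ k ∉ K, b k = 0) {w : (Fin n → ℤ) → ℝ} (hw : ∀ k, 0 ≤ w k) :
    ∑ k ∈ K.erase 0, w k * advBound K a b k ≤
      ∑ l ∈ K.erase 0, ∑ j ∈ K.erase 0, w (l + j) * (‖a l‖ * (‖kvec j‖ * ‖b j‖)) := by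
  refine sum_mul_conv_le (K.erase 0) (p := fun l => ‖a l‖) (q := fun j => ‖kvec j‖ * ‖b j‖) hw
    (fun _ => norm_nonneg _) (fun _ => by positivity) fun k hk => ?_
  by_cases hk0 : k = 0
  · simp [hk0]
  · simp [hb k fun h => hk (Finset.mem_erase.2 ⟨hk0, h⟩)]

/-- The advection is bounded by `‖a‖₀ ‖b‖₁` in the norm `wsum 0`. The constant `1` here is what
makes the threshold `ν` and the life span `2ν / ‖u₀‖²` come out. -/
theorem sum_advBound_le_wsum (K : Finset (Fin n → ℤ))
    (a b : (Fin n → ℤ) → EuclideanSpace ℂ (Fin n)) (hb : ∀ k ∉ K, b k = 0) :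
    ∑ k ∈ K.erase 0, advBound K a b k ≤ wsum 0 K a * wsum 1 K b := by
  have := sum_advBound_le K a b hb (w := fun _ => 1) (fun _ => zero_le_one)
  simp only [one_mul] at this
  refine this.trans (le_of_eq ?_)
  simp only [wsum, pow_zero, one_mul, pow_one]
  rw [Finset.sum_mul_sum]

/-- The advection in the norm `wsum m` is bounded linearly in the highest norm `wsum (m + 1)`;
the other factor is only `wsum 0`, so that control of `wsum 0` controls all norms. -/
theorem sum_pow_mul_advBound_le (m : ℕ) (K : Finset (Fin n → ℤ))
    (a : (Fin n → ℤ) → EuclideanSpace ℂ (Fin n)) (ha : ∀ k ∉ K, a k = 0) :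
    ∑ k ∈ K.erase 0, ‖kvec k‖ ^ m * advBound K a a k ≤
      2 ^ (m + 1) * (wsum 0 K a * wsum (m + 1) K a) := by
  refine (sum_advBound_le K a a ha (w := fun k => ‖kvec k‖ ^ m) fun _ => by positivity).trans ?_
  have h : ∀ l j : Fin n → ℤ, ‖kvec (l + j)‖ ^ m * (‖a l‖ * (‖kvec j‖ * ‖a j‖)) ≤
      2 ^ m * ((‖kvec l‖ ^ (m + 1) * ‖a l‖) * ‖a j‖ + ‖a l‖ * (‖kvec j‖ ^ (m + 1) * ‖a j‖)) := by
    intro l j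
    have h1 : ‖kvec (l + j)‖ ^ m * ‖kvec j‖ ≤
        2 ^ m * (‖kvec l‖ ^ (m + 1) + ‖kvec j‖ ^ (m + 1)) := by
      calc ‖kvec (l + j)‖ ^ m * ‖kvec j‖ ≤ (‖kvec l‖ + ‖kvec j‖) ^ m * (‖kvec l‖ + ‖kvec j‖) := by
            rw [kvec_add]
            gcongr
            · exact norm_add_le _ _
            · exact le_add_of_nonneg_left (norm_nonneg _)
        _ = (‖kvec l‖ + ‖kvec j‖) ^ (m + 1) := (pow_succ _ _).symm
        _ ≤ _ := add_pow_le (norm_nonneg _) (norm_nonneg _) (m + 1)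
    calc _ = (‖kvec (l + j)‖ ^ m * ‖kvec j‖) * (‖a l‖ * ‖a j‖) := by ring
      _ ≤ (2 ^ m * (‖kvec l‖ ^ (m + 1) + ‖kvec j‖ ^ (m + 1))) * (‖a l‖ * ‖a j‖) := by gcongr
      _ = _ := by ring
  refine (Finset.sum_le_sum fun l _ => Finset.sum_le_sum fun j _ => h l j).trans (le_of_eq ?_)
  simp_rw [← Finset.mul_sum, Finset.sum_add_distrib]
  simp only [wsum, pow_zero, one_mul]
  rw [← Finset.sum_mul_sum, ← Finset.sum_mul_sum]
  ring

/-- Young's inequality `|k|^{m+1} ≤ c |k|^{m+2} + |k|^m / (4c)`, summed. -/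
theorem mul_wsum_succ_le (m : ℕ) (K : Finset (Fin n → ℤ))
    (a : (Fin n → ℤ) → EuclideanSpace ℂ (Fin n)) {c : ℝ} (hc : 0 < c) (B : ℝ) :
    B * wsum (m + 1) K a ≤ c * wsum (m + 2) K a + B ^ 2 / (4 * c) * wsum m K a := by
  simp only [wsum, Finset.mul_sum, ← Finset.sum_add_distrib]
  refine Finset.sum_le_sum fun k _ => ?_
  have h : B * ‖kvec k‖ ≤ c * ‖kvec k‖ ^ 2 + B ^ 2 / (4 * c) := by
    rw [← sub_nonneg]
    have : c * ‖kvec k‖ ^ 2 + B ^ 2 / (4 * c) - B * ‖kvec k‖ =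
      (2 * c * ‖kvec k‖ - B) ^ 2 / (4 * c) := by field_simp; ring
    rw [this]; positivity
  have := mul_le_mul_of_nonneg_right h (by positivity : 0 ≤ ‖kvec k‖ ^ m * ‖a k‖)
  calc _ = (B * ‖kvec k‖) * (‖kvec k‖ ^ m * ‖a k‖) := by ring
    _ ≤ _ := this
    _ = _ := by ring

/-! ### Galerkin approximation -/

/-- The right-hand side of the Navier–Stokes equation on the Fourier side. -/
noncomputable def nsField (ν : ℝ) (a : (Fin n → ℤ) → EuclideanSpace ℂ (Fin n)) (k : Fin n → ℤ) :
    EuclideanSpace ℂ (Fin n) :=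
  leray k (-(ν * ‖kvec k‖ ^ 2) • a k - Complex.I • advection a a k)

theorem advection_neg_freq {a : (Fin n → ℤ) → EuclideanSpace ℂ (Fin n)} {K : Finset (Fin n → ℤ)}
    (hK : ∀ k ∈ K, -k ∈ K) (ha : ∀ k ∉ K, a k = 0) (hr : IsRealFamily a) (k : Fin n → ℤ) :
    advection a a (-k) = -conjVec (advection a a k) := by
  rw [advection_eq_sum ha, advection_eq_sum ha, conjVec_sum, ← Finset.sum_neg_distrib]
  refine Finset.sum_nbij' (fun l => -l) (fun l => -l) hK hK (fun l _ => neg_neg l)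
    (fun l _ => neg_neg l) fun l _ => ?_
  have e : a (-k - l) = conjVec (a (k - -l)) := by rw [← hr]; congr 1; abel
  rw [conjVec_smul, ← inner_kvec_conjVec, ← hr, neg_neg, e, kvec_neg, inner_neg_left, neg_smul]

theorem nsField_neg_freq {ν : ℝ} {a : (Fin n → ℤ) → EuclideanSpace ℂ (Fin n)}
    {K : Finset (Fin n → ℤ)} (hK : ∀ k ∈ K, -k ∈ K) (ha : ∀ k ∉ K, a k = 0) (hr : IsRealFamily a)
    (k : Fin n → ℤ) : nsField ν a (-k) = conjVec (nsField ν a k) := by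
  rw [nsField, nsField, advection_neg_freq hK ha hr, leray_neg_freq, ← leray_conjVec, conjVec_sub,
    conjVec_smul, conjVec_smul_real, hr, kvec_neg, norm_neg, Complex.conj_I]
  simp

/-- Extension by zero of a family of coefficients given on a finite set of frequencies. -/
noncomputable def extendZero {K : Finset (Fin n → ℤ)} (c : K → EuclideanSpace ℂ (Fin n))
    (k : Fin n → ℤ) : EuclideanSpace ℂ (Fin n) :=
  if h : k ∈ K then c ⟨k, h⟩ else 0

theorem extendZero_of_mem {K : Finset (Fin n → ℤ)} (c : K → EuclideanSpace ℂ (Fin n))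
    {k : Fin n → ℤ} (h : k ∈ K) : extendZero c k = c ⟨k, h⟩ := dif_pos h

theorem extendZero_of_notMem {K : Finset (Fin n → ℤ)} (c : K → EuclideanSpace ℂ (Fin n))
    {k : Fin n → ℤ} (h : k ∉ K) : extendZero c k = 0 := dif_neg h

theorem contDiff_extendZero {K : Finset (Fin n → ℤ)} (k : Fin n → ℤ) :
    ContDiff ℝ ∞ fun c : K → EuclideanSpace ℂ (Fin n) => extendZero c k := by
  by_cases h : k ∈ K
  · simp only [extendZero, h, dite_true]
    exact contDiff_apply ℝ _ _
  · simp only [extendZero, h, dite_false]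
    exact contDiff_const

/-- Complex conjugation of `ℂⁿ` as a real linear map. -/
noncomputable def conjVecL : EuclideanSpace ℂ (Fin n) →L[ℝ] EuclideanSpace ℂ (Fin n) :=
  ⟨⟨⟨conjVec, conjVec_add⟩, conjVec_smul_real⟩, continuous_conjVec⟩

theorem contDiff_nsField_extendZero (ν : ℝ) {K : Finset (Fin n → ℤ)} (k : Fin n → ℤ) :
    ContDiff ℝ ∞ fun c : K → EuclideanSpace ℂ (Fin n) => nsField ν (extendZero c) k := by
  have h : ∀ c : K → EuclideanSpace ℂ (Fin n), nsField ν (extendZero c) k =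
      leray k (-(ν * ‖kvec k‖ ^ 2) • extendZero c k - Complex.I •
        ∑ l ∈ K, inner ℂ (kvec k) (extendZero c l) • extendZero c (k - l)) := fun c => by
    rw [nsField, advection_eq_sum fun k => extendZero_of_notMem c]
  simp_rw [h]
  refine ((leray k).restrictScalars ℝ).contDiff.comp (ContDiff.sub
    ((contDiff_extendZero k).const_smul _) (ContDiff.const_smul _ (ContDiff.sum fun l _ => ?_)))
  exact (contDiff_const.inner ℂ (contDiff_extendZero l)).smul (contDiff_extendZero (k - l))

/-- `a` solves the Galerkin system on the frequencies in `K` up to time `T`, slowed down by a time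
dependent factor `φ ∈ [0, 1]`. -/
structure IsGalerkinSolution (ν T : ℝ) (K : Finset (Fin n → ℤ)) (φ : ℝ → ℝ)
    (a : ℝ → (Fin n → ℤ) → EuclideanSpace ℂ (Fin n)) : Prop where
  support : ∀ t, ∀ k ∉ K, a t k = 0
  real : ∀ t ∈ Icc 0 T, IsRealFamily (a t)
  divFree : ∀ t ∈ Icc 0 T, IsDivFreeFamily (a t)
  deriv : ∀ k ∈ K, ∀ t ∈ Icc 0 T,
    HasDerivWithinAt (fun s => a s k) (φ t • nsField ν (a t) k) (Icc 0 T) t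
  continuousOn_factor : ContinuousOn φ (Icc 0 T)
  factor_mem : ∀ t ∈ Icc 0 T, φ t ∈ Icc (0 : ℝ) 1

/-- A compactly supported smooth vector field is bounded and Lipschitz, so that its integral curves
exist up to any time. -/
theorem exists_integralCurve_of_contDiff_hasCompactSupport {E : Type*} [NormedAddCommGroup E]
    [NormedSpace ℝ E] [CompleteSpace E] {G : E → E} (hG : ContDiff ℝ ∞ G)
    (hc : HasCompactSupport G) (x₀ : E) {T : ℝ} (hT : 0 ≤ T) :
    ∃ x : ℝ → E, x 0 = x₀ ∧ ∀ t ∈ Icc 0 T, HasDerivWithinAt x (G (x t)) (Icc 0 T) t := by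
  obtain ⟨C, hC⟩ := hG.lipschitzWith_of_hasCompactSupport hc (by simp)
  obtain ⟨L, hL⟩ := hc.exists_bound_of_continuous hG.continuous
  have hL0 : 0 ≤ L := (norm_nonneg _).trans (hL x₀)
  have hP : IsPicardLindelof (fun _ => G) (⟨0, le_rfl, hT⟩ : Icc (0 : ℝ) T) x₀
      (⟨L * T, mul_nonneg hL0 hT⟩ : ℝ≥0) 0 (⟨L, hL0⟩ : ℝ≥0) C := by
    refine IsPicardLindelof.of_time_independent (fun x _ => hL x) hC.lipschitzOnWith ?_
    simp [hT]
    exact le_rfl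
  obtain ⟨x, hx0, hx⟩ := hP.exists_eq_forall_mem_Icc_hasDerivWithinAt₀
  exact ⟨x, hx0, hx⟩

theorem eq_of_hasDerivWithinAt_zero {E : Type*} [NormedAddCommGroup E] [NormedSpace ℝ E] {T : ℝ}
    {f : ℝ → E} (hf : ∀ t ∈ Icc 0 T, HasDerivWithinAt f 0 (Icc 0 T) t) {t : ℝ} (ht : t ∈ Icc 0 T) :
    f t = f 0 := by
  have := (convex_Icc 0 T).norm_image_sub_le_of_norm_hasDerivWithin_le (C := 0) hf
    (fun s _ => by simp) ⟨le_rfl, ht.1.trans ht.2⟩ ht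
  rwa [zero_mul, norm_le_zero_iff, sub_eq_zero] at this

/-- The Galerkin system with its field cut off outside a ball of radius `ρ` is solvable up to any
time; the cut-off appears as the factor `φ`, which is `1` as long as the solution is bounded by
`ρ`. -/
theorem exists_isGalerkinSolution (ν : ℝ) {T : ℝ} (hT : 0 ≤ T) {K : Finset (Fin n → ℤ)}
    (hK : ∀ k ∈ K, -k ∈ K) {a₀ : (Fin n → ℤ) → EuclideanSpace ℂ (Fin n)} (hr : IsRealFamily a₀)
    (hd : IsDivFreeFamily a₀) {ρ : ℝ} (hρ : 0 < ρ) :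
    ∃ φ a, IsGalerkinSolution ν T K φ a ∧ (∀ k ∈ K, a 0 k = a₀ k) ∧
      ∀ t ∈ Icc 0 T, ∑ k ∈ K, ‖a t k‖ ≤ ρ → φ t = 1 := by
  let ψ : ContDiffBump (0 : K → EuclideanSpace ℂ (Fin n)) := ⟨ρ, ρ + 1, hρ, by linarith⟩
  -- The field is cut off by `ψ`, and symmetrised, which makes reality of the field automatic.
  let G : (K → EuclideanSpace ℂ (Fin n)) → K → EuclideanSpace ℂ (Fin n) := fun c => ψ c •
    fun k : K => (1 / 2 : ℝ) •
      (nsField ν (extendZero c) k + conjVec (nsField ν (extendZero c) (-k)))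
  have hG : ContDiff ℝ ∞ G := by
    refine ψ.contDiff.smul (contDiff_pi.2 fun k => ContDiff.const_smul _ (ContDiff.add ?_ ?_))
    · exact contDiff_nsField_extendZero ν _
    · exact (conjVecL (n := n)).contDiff.comp (contDiff_nsField_extendZero ν _)
  have hGc : HasCompactSupport G := ψ.hasCompactSupport.smul_right
  obtain ⟨x, hx0, hx⟩ := exists_integralCurve_of_contDiff_hasCompactSupport hG hGc
    (fun k : K => a₀ k) hT
  set a : ℝ → (Fin n → ℤ) → EuclideanSpace ℂ (Fin n) := fun t => extendZero (x t) with ha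
  have hxk : ∀ k ∈ K, ∀ t ∈ Icc 0 T, HasDerivWithinAt (fun s => a s k) (ψ (x t) • (1 / 2 : ℝ) •
      (nsField ν (a t) k + conjVec (nsField ν (a t) (-k)))) (Icc 0 T) t := by
    intro k hk t ht
    have := hasDerivWithinAt_pi.1 (hx t ht) ⟨k, hk⟩
    refine this.congr_deriv rfl |>.congr_of_mem (fun s hs => ?_) ht
    exact extendZero_of_mem _ hk
  have hsupp : ∀ t, ∀ k ∉ K, a t k = 0 := fun t k hk => extendZero_of_notMem _ hk
  have hinit : ∀ k ∈ K, a 0 k = a₀ k := fun k hk => by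
    simp only [ha, hx0]; exact extendZero_of_mem _ hk
  have hreal : ∀ t ∈ Icc 0 T, IsRealFamily (a t) := by
    intro t ht k
    by_cases hk : k ∈ K
    · have h0 : ∀ s ∈ Icc 0 T, HasDerivWithinAt (fun s => a s (-k) - conjVec (a s k)) 0
          (Icc 0 T) s := by
        intro s hs
        have h1 := hxk k hk s hs
        have h2 : HasDerivWithinAt (fun s => conjVec (a s k)) (conjVec (ψ (x s) • (1 / 2 : ℝ) •
            (nsField ν (a s) k + conjVec (nsField ν (a s) (-k))))) (Icc 0 T) s := by
          exact (conjVecL (n := n)).hasFDerivAt.comp_hasDerivWithinAt s h1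
        refine ((hxk (-k) (hK k hk) s hs).sub h2).congr_deriv ?_
        simp only [conjVec_smul_real, conjVec_add, conjVec_conjVec, neg_neg]
        rw [add_comm, sub_self]
      have h1 := eq_of_hasDerivWithinAt_zero h0 ht
      rw [hinit k hk, hinit _ (hK k hk), hr k, sub_self] at h1
      exact sub_eq_zero.1 h1
    · have hk' : -k ∉ K := fun h => hk (by simpa using hK _ h)
      rw [hsupp t k hk, hsupp t _ hk']
      ext i; simp
  refine ⟨fun t => ψ (x t), a, ⟨hsupp, hreal, fun t ht k => ?_, fun k hk t ht => ?_, ?_, ?_⟩,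
    hinit, fun t ht h => ?_⟩
  · by_cases hk : k ∈ K
    · have h0 : ∀ s ∈ Icc 0 T, HasDerivWithinAt (fun s => inner ℂ (kvec k) (a s k)) 0
          (Icc 0 T) s := by
        intro s hs
        have h1 := hxk k hk s hs
        have h2 := ((innerSL ℂ (kvec k)).restrictScalars ℝ).hasFDerivAt.comp_hasDerivWithinAt s h1
        refine h2.congr_deriv ?_
        rw [nsField_neg_freq hK (hsupp s) (hreal s hs), conjVec_conjVec]
        rw [← two_smul ℝ, ← Complex.coe_smul, ← Complex.coe_smul, ← Complex.coe_smul, nsField,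
          ← map_smul, ← map_smul, ← map_smul]
        exact inner_kvec_leray k _
      have h1 := eq_of_hasDerivWithinAt_zero h0 ht
      rw [hinit k hk, hd k] at h1
      exact h1
    · rw [hsupp t k hk, inner_zero_right]
  · refine (hxk k hk t ht).congr_deriv ?_
    rw [nsField_neg_freq hK (hsupp t) (hreal t ht), conjVec_conjVec, ← two_smul ℝ,
      smul_smul, smul_smul]
    congr 1
    ring
  · exact ψ.continuous.comp_continuousOn fun t ht => (hx t ht).continuousWithinAt
  · exact fun t _ => ⟨ψ.nonneg, ψ.le_one⟩
  · apply ψ.one_of_mem_closedBall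
    rw [mem_closedBall_zero_iff, pi_norm_le_iff_of_nonneg hρ.le]
    intro k
    refine le_trans ?_ h
    have := Finset.single_le_sum (f := fun k => ‖a t k‖) (fun _ _ => norm_nonneg _) k.2
    simpa [ha, extendZero_of_mem _ k.2] using this

/-! ### A priori estimates for the Galerkin approximation -/

theorem inner_kvec_zero_eq_re {a : (Fin n → ℤ) → EuclideanSpace ℂ (Fin n)} (hr : IsRealFamily a)
    (k : Fin n → ℤ) : inner ℂ (kvec k) (a 0) = ((inner ℂ (kvec k) (a 0)).re : ℂ) := by
  refine (Complex.conj_eq_iff_re.1 ?_).symm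
  rw [← inner_kvec_conjVec, ← hr 0, neg_zero]

/-- The mean of `a` only rotates the phase of the coefficients of `b`. -/
theorem neg_re_inner_advection_le {a b : (Fin n → ℤ) → EuclideanSpace ℂ (Fin n)}
    {K : Finset (Fin n → ℤ)} (ha : ∀ k ∉ K, a k = 0) (hdiv : IsDivFreeFamily a)
    (hr : IsRealFamily a) (k : Fin n → ℤ) :
    -(inner ℂ (b k) (Complex.I • advection a b k)).re ≤ ‖b k‖ * advBound K a b k := by
  set R := advection a b k - inner ℂ (kvec k) (a 0) • b k with hR
  have hRle : ‖R‖ ≤ advBound K a b k := norm_advection_sub_le ha hdiv k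
  have e : advection a b k = ((inner ℂ (kvec k) (a 0)).re : ℂ) • b k + R := by
    rw [hR, ← inner_kvec_zero_eq_re hr]; abel
  rw [e, inner_smul_right, inner_add_right, inner_smul_right, inner_self_eq_norm_sq_to_K, mul_add,
    Complex.add_re]
  have e1 : (Complex.I * (((inner ℂ (kvec k) (a 0)).re : ℂ) * ((‖b k‖ : ℝ) : ℂ) ^ 2)).re = 0 := by
    rw [← Complex.ofReal_pow, ← Complex.ofReal_mul, Complex.I_mul_re, Complex.ofReal_im, neg_zero]
  have e2 : |(Complex.I * inner ℂ (b k) R).re| ≤ ‖b k‖ * ‖R‖ := by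
    refine (Complex.abs_re_le_norm _).trans ?_
    rw [norm_mul, Complex.norm_I, one_mul]
    exact norm_inner_le_norm _ _
  have e3 := mul_le_mul_of_nonneg_left hRle (norm_nonneg (b k))
  have e4 := neg_abs_le (Complex.I * inner ℂ (b k) R).re
  erw [e1]
  linarith

/-- If `a` has mean zero, the advection of `b` by `a` can be tested with any vector. -/
theorem neg_re_inner_advection_le_of_zero {a b : (Fin n → ℤ) → EuclideanSpace ℂ (Fin n)}
    {K : Finset (Fin n → ℤ)} (ha : ∀ k ∉ K, a k = 0) (hdiv : IsDivFreeFamily a)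
    (h0 : a 0 = 0) (k : Fin n → ℤ) (x : EuclideanSpace ℂ (Fin n)) :
    -(inner ℂ x (Complex.I • advection a b k)).re ≤ ‖x‖ * advBound K a b k := by
  have h := norm_advection_sub_le (b := b) ha hdiv k
  rw [h0, inner_zero_right, zero_smul, sub_zero] at h
  have e2 : |(inner ℂ x (Complex.I • advection a b k)).re| ≤ ‖x‖ * ‖advection a b k‖ := by
    refine (Complex.abs_re_le_norm _).trans ((norm_inner_le_norm _ _).trans_eq ?_)
    rw [norm_smul, Complex.norm_I, one_mul]
  have e3 := mul_le_mul_of_nonneg_left h (norm_nonneg x)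
  have e4 := neg_abs_le (inner ℂ x (Complex.I • advection a b k)).re
  linarith

theorem real_inner_eq_re (v w : EuclideanSpace ℂ (Fin n)) : inner ℝ v w = (inner ℂ v w).re := by
  simp [PiLp.inner_apply, Complex.inner, mul_comm]

/-- The Leray projection can be dropped when testing with `a k`, as `k · a k = 0`. -/
theorem real_inner_nsField_le {ν : ℝ} {a : (Fin n → ℤ) → EuclideanSpace ℂ (Fin n)}
    {K : Finset (Fin n → ℤ)} (ha : ∀ k ∉ K, a k = 0) (hdiv : IsDivFreeFamily a)
    (hr : IsRealFamily a) (k : Fin n → ℤ) :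
    inner ℝ (a k) (nsField ν a k) ≤ ‖a k‖ * advBound K a a k - ν * ‖kvec k‖ ^ 2 * ‖a k‖ ^ 2 := by
  have h := neg_re_inner_advection_le (b := a) ha hdiv hr k
  rw [real_inner_eq_re, nsField, inner_leray_right (hdiv k), inner_sub_right, Complex.sub_re,
    ← Complex.coe_smul, inner_smul_right, inner_self_eq_norm_sq_to_K]
  have e1 : (((-(ν * ‖kvec k‖ ^ 2) : ℝ) : ℂ) * ((‖a k‖ : ℝ) : ℂ) ^ 2).re =
      -(ν * ‖kvec k‖ ^ 2) * ‖a k‖ ^ 2 := by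
    rw [← Complex.ofReal_pow, ← Complex.ofReal_mul, Complex.ofReal_re]
  erw [e1]
  linarith

namespace IsGalerkinSolution

variable {ν T : ℝ} {K : Finset (Fin n → ℤ)} {φ : ℝ → ℝ}
  {a : ℝ → (Fin n → ℤ) → EuclideanSpace ℂ (Fin n)}

theorem continuousOn (h : IsGalerkinSolution ν T K φ a) (k : Fin n → ℤ) :
    ContinuousOn (fun t => a t k) (Icc 0 T) := by
  by_cases hk : k ∈ K
  · exact fun t ht => (h.deriv k hk t ht).continuousWithinAt
  · simp only [h.support _ k hk]; exact continuousOn_const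

theorem continuousOn_wsum (h : IsGalerkinSolution ν T K φ a) (m : ℕ) (K' : Finset (Fin n → ℤ)) :
    ContinuousOn (fun t => wsum m K' (a t)) (Icc 0 T) :=
  continuousOn_finsetSum _ fun k _ => continuousOn_const.mul (h.continuousOn k).norm

theorem continuousOn_advBound (h : IsGalerkinSolution ν T K φ a) (K' : Finset (Fin n → ℤ))
    (k : Fin n → ℤ) : ContinuousOn (fun t => advBound K' (a t) (a t) k) (Icc 0 T) :=
  continuousOn_finsetSum _ fun l _ => (h.continuousOn l).norm.mul
    (continuousOn_const.mul (h.continuousOn _).norm)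

theorem norm_le (h : IsGalerkinSolution ν T K φ a) (hν : 0 < ν) {k : Fin n → ℤ} (hk : k ∈ K)
    {t : ℝ} (ht : t ∈ Icc 0 T) :
    ‖a t k‖ ≤ ‖a 0 k‖ + ∫ s in (0 : ℝ)..t, (φ s * advBound K (a s) (a s) k -
      φ s * (ν * ‖kvec k‖ ^ 2) * ‖a s k‖) := by
  refine norm_le_add_integral (c := fun s => φ s * (ν * ‖kvec k‖ ^ 2))
    (g := fun s => φ s * advBound K (a s) (a s) k) (h.deriv k hk)
    (h.continuousOn_factor.mul continuousOn_const)
    (h.continuousOn_factor.mul (h.continuousOn_advBound K k)) (fun s hs => ?_) (fun s hs => ?_)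
    (fun s hs => ?_) ht
  · exact mul_nonneg (h.factor_mem s hs).1 (by positivity)
  · exact mul_nonneg (h.factor_mem s hs).1 (advBound_nonneg _ _ _ _)
  · rw [real_inner_smul_right]
    have := mul_le_mul_of_nonneg_left (real_inner_nsField_le (ν := ν) (h.support s) (h.divFree s hs)
      (h.real s hs) k) (h.factor_mem s hs).1
    linarith

/-- The differential inequality `‖a‖ₘ' ≤ ‖advection‖ₘ - ν ‖a‖ₘ₊₂`, in integrated form. -/
theorem wsum_le_add_integral (h : IsGalerkinSolution ν T K φ a) (hν : 0 < ν) (m : ℕ)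
    {t : ℝ} (ht : t ∈ Icc 0 T) :
    wsum m K (a t) ≤ wsum m K (a 0) + ∫ s in (0 : ℝ)..t, φ s *
      ((∑ k ∈ K.erase 0, ‖kvec k‖ ^ m * advBound K (a s) (a s) k) - ν * wsum (m + 2) K (a s)) := by
  have hI : ∀ k, IntervalIntegrable (fun s => φ s * advBound K (a s) (a s) k -
      φ s * (ν * ‖kvec k‖ ^ 2) * ‖a s k‖) volume 0 t := fun k =>
    (((h.continuousOn_factor.mul (h.continuousOn_advBound K k)).sub
      ((h.continuousOn_factor.mul continuousOn_const).mul (h.continuousOn k).norm)).mono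
        (Icc_subset_Icc le_rfl ht.2)).intervalIntegrable_of_Icc ht.1
  calc wsum m K (a t) ≤ ∑ k ∈ K.erase 0, ‖kvec k‖ ^ m * (‖a 0 k‖ + ∫ s in (0 : ℝ)..t,
        (φ s * advBound K (a s) (a s) k - φ s * (ν * ‖kvec k‖ ^ 2) * ‖a s k‖)) := by
        refine Finset.sum_le_sum fun k hk => ?_
        gcongr
        exact h.norm_le hν (Finset.mem_of_mem_erase hk) ht
    _ = _ := by
        simp_rw [mul_add, Finset.sum_add_distrib, ← intervalIntegral.integral_const_mul]
        rw [← intervalIntegral.integral_finsetSum fun k _ => (hI k).const_mul _]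
        congr 1
        refine intervalIntegral.integral_congr fun s _ => ?_
        simp only [wsum, Finset.mul_sum, mul_sub, ← Finset.sum_sub_distrib]
        exact Finset.sum_congr rfl fun k _ => by ring

theorem continuousOn_rate (h : IsGalerkinSolution ν T K φ a) (m : ℕ) :
    ContinuousOn (fun s => φ s * ((∑ k ∈ K.erase 0, ‖kvec k‖ ^ m * advBound K (a s) (a s) k) -
      ν * wsum (m + 2) K (a s))) (Icc 0 T) :=
  h.continuousOn_factor.mul ((continuousOn_finsetSum _ fun k _ =>
    continuousOn_const.mul (h.continuousOn_advBound K k)).sub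
      (continuousOn_const.mul (h.continuousOn_wsum _ _)))

/-- From `‖a‖₀' ≤ ‖a‖₀ ‖a‖₁ - ν ‖a‖₂` and `‖a‖₁ ≤ ‖a‖₂`: the bound `‖a‖₀ ≤ ν` persists. -/
theorem wsum_zero_le_of_le (h : IsGalerkinSolution ν T K φ a) (hν : 0 < ν)
    (h0 : wsum 0 K (a 0) ≤ ν) {t : ℝ} (ht : t ∈ Icc 0 T) : wsum 0 K (a t) ≤ ν := by
  refine le_of_le_add_integral_sub_mul (A := fun s => φ s * wsum 2 K (a s)) h0
    (h.continuousOn_wsum 0 K) (h.continuousOn_rate 0)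
    (h.continuousOn_factor.mul (h.continuousOn_wsum 2 K))
    (fun s hs => mul_nonneg (h.factor_mem s hs).1 (wsum_nonneg _ _ _))
    (fun s hs => h.wsum_le_add_integral hν 0 hs) (fun s hs => ?_) ht
  have e1 := sum_advBound_le_wsum K (a s) (a s) (h.support s)
  have e2 := mul_le_mul_of_nonneg_left (wsum_le_wsum_succ 1 K (a s)) (wsum_nonneg 0 K (a s))
  have e3 : (∑ k ∈ K.erase 0, ‖kvec k‖ ^ 0 * advBound K (a s) (a s) k) - ν * wsum (0 + 2) K (a s) ≤
      (wsum 0 K (a s) - ν) * wsum 2 K (a s) := by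
    simp only [pow_zero, one_mul, zero_add]
    norm_num at e2 ⊢
    linarith
  have := mul_le_mul_of_nonneg_left e3 (h.factor_mem s hs).1
  linarith

/-- From `‖a‖₀' ≤ ‖a‖₀ ‖a‖₁ - ν ‖a‖₂ ≤ ‖a‖₀³ / (4ν)`, by Young's inequality: the norm stays bounded
up to any time below `2ν / ‖a(0)‖₀²`. -/
theorem wsum_zero_le_sqrt (h : IsGalerkinSolution ν T K φ a) (hν : 0 < ν) {y₁ : ℝ} (hy₁ : 0 < y₁)
    (hT : T * y₁ ^ 2 < 2 * ν) (h0 : wsum 0 K (a 0) ≤ y₁) {t : ℝ} (ht : t ∈ Icc 0 T) :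
    wsum 0 K (a t) ≤ √((1 / y₁ ^ 2 - T / (2 * ν))⁻¹) := by
  refine le_of_le_add_integral_cube hν hy₁ hT (h.continuousOn_wsum 0 K) (h.continuousOn_rate 0)
    (fun s _ => wsum_nonneg _ _ _) (fun s hs => (h.wsum_le_add_integral hν 0 hs).trans
      (add_le_add_left h0 _)) (fun s hs => ?_) ht
  have e1 := sum_advBound_le_wsum K (a s) (a s) (h.support s)
  have e2 := mul_wsum_succ_le 0 K (a s) hν (wsum 0 K (a s))
  have e3 : (∑ k ∈ K.erase 0, ‖kvec k‖ ^ 0 * advBound K (a s) (a s) k) - ν * wsum (0 + 2) K (a s) ≤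
      wsum 0 K (a s) ^ 3 / (4 * ν) := by
    simp only [pow_zero, one_mul, zero_add] at e2 ⊢
    have : wsum 0 K (a s) ^ 2 / (4 * ν) * wsum 0 K (a s) = wsum 0 K (a s) ^ 3 / (4 * ν) := by ring
    linarith
  have e4 : 0 ≤ wsum 0 K (a s) ^ 3 / (4 * ν) :=
    div_nonneg (pow_nonneg (wsum_nonneg _ _ _) 3) (by positivity)
  exact (mul_le_mul_of_nonneg_left e3 (h.factor_mem s hs).1).trans
    (mul_le_of_le_one_left e4 (h.factor_mem s hs).2)

/-- A bound on the norm `wsum 0` propagates all higher norms. -/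
theorem wsum_le_exp (h : IsGalerkinSolution ν T K (fun _ => 1) a) (hν : 0 < ν) {R : ℝ}
    (hR : ∀ t ∈ Icc 0 T, wsum 0 K (a t) ≤ R) (m : ℕ) {t : ℝ} (ht : t ∈ Icc 0 T) :
    wsum m K (a t) ≤ wsum m K (a 0) * Real.exp ((2 ^ (m + 1) * R) ^ 2 / (4 * ν) * T) := by
  have := le_exp_of_le_add_integral (K := (2 ^ (m + 1) * R) ^ 2 / (4 * ν)) (b := 0)
    (by positivity) le_rfl (h.continuousOn_rate m) (wsum_nonneg m K (a 0))
    (fun s hs => h.wsum_le_add_integral hν m hs) (fun s hs => ?_) ht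
  · simpa using this
  · have e1 := sum_pow_mul_advBound_le m K (a s) (h.support s)
    have e2 := mul_wsum_succ_le m K (a s) hν (2 ^ (m + 1) * R)
    have e3 := mul_le_mul_of_nonneg_right (hR s hs) (wsum_nonneg (m + 1) K (a s))
    have e4 := mul_le_mul_of_nonneg_left e3 (by positivity : (0 : ℝ) ≤ 2 ^ (m + 1))
    simp only [one_mul]
    linarith

/-- The mean velocity is conserved. -/
theorem apply_zero_eq (h : IsGalerkinSolution ν T K φ a) {t : ℝ} (ht : t ∈ Icc 0 T) :
    a t 0 = a 0 0 := by
  by_cases h0 : (0 : Fin n → ℤ) ∈ K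
  · refine eq_of_hasDerivWithinAt_zero (f := fun t => a t 0) (fun s hs => ?_) ht
    refine (h.deriv 0 h0 s hs).congr_deriv ?_
    simp [nsField, advection]
  · rw [h.support _ 0 h0, h.support _ 0 h0]

end IsGalerkinSolution

theorem sum_norm_le (K : Finset (Fin n → ℤ)) (a : (Fin n → ℤ) → EuclideanSpace ℂ (Fin n)) :
    ∑ k ∈ K, ‖a k‖ ≤ ‖a 0‖ + wsum 0 K a := by
  simp only [wsum, pow_zero, one_mul]
  by_cases h0 : (0 : Fin n → ℤ) ∈ K
  · rw [← Finset.add_sum_erase _ _ h0]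
  · rw [Finset.erase_eq_of_notMem h0]
    exact le_add_of_nonneg_left (norm_nonneg _)

/-- Galerkin solutions exist, with bounds that do not depend on the set `K` of frequencies, up to
the time given by the sharp ordinary differential inequality for the norm. -/
theorem exists_galerkin_bounded {ν T y₀ : ℝ} (hν : 0 < ν) (hT : 0 ≤ T) (hy₀ : 0 ≤ y₀)
    (hy : y₀ ≤ ν ∨ T * y₀ ^ 2 < 2 * ν) {a₀ : (Fin n → ℤ) → EuclideanSpace ℂ (Fin n)}
    (hr : IsRealFamily a₀) (hd : IsDivFreeFamily a₀) :
    ∃ R : ℝ, ∀ K : Finset (Fin n → ℤ), (∀ k ∈ K, -k ∈ K) → wsum 0 K a₀ ≤ y₀ →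
      ∃ a, IsGalerkinSolution ν T K (fun _ => 1) a ∧ (∀ k ∈ K, a 0 k = a₀ k) ∧
        ∀ t ∈ Icc 0 T, wsum 0 K (a t) ≤ R := by
  have key : ∃ R : ℝ, ∀ (K : Finset (Fin n → ℤ)) φ a, IsGalerkinSolution ν T K φ a →
      wsum 0 K (a 0) ≤ y₀ → ∀ t ∈ Icc 0 T, wsum 0 K (a t) ≤ R := by
    rcases hy with hy | hy
    · exact ⟨ν, fun K φ a h h0 t ht => h.wsum_zero_le_of_le hν (h0.trans hy) ht⟩
    · obtain ⟨y₁, h1, h2⟩ : ∃ y₁, T * y₁ ^ 2 < 2 * ν ∧ y₀ < y₁ := by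
        have hc : ContinuousAt (fun y : ℝ => T * y ^ 2) y₀ := by fun_prop
        have h1 := hc.eventually_lt_const hy
        exact ((h1.filter_mono nhdsWithin_le_nhds).and
          (self_mem_nhdsWithin : Ioi y₀ ∈ nhdsWithin y₀ (Ioi y₀))).exists
      exact ⟨_, fun K φ a h h0 t ht =>
        h.wsum_zero_le_sqrt hν (hy₀.trans_lt h2) h1 (h0.trans h2.le) ht⟩
  obtain ⟨R, hR⟩ := key
  refine ⟨R, fun K hK hK0 => ?_⟩
  obtain ⟨φ, a, ha, ha0, hφ⟩ := exists_isGalerkinSolution ν hT hK hr hd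
    (ρ := ‖a₀ 0‖ + |R| + 1) (by positivity)
  have hw : wsum 0 K (a 0) = wsum 0 K a₀ :=
    Finset.sum_congr rfl fun k hk => by rw [ha0 k (Finset.mem_of_mem_erase hk)]
  have hb := hR K φ a ha (hw.trans_le hK0)
  have hzero : ‖a 0 0‖ ≤ ‖a₀ 0‖ := by
    by_cases h0 : (0 : Fin n → ℤ) ∈ K
    · rw [ha0 0 h0]
    · rw [ha.support _ 0 h0, norm_zero]; exact norm_nonneg _
  have hφ1 : ∀ t ∈ Icc 0 T, φ t = 1 := fun t ht => by
    refine hφ t ht ((sum_norm_le K (a t)).trans ?_)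
    rw [ha.apply_zero_eq ht]
    linarith [hb t ht, le_abs_self R]
  refine ⟨a, ⟨ha.support, ha.real, ha.divFree, fun k hk t ht => ?_, continuousOn_const,
    fun t _ => ⟨zero_le_one, le_rfl⟩⟩, ha0, hb⟩
  have := ha.deriv k hk t ht
  rwa [hφ1 t ht] at this

/-! ### Convergence of the Galerkin approximation -/

theorem advection_sub_advection {a b : (Fin n → ℤ) → EuclideanSpace ℂ (Fin n)}
    {K : Finset (Fin n → ℤ)} (ha : ∀ k ∉ K, a k = 0) (hb : ∀ k ∉ K, b k = 0) (k : Fin n → ℤ) :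
    advection b b k - advection a a k =
      advection (fun l => b l - a l) b k + advection a (fun l => b l - a l) k := by
  have hd : ∀ k ∉ K, b k - a k = 0 := fun k hk => by rw [ha k hk, hb k hk, sub_zero]
  rw [advection_eq_sum hb, advection_eq_sum ha, advection_eq_sum hd, advection_eq_sum ha,
    ← Finset.sum_sub_distrib, ← Finset.sum_add_distrib]
  refine Finset.sum_congr rfl fun l _ => ?_
  rw [inner_sub_right, sub_smul, smul_sub]
  abel

/-- The part of a norm due to the frequencies outside of `K`, all of length at least `N`, costs a
factor `1 / N` in terms of the next higher norm. -/
theorem wsum_le_add_div {K K' : Finset (Fin n → ℤ)} (hKK : K ⊆ K') {N : ℝ} (hN : 0 < N)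
    (hfar : ∀ k ∉ K, N ≤ ‖kvec k‖) (m : ℕ) {d b : (Fin n → ℤ) → EuclideanSpace ℂ (Fin n)}
    (hdb : ∀ k ∉ K, d k = b k) : wsum m K' d ≤ wsum m K d + wsum (m + 1) K' b / N := by
  have hsub : K.erase 0 ⊆ K'.erase 0 := Finset.erase_subset_erase _ hKK
  simp only [wsum]
  rw [← Finset.sum_sdiff hsub, add_comm]
  gcongr
  rw [Finset.sum_div]
  calc _ ≤ ∑ k ∈ K'.erase 0 \ K.erase 0, ‖kvec k‖ ^ (m + 1) * ‖b k‖ / N := by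
        refine Finset.sum_le_sum fun k hk => ?_
        have hkK : k ∉ K := fun h => (Finset.mem_sdiff.1 hk).2
          (Finset.mem_erase.2 ⟨Finset.ne_of_mem_erase (Finset.mem_sdiff.1 hk).1, h⟩)
        rw [hdb k hkK, le_div_iff₀ hN, pow_succ]
        have := mul_le_mul_of_nonneg_left (hfar k hkK) (by positivity : 0 ≤ ‖kvec k‖ ^ m * ‖b k‖)
        linarith
    _ ≤ _ := Finset.sum_le_sum_of_subset_of_nonneg Finset.sdiff_subset fun _ _ _ => by positivity

/-- Galerkin solutions for larger and larger sets of frequencies form a Cauchy sequence: on the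
smaller set, their difference `d` satisfies a linear differential inequality with a forcing
`2R² / N` from the frequencies outside of it. The term `‖d‖₁` is absorbed into the viscous
term `ν ‖d‖₂`. -/
theorem wsum_galerkin_sub_le {ν T : ℝ} (hν : 0 < ν) {K K' : Finset (Fin n → ℤ)} (hKK : K ⊆ K')
    (h0K : 0 ∈ K) {N : ℝ} (hN : 0 < N) (hfar : ∀ k ∉ K, N ≤ ‖kvec k‖)
    {a b : ℝ → (Fin n → ℤ) → EuclideanSpace ℂ (Fin n)}
    (ha : IsGalerkinSolution ν T K (fun _ => 1) a) (hb : IsGalerkinSolution ν T K' (fun _ => 1) b)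
    (h0 : ∀ k ∈ K, a 0 k = b 0 k) {R : ℝ} (hR : 0 ≤ R) (haR : ∀ t ∈ Icc 0 T, wsum 0 K (a t) ≤ R)
    (hbR : ∀ t ∈ Icc 0 T, wsum 1 K' (b t) ≤ R) (hbR' : ∀ t ∈ Icc 0 T, wsum 2 K' (b t) ≤ R)
    {t : ℝ} (ht : t ∈ Icc 0 T) :
    wsum 0 K (fun k => b t k - a t k) ≤
      2 * R ^ 2 / N * T * Real.exp ((R + R ^ 2 / (4 * ν)) * T) := by
  set d : ℝ → (Fin n → ℤ) → EuclideanSpace ℂ (Fin n) := fun t k => b t k - a t k with hd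
  have haK' : ∀ s, ∀ k ∉ K', a s k = 0 := fun s k hk => ha.support s k fun h => hk (hKK h)
  have hdK' : ∀ s, ∀ k ∉ K', d s k = 0 := fun s k hk => by
    simp only [hd, haK' s k hk, hb.support s k hk, sub_zero]
  have hdc : ∀ k, ContinuousOn (fun s => d s k) (Icc 0 T) := fun k =>
    (hb.continuousOn k).sub (ha.continuousOn k)
  have hddiv : ∀ s ∈ Icc 0 T, IsDivFreeFamily (d s) := fun s hs k => by
    simp only [hd, inner_sub_right, ha.divFree s hs k, hb.divFree s hs k, sub_zero]
  have hd0 : ∀ s ∈ Icc 0 T, d s 0 = 0 := fun s hs => by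
    simp only [hd]; rw [ha.apply_zero_eq hs, hb.apply_zero_eq hs, h0 0 h0K, sub_self]
  let G : (Fin n → ℤ) → ℝ → ℝ := fun k s =>
    advBound K' (d s) (b s) k + advBound K' (a s) (d s) k
  have hGc : ∀ k, ContinuousOn (G k) (Icc 0 T) := fun k =>
    (continuousOn_finsetSum _ fun l _ => (hdc l).norm.mul
      (continuousOn_const.mul (hb.continuousOn _).norm)).add
    (continuousOn_finsetSum _ fun l _ => (ha.continuousOn l).norm.mul
      (continuousOn_const.mul (hdc _).norm))
  have hG0 : ∀ k s, 0 ≤ G k s := fun k s =>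
    add_nonneg (advBound_nonneg _ _ _ _) (advBound_nonneg _ _ _ _)
  have hmode : ∀ k ∈ K, ∀ t ∈ Icc 0 T, ‖d t k‖ ≤
      ∫ s in (0 : ℝ)..t, (G k s - ν * ‖kvec k‖ ^ 2 * ‖d s k‖) := by
    intro k hk t ht
    have := norm_le_add_integral (x := fun s => d s k)
      (x' := fun s => nsField ν (b s) k - nsField ν (a s) k) (c := fun _ => ν * ‖kvec k‖ ^ 2)
      (g := G k) (T := T) (fun s hs => ?_) continuousOn_const (hGc k) (fun _ _ => by positivity)
      (fun s _ => hG0 k s) (fun s hs => ?_) ht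
    · have e : d 0 k = 0 := by simp only [hd, h0 k hk, sub_self]
      simpa only [e, norm_zero, zero_add] using this
    · have h1 := hb.deriv k (hKK hk) s hs
      have h2 := ha.deriv k hk s hs
      rw [one_smul] at h1 h2
      exact h1.sub h2
    · have e : nsField ν (b s) k - nsField ν (a s) k = leray k (-(ν * ‖kvec k‖ ^ 2) • d s k -
          Complex.I • (advection (d s) (b s) k + advection (a s) (d s) k)) := by
        rw [← advection_sub_advection (haK' s) (hb.support s), nsField, nsField, ← map_sub]
        simp only [hd, smul_sub]
        congr 1
        abel
      have h1 := neg_re_inner_advection_le_of_zero (b := b s) (hdK' s) (hddiv s hs) (hd0 s hs) k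
        (d s k)
      have h2 := neg_re_inner_advection_le (b := d s) (haK' s) (ha.divFree s hs) (ha.real s hs) k
      rw [e, real_inner_eq_re, inner_leray_right (hddiv s hs k), inner_sub_right, Complex.sub_re,
        ← Complex.coe_smul, inner_smul_right, inner_self_eq_norm_sq_to_K, smul_add,
        inner_add_right, Complex.add_re]
      have e1 : (((-(ν * ‖kvec k‖ ^ 2) : ℝ) : ℂ) * ((‖d s k‖ : ℝ) : ℂ) ^ 2).re =
          -(ν * ‖kvec k‖ ^ 2) * ‖d s k‖ ^ 2 := by
        rw [← Complex.ofReal_pow, ← Complex.ofReal_mul, Complex.ofReal_re]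
      erw [e1]
      simp only [G]
      linarith
  have hrate : ContinuousOn (fun s => ∑ k ∈ K.erase 0, (G k s - ν * ‖kvec k‖ ^ 2 * ‖d s k‖))
      (Icc 0 T) :=
    continuousOn_finsetSum _ fun k _ => (hGc k).sub (continuousOn_const.mul (hdc k).norm)
  have hT : 0 ≤ T := ht.1.trans ht.2
  have := le_exp_of_le_add_integral (K := R + R ^ 2 / (4 * ν)) (b := 2 * R ^ 2 / N) (y₀ := 0)
    (y := fun s => wsum 0 K (d s)) (by positivity) (by positivity) hrate le_rfl (fun t ht => ?_)
    (fun s hs => ?_) ht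
  · simpa only [zero_add] using this
  · rw [zero_add, intervalIntegral.integral_finsetSum
      (f := fun k s => G k s - ν * ‖kvec k‖ ^ 2 * ‖d s k‖) fun k _ =>
      (((hGc k).sub (continuousOn_const.mul (hdc k).norm)).mono
        (Icc_subset_Icc le_rfl ht.2)).intervalIntegrable_of_Icc ht.1]
    simp only [wsum, pow_zero, one_mul]
    exact Finset.sum_le_sum fun k hk => hmode k (Finset.mem_of_mem_erase hk) t ht
  · have hsub : K.erase 0 ⊆ K'.erase 0 := Finset.erase_subset_erase _ hKK
    have e1 : ∑ k ∈ K.erase 0, G k s ≤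
        wsum 0 K' (d s) * wsum 1 K' (b s) + wsum 0 K' (a s) * wsum 1 K' (d s) := by
      refine (Finset.sum_le_sum_of_subset_of_nonneg hsub fun k _ _ => hG0 k s).trans ?_
      simp only [G, Finset.sum_add_distrib]
      exact add_le_add (sum_advBound_le_wsum K' _ _ (hb.support s))
        (sum_advBound_le_wsum K' _ _ (hdK' s))
    have hdb : ∀ k ∉ K, d s k = b s k := fun k hk => by simp only [hd, ha.support s k hk, sub_zero]
    have e2 : wsum 0 K' (d s) ≤ wsum 0 K (d s) + R / N :=
      (wsum_le_add_div hKK hN hfar 0 hdb).trans (by gcongr; exact hbR s hs)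
    have e3 : wsum 1 K' (d s) ≤ wsum 1 K (d s) + R / N :=
      (wsum_le_add_div hKK hN hfar 1 hdb).trans (by gcongr; exact hbR' s hs)
    have e4 : wsum 0 K' (a s) ≤ R := by
      refine le_trans (le_of_eq ?_) (haR s hs)
      refine (Finset.sum_subset hsub fun k hk hkK => ?_).symm
      have hkK : k ∉ K := fun h => hkK (Finset.mem_erase.2 ⟨Finset.ne_of_mem_erase hk, h⟩)
      rw [ha.support s k hkK, norm_zero, mul_zero]
    have e5 := mul_wsum_succ_le 0 K (d s) hν R
    have e6 : ∑ k ∈ K.erase 0, (G k s - ν * ‖kvec k‖ ^ 2 * ‖d s k‖) =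
        (∑ k ∈ K.erase 0, G k s) - ν * wsum 2 K (d s) := by
      simp only [wsum, Finset.sum_sub_distrib, Finset.mul_sum, mul_assoc]
    have e7 : wsum 0 K' (d s) * wsum 1 K' (b s) ≤ (wsum 0 K (d s) + R / N) * R :=
      mul_le_mul e2 (hbR s hs) (wsum_nonneg _ _ _) ((wsum_nonneg _ _ _).trans e2)
    have e8 : wsum 0 K' (a s) * wsum 1 K' (d s) ≤ R * (wsum 1 K (d s) + R / N) :=
      mul_le_mul e4 e3 (wsum_nonneg _ _ _) hR
    rw [e6]
    have e9 : 2 * R ^ 2 / N = R / N * R + R * (R / N) := by ring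
    simp only [zero_add] at e5
    rw [e9]
    linarith

/-! ### Rapidly decreasing families -/

theorem summable_prod_apply {ι : Type*} [Fintype ι] {f : ℤ → ℝ} (hf : Summable f)
    (h0 : ∀ k, 0 ≤ f k) : Summable fun k : ι → ℤ => ∏ i, f (k i) := by
  classical
  refine summable_of_sum_le (c := ∏ _i : ι, ∑' k, f k)
    (fun k => Finset.prod_nonneg fun i _ => h0 _) fun s => ?_
  calc ∑ k ∈ s, ∏ i, f (k i)
      ≤ ∑ k ∈ Fintype.piFinset fun i => s.image (· i), ∏ i, f (k i) := by
        refine Finset.sum_le_sum_of_subset_of_nonneg (fun k hk => ?_)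
          fun k _ _ => Finset.prod_nonneg fun i _ => h0 _
        exact Fintype.mem_piFinset.2 fun i => Finset.mem_image_of_mem _ hk
    _ = ∏ i, ∑ j ∈ s.image (· i), f j := (Finset.prod_univ_sum _ _).symm
    _ ≤ _ := Finset.prod_le_prod (fun i _ => Finset.sum_nonneg fun j _ => h0 _)
        fun i _ => hf.sum_le_tsum _ fun j _ => h0 j

/-- A summable weight on `ℤⁿ`. -/
noncomputable def decayWeight (k : Fin n → ℤ) : ℝ := ((1 + ‖kvec k‖) ^ (2 * n))⁻¹

theorem decayWeight_pos (k : Fin n → ℤ) : 0 < decayWeight k := by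
  unfold decayWeight; positivity

theorem decayWeight_le_one (k : Fin n → ℤ) : decayWeight k ≤ 1 :=
  inv_le_one_of_one_le₀ (one_le_pow₀ (by linarith [norm_nonneg (kvec k)]))

theorem summable_decayWeight : Summable (decayWeight (n := n)) := by
  have h1 : Summable fun k : ℤ => (1 + (k : ℝ) ^ 2)⁻¹ := by
    have h2 : Summable fun k : ℤ => 2 * (1 / (k : ℝ) ^ 2) :=
      (Real.summable_one_div_int_pow.2 one_lt_two).mul_left 2
    refine Summable.of_norm_bounded_eventually h2 ?_
    rw [Filter.eventually_cofinite]
    refine (Set.finite_singleton (0 : ℤ)).subset fun k hk => ?_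
    by_contra hk0
    refine hk ?_
    have : (0 : ℝ) < (k : ℝ) ^ 2 := by positivity [show (k : ℝ) ≠ 0 from mod_cast hk0]
    rw [Real.norm_of_nonneg (by positivity), inv_eq_one_div]
    calc 1 / (1 + (k : ℝ) ^ 2) ≤ 1 / (k : ℝ) ^ 2 := by gcongr; linarith
      _ ≤ _ := by linarith [one_div_pos.2 this]
  refine Summable.of_nonneg_of_le (fun k => (decayWeight_pos k).le) (fun k => ?_)
    (summable_prod_apply (ι := Fin n) h1 fun k => by positivity)
  rw [Finset.prod_inv_distrib, decayWeight]
  refine inv_anti₀ (Finset.prod_pos fun i _ => by positivity) ?_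
  calc ∏ i, (1 + (k i : ℝ) ^ 2) ≤ ∏ _i : Fin n, (1 + ‖kvec k‖) ^ 2 := by
        refine Finset.prod_le_prod (fun i _ => by positivity) fun i _ => ?_
        have := abs_le_norm_kvec k i
        have h2 : (k i : ℝ) ^ 2 ≤ ‖kvec k‖ ^ 2 := by rw [← sq_abs]; gcongr
        nlinarith [norm_nonneg (kvec k)]
    _ = _ := by rw [Finset.prod_const, Finset.card_univ, Fintype.card_fin, pow_mul]

theorem mul_norm_le_decayWeight {E : Type*} [NormedAddCommGroup E] {m : ℕ} {k : Fin n → ℤ} {C : ℝ}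
    {v : E} (h : (1 + ‖kvec k‖) ^ (m + 2 * n) * ‖v‖ ≤ C) :
    (1 + ‖kvec k‖) ^ m * ‖v‖ ≤ C * decayWeight k := by
  rw [decayWeight, ← div_eq_mul_inv, le_div_iff₀ (by positivity)]
  calc _ = (1 + ‖kvec k‖) ^ (m + 2 * n) * ‖v‖ := by rw [pow_add]; ring
    _ ≤ C := h

/-- The family `c` decreases faster than any power of `|k|`, uniformly on `[0, T]`. -/
def RapidOn {E : Type*} [NormedAddCommGroup E] (T : ℝ) (c : ℝ → (Fin n → ℤ) → E) : Prop :=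
  ∀ m : ℕ, ∃ C : ℝ, ∀ t ∈ Icc 0 T, ∀ k, (1 + ‖kvec k‖) ^ m * ‖c t k‖ ≤ C

theorem RapidOn.exists_le_decayWeight {E : Type*} [NormedAddCommGroup E] {T : ℝ}
    {c : ℝ → (Fin n → ℤ) → E} (h : RapidOn T c) (m : ℕ) :
    ∃ C : ℝ, 0 ≤ C ∧ ∀ t ∈ Icc 0 T, ∀ k, (1 + ‖kvec k‖) ^ m * ‖c t k‖ ≤ C * decayWeight k := by
  obtain ⟨C, hC⟩ := h (m + 2 * n)
  refine ⟨max C 0, le_max_right _ _, fun t ht k => mul_norm_le_decayWeight ?_⟩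
  exact (hC t ht k).trans (le_max_left _ _)

/-! ### Passage to the limit -/

/-- The box `{k | |kᵢ| ≤ N}` of frequencies. -/
noncomputable def freqBox (n N : ℕ) : Finset (Fin n → ℤ) :=
  Fintype.piFinset fun _ => Finset.Icc (-(N : ℤ)) N

theorem mem_freqBox {N : ℕ} {k : Fin n → ℤ} : k ∈ freqBox n N ↔ ∀ i, |k i| ≤ N := by
  simp [freqBox, Fintype.mem_piFinset, abs_le]

theorem neg_mem_freqBox {N : ℕ} {k : Fin n → ℤ} (h : k ∈ freqBox n N) : -k ∈ freqBox n N := by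
  simpa [mem_freqBox] using h

theorem freqBox_mono {M N : ℕ} (h : M ≤ N) : freqBox n M ⊆ freqBox n N := fun k hk =>
  mem_freqBox.2 fun i => (mem_freqBox.1 hk i).trans (by exact_mod_cast h)

theorem exists_mem_freqBox (k : Fin n → ℤ) : ∃ N, k ∈ freqBox n N := by
  refine ⟨∑ i, (k i).natAbs, mem_freqBox.2 fun i => ?_⟩
  have := Finset.single_le_sum (f := fun i => (k i).natAbs) (fun _ _ => Nat.zero_le _)
    (Finset.mem_univ i)
  rw [← Int.natCast_natAbs]
  exact_mod_cast this

theorem le_norm_kvec_of_notMem_freqBox {N : ℕ} {k : Fin n → ℤ} (h : k ∉ freqBox n N) :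
    (N + 1 : ℝ) ≤ ‖kvec k‖ := by
  simp only [mem_freqBox, not_forall, not_le] at h
  obtain ⟨i, hi⟩ := h
  refine le_trans ?_ (abs_le_norm_kvec k i)
  have : ((N : ℤ) + 1 : ℤ) ≤ |k i| := hi
  exact_mod_cast this

theorem norm_advection_term_le {a : (Fin n → ℤ) → EuclideanSpace ℂ (Fin n)} {C : ℝ} (hC : 0 ≤ C)
    (h : ∀ k, ‖a k‖ ≤ C * decayWeight k) (k l : Fin n → ℤ) :
    ‖inner ℂ (kvec k) (a l) • a (k - l)‖ ≤ ‖kvec k‖ * C * C * decayWeight l := by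
  have h1 : ‖a (k - l)‖ ≤ C := (h _).trans (mul_le_of_le_one_right hC (decayWeight_le_one _))
  rw [norm_smul]
  calc _ ≤ (‖kvec k‖ * ‖a l‖) * ‖a (k - l)‖ := by gcongr; exact norm_inner_le_norm _ _
    _ ≤ (‖kvec k‖ * (C * decayWeight l)) * C := by
      have := mul_nonneg hC (decayWeight_pos l).le
      gcongr
      exact h l
    _ = _ := by ring

theorem norm_nsField_le {ν : ℝ} (hν : 0 < ν) {a : (Fin n → ℤ) → EuclideanSpace ℂ (Fin n)} {C : ℝ}
    (hC : 0 ≤ C) (h : ∀ k, ‖a k‖ ≤ C * decayWeight k) (k : Fin n → ℤ) :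
    ‖nsField ν a k‖ ≤ ν * ‖kvec k‖ ^ 2 * C + ∑' l, ‖kvec k‖ * C * C * decayWeight (n := n) l := by
  refine (norm_leray_le _ _).trans ((norm_sub_le _ _).trans (add_le_add ?_ ?_))
  · rw [norm_smul, norm_neg, Real.norm_of_nonneg (by positivity)]
    gcongr
    exact (h k).trans (mul_le_of_le_one_right hC (decayWeight_le_one _))
  · rw [norm_smul, Complex.norm_I, one_mul]
    exact tsum_of_norm_bounded (summable_decayWeight.mul_left _).hasSum
      (norm_advection_term_le hC h k)

/-- The field is continuous with respect to coefficientwise convergence under a summable bound. -/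
theorem tendsto_nsField {ν : ℝ} {ι : Type*} {F : Filter ι}
    {A : ι → (Fin n → ℤ) → EuclideanSpace ℂ (Fin n)} {a : (Fin n → ℤ) → EuclideanSpace ℂ (Fin n)}
    {C : ℝ} (hC : 0 ≤ C) (h : ∀ᶠ i in F, ∀ k, ‖A i k‖ ≤ C * decayWeight k)
    (hA : ∀ k, Tendsto (fun i => A i k) F (𝓝 (a k))) (k : Fin n → ℤ) :
    Tendsto (fun i => nsField ν (A i) k) F (𝓝 (nsField ν a k)) := by
  refine ((leray k).continuous.tendsto _).comp (((hA k).const_smul _).sub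
    (Tendsto.const_smul (tendsto_tsum_of_dominated_convergence
      (summable_decayWeight.mul_left (‖kvec k‖ * C * C)) (fun l => ?_) ?_) _))
  · exact (tendsto_const_nhds.inner (hA l)).smul (hA (k - l))
  · exact h.mono fun i hi l => norm_advection_term_le hC hi k l

/-- The Navier–Stokes equation on the Fourier side has a solution up to the time given by the
sharp ordinary differential inequality. -/
theorem exists_fourier_solution {ν T y₀ : ℝ} (hν : 0 < ν) (hT : 0 ≤ T) (hy₀ : 0 ≤ y₀)
    (hy : y₀ ≤ ν ∨ T * y₀ ^ 2 < 2 * ν) {a₀ : (Fin n → ℤ) → EuclideanSpace ℂ (Fin n)}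
    (hr : IsRealFamily a₀) (hd : IsDivFreeFamily a₀)
    (hdecay : ∀ m : ℕ, ∃ C : ℝ, ∀ k, (1 + ‖kvec k‖) ^ m * ‖a₀ k‖ ≤ C)
    (hwsum : ∀ K, wsum 0 K a₀ ≤ y₀) :
    ∃ a : ℝ → (Fin n → ℤ) → EuclideanSpace ℂ (Fin n), (∀ k, a 0 k = a₀ k) ∧ RapidOn T a ∧
      (∀ t ∈ Icc 0 T, IsRealFamily (a t)) ∧ (∀ t ∈ Icc 0 T, IsDivFreeFamily (a t)) ∧
      ∀ k, ∀ t ∈ Icc 0 T, HasDerivWithinAt (fun s => a s k) (nsField ν (a t) k) (Icc 0 T) t := by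
  obtain ⟨R, hR⟩ := exists_galerkin_bounded hν hT hy₀ hy hr hd
  choose A hA hA0 hAR using fun N : ℕ => hR (freqBox n N) (fun k => neg_mem_freqBox) (hwsum _)
  -- Bounds of all weighted norms, uniform in the number of frequencies.
  have hw0 : ∀ m : ℕ, ∃ W : ℝ, 0 ≤ W ∧ ∀ K, wsum m K a₀ ≤ W := by
    intro m
    obtain ⟨C, hC⟩ := hdecay (m + 2 * n)
    have hC0 : 0 ≤ C := le_trans (by positivity) (hC 0)
    refine ⟨∑' k, C * decayWeight (n := n) k, tsum_nonneg fun k =>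
      mul_nonneg hC0 (decayWeight_pos k).le, fun K => ?_⟩
    refine (Finset.sum_le_sum fun k _ => ?_).trans ((summable_decayWeight.mul_left C).sum_le_tsum _
      fun k _ => mul_nonneg hC0 (decayWeight_pos k).le)
    refine le_trans ?_ (mul_norm_le_decayWeight (hC k))
    gcongr
    linarith
  have hw : ∀ m : ℕ, ∃ W : ℝ, 0 ≤ W ∧ ∀ N, ∀ t ∈ Icc 0 T, wsum m (freqBox n N) (A N t) ≤ W := by
    intro m
    obtain ⟨W, hW0, hW⟩ := hw0 m
    refine ⟨W * Real.exp ((2 ^ (m + 1) * R) ^ 2 / (4 * ν) * T), by positivity, fun N t ht => ?_⟩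
    refine ((hA N).wsum_le_exp hν (hAR N) m ht).trans ?_
    gcongr
    refine le_trans (le_of_eq ?_) (hW (freqBox n N))
    exact Finset.sum_congr rfl fun k hk => by rw [hA0 N k (Finset.mem_of_mem_erase hk)]
  have h0box : ∀ N, (0 : Fin n → ℤ) ∈ freqBox n N := fun N => mem_freqBox.2 fun i => by simp
  have hA00 : ∀ N, ∀ t ∈ Icc 0 T, A N t 0 = a₀ 0 := fun N t ht => by
    rw [(hA N).apply_zero_eq ht, hA0 N 0 (h0box N)]
  have hAdecay : ∀ m : ℕ, ∃ C : ℝ, ∀ N, ∀ t ∈ Icc 0 T, ∀ k,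
      (1 + ‖kvec k‖) ^ m * ‖A N t k‖ ≤ C := by
    intro m
    obtain ⟨W, hW0, hW⟩ := hw m
    refine ⟨2 ^ m * W + ‖a₀ 0‖, fun N t ht k => ?_⟩
    by_cases hk0 : k = 0
    · rw [hk0, hA00 N t ht]
      simp
      positivity
    · by_cases hk : k ∈ freqBox n N
      · have h1 := one_le_norm_kvec hk0
        calc _ ≤ (2 * ‖kvec k‖) ^ m * ‖A N t k‖ := by gcongr; linarith
          _ = 2 ^ m * (‖kvec k‖ ^ m * ‖A N t k‖) := by rw [mul_pow, mul_assoc]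
          _ ≤ 2 ^ m * W := by gcongr; exact (norm_le_wsum m hk hk0 _).trans (hW N t ht)
          _ ≤ _ := le_add_of_nonneg_right (norm_nonneg _)
      · rw [(hA N).support t k hk, norm_zero, mul_zero]
        positivity
  obtain ⟨R', hR'0, hcauchy⟩ : ∃ R' : ℝ, 0 ≤ R' ∧ ∀ M N, M ≤ N → ∀ t ∈ Icc 0 T,
      ∀ k ∈ freqBox n M, ‖A N t k - A M t k‖ ≤ R' / (M + 1) := by
    obtain ⟨W0, h0, hW0⟩ := hw 0
    obtain ⟨W1, h1, hW1⟩ := hw 1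
    obtain ⟨W2, h2, hW2⟩ := hw 2
    set W := W0 + W1 + W2 with hW
    refine ⟨2 * W ^ 2 * T * Real.exp ((W + W ^ 2 / (4 * ν)) * T), by positivity,
      fun M N hMN t ht k hk => ?_⟩
    by_cases hk0 : k = 0
    · rw [hk0, hA00 N t ht, hA00 M t ht, sub_self, norm_zero]
      positivity
    have h3 := wsum_galerkin_sub_le hν (freqBox_mono hMN) (h0box M) (N := (M + 1 : ℝ))
      (by positivity) (fun k hk => le_norm_kvec_of_notMem_freqBox hk) (hA M) (hA N)
      (fun k hk => by rw [hA0 M k hk, hA0 N k (freqBox_mono hMN hk)]) (R := W) (by positivity)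
      (fun t ht => (hW0 M t ht).trans (by linarith)) (fun t ht => (hW1 N t ht).trans (by linarith))
      (fun t ht => (hW2 N t ht).trans (by linarith)) ht
    have h4 := norm_le_wsum 0 hk hk0 (fun k => A N t k - A M t k)
    rw [pow_zero, one_mul] at h4
    refine (h4.trans h3).trans (le_of_eq ?_)
    ring
  have hlim : ∀ t k, ∃ v, t ∈ Icc 0 T → Tendsto (fun N => A N t k) atTop (𝓝 v) := by
    intro t k
    by_cases ht : t ∈ Icc 0 T
    · have : CauchySeq fun N => A N t k := by
        refine Metric.cauchySeq_iff'.2 fun ε hε => ?_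
        obtain ⟨M₀, hM₀⟩ := exists_mem_freqBox k
        obtain ⟨M₁, hM₁⟩ := exists_nat_gt (R' / ε)
        refine ⟨max M₀ M₁, fun N hN => ?_⟩
        rw [dist_eq_norm]
        refine (hcauchy _ N hN t ht k (freqBox_mono (le_max_left _ _) hM₀)).trans_lt ?_
        rw [div_lt_iff₀ (by positivity)]
        have h5 : (M₁ : ℝ) ≤ (max M₀ M₁ : ℕ) := by exact_mod_cast le_max_right _ _
        rw [div_lt_iff₀ hε] at hM₁
        nlinarith
      obtain ⟨v, hv⟩ := cauchySeq_tendsto_of_complete this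
      exact ⟨v, fun _ => hv⟩
    · exact ⟨0, fun h => absurd h ht⟩
  choose a ha using hlim
  have h0T : (0 : ℝ) ∈ Icc 0 T := ⟨le_rfl, hT⟩
  have hev : ∀ k, ∀ᶠ N in atTop, k ∈ freqBox n N := fun k => by
    obtain ⟨M, hM⟩ := exists_mem_freqBox k
    exact eventually_atTop.2 ⟨M, fun N hN => freqBox_mono hN hM⟩
  have hinit : ∀ k, a 0 k = a₀ k := fun k =>
    tendsto_nhds_unique (ha 0 k h0T) (tendsto_const_nhds.congr' ((hev k).mono fun N hN =>
      (hA0 N k hN).symm))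
  have hrapid : RapidOn T a := by
    intro m
    obtain ⟨C, hC⟩ := hAdecay m
    exact ⟨C, fun t ht k => le_of_tendsto ((ha t k ht).norm.const_mul _)
      (Eventually.of_forall fun N => hC N t ht k)⟩
  refine ⟨a, hinit, hrapid, fun t ht k => ?_, fun t ht k => ?_, ?_⟩
  · exact tendsto_nhds_unique ((ha t (-k) ht).congr fun N => (hA N).real t ht k)
      ((continuous_conjVec.tendsto _).comp (ha t k ht))
  · exact tendsto_nhds_unique ((tendsto_const_nhds.inner (ha t k ht)).congr fun N =>
      (hA N).divFree t ht k) tendsto_const_nhds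
  · obtain ⟨C, hC0, hC⟩ : ∃ C : ℝ, 0 ≤ C ∧ ∀ N, ∀ t ∈ Icc 0 T, ∀ k,
        ‖A N t k‖ ≤ C * decayWeight k := by
      obtain ⟨C, hC⟩ := hAdecay (0 + 2 * n)
      refine ⟨C, le_trans (by positivity) (hC 0 0 h0T 0), fun N t ht k => ?_⟩
      simpa using mul_norm_le_decayWeight (hC N t ht k)
    have hC' : ∀ t ∈ Icc 0 T, ∀ k, ‖a t k‖ ≤ C * decayWeight k := fun t ht k =>
      le_of_tendsto (ha t k ht).norm (Eventually.of_forall fun N => hC N t ht k)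
    intro k
    -- The integrated equation passes to the limit by dominated convergence.
    have hint : ∀ j, ∀ t ∈ Icc 0 T, a t j = a₀ j + ∫ s in (0 : ℝ)..t, nsField ν (a s) j := by
      intro j t ht
      have hsub : Icc 0 t ⊆ Icc 0 T := Icc_subset_Icc le_rfl ht.2
      have hcj : ∀ N, ContinuousOn (fun t => nsField ν (A N t) j) (Icc 0 T) := fun N t ht =>
        tendsto_nsField hC0 (eventually_of_mem self_mem_nhdsWithin fun s hs => hC N s hs)
          (fun k => (hA N).continuousOn k t ht) j
      have h1 : Tendsto (fun N => ∫ s in (0 : ℝ)..t, nsField ν (A N s) j) atTop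
          (𝓝 (∫ s in (0 : ℝ)..t, nsField ν (a s) j)) := by
        have hu : ∀ s ∈ Set.uIoc 0 t, s ∈ Icc 0 T := fun s hs => by
          rw [uIoc_of_le ht.1] at hs
          exact ⟨hs.1.le, hs.2.trans ht.2⟩
        refine intervalIntegral.tendsto_integral_filter_of_dominated_convergence
          (fun _ => ν * ‖kvec j‖ ^ 2 * C + ∑' l, ‖kvec j‖ * C * C * decayWeight (n := n) l)
          (Eventually.of_forall fun N => ?_) (Eventually.of_forall fun N => ?_) (by simp) ?_
        · rw [uIoc_of_le ht.1]
          exact ((hcj N).mono (Ioc_subset_Icc_self.trans hsub)).aestronglyMeasurable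
            measurableSet_Ioc
        · exact Eventually.of_forall fun s hs => norm_nsField_le hν hC0 (hC N s (hu s hs)) j
        · exact Eventually.of_forall fun s hs => tendsto_nsField hC0
            (Eventually.of_forall fun N => hC N s (hu s hs)) (fun k => ha s k (hu s hs)) j
      have h2 : ∀ᶠ N in atTop, a₀ j + ∫ s in (0 : ℝ)..t, nsField ν (A N s) j = A N t j := by
        filter_upwards [hev j] with N hN
        have hder : ∀ s ∈ Icc 0 T, HasDerivWithinAt (fun s => A N s j -
            ∫ r in (0 : ℝ)..s, nsField ν (A N r) j) 0 (Icc 0 T) s := fun s hs => by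
          have := (hA N).deriv j hN s hs
          rw [one_smul] at this
          exact (this.sub (hasDerivWithinAt_integral_Icc (hcj N) hs)).congr_deriv (sub_self _)
        have := eq_of_hasDerivWithinAt_zero hder ht
        rw [intervalIntegral.integral_same, sub_zero, hA0 N j hN] at this
        rw [← this]; abel
      exact tendsto_nhds_unique (ha t j ht) ((tendsto_const_nhds.add h1).congr' h2)
    -- A common Lipschitz bound makes the limit continuous, so that it can be differentiated again.
    have hLip : ∀ j, ContinuousOn (fun t => a t j) (Icc 0 T) := by
      intro j
      set L := ν * ‖kvec j‖ ^ 2 * C + ∑' l, ‖kvec j‖ * C * C * decayWeight (n := n) l with hL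
      have hL0 : 0 ≤ L := le_trans (norm_nonneg _) (norm_nsField_le hν hC0 (hC' 0 h0T) j)
      refine LipschitzOnWith.continuousOn (K := ⟨L, hL0⟩)
        (LipschitzOnWith.of_dist_le_mul fun s hs t ht => ?_)
      rw [dist_comm, dist_comm s t, dist_eq_norm, dist_eq_norm]
      refine le_of_tendsto ((ha t j ht).sub (ha s j hs)).norm ?_
      filter_upwards [hev j] with N hN
      refine (convex_Icc 0 T).norm_image_sub_le_of_norm_hasDerivWithin_le
        (fun r hr => (hA N).deriv j hN r hr) (fun r hr => ?_) hs ht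
      rw [one_smul]
      exact norm_nsField_le hν hC0 (hC N r hr) j
    have hcont : ContinuousOn (fun t => nsField ν (a t) k) (Icc 0 T) := fun t ht =>
      tendsto_nsField hC0 (eventually_of_mem self_mem_nhdsWithin fun s hs => hC' s hs)
        (fun j => hLip j t ht) k
    intro t ht
    exact ((hasDerivWithinAt_integral_Icc hcont ht).const_add (a₀ k)).congr_of_mem
      (fun s hs => hint k s hs) ht

/-! ### Smooth families of coefficients and their Fourier series -/

/-- Termwise differentiation of a series on a convex set, which need not be open: the time interval
is closed, with one-sided derivatives at its ends. -/
theorem hasFDerivWithinAt_tsum_of_convex {ι E F : Type*} [NormedAddCommGroup E] [NormedSpace ℝ E]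
    [NormedAddCommGroup F] [NormedSpace ℝ F] [CompleteSpace F] {s : Set E} (hs : Convex ℝ s)
    {f : ι → E → F} {f' : ι → E → E →L[ℝ] F} {u : ι → ℝ} (hu : Summable u)
    (hf : ∀ i, ∀ x ∈ s, HasFDerivWithinAt (f i) (f' i x) s x) (hb : ∀ i, ∀ x ∈ s, ‖f' i x‖ ≤ u i)
    (h0 : ∀ x ∈ s, Summable fun i => f i x) {x : E} (hx : x ∈ s) :
    HasFDerivWithinAt (fun y => ∑' i, f i y) (∑' i, f' i x) s x := by
  have hf's : Summable fun i => f' i x := Summable.of_norm_bounded hu fun i => hb i x hx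
  rw [hasFDerivWithinAt_iff_tendsto]
  have h1 : ∀ i, Tendsto (fun y => ‖y - x‖⁻¹ • (f i y - f i x - f' i x (y - x))) (𝓝[s] x)
      (𝓝 0) := by
    intro i
    rw [tendsto_zero_iff_norm_tendsto_zero]
    refine (hasFDerivWithinAt_iff_tendsto.1 (hf i x hx)).congr fun y => ?_
    rw [norm_smul, norm_inv, norm_norm]
  have h2 : ∀ᶠ y in 𝓝[s] x, ∀ i, ‖‖y - x‖⁻¹ • (f i y - f i x - f' i x (y - x))‖ ≤ 2 * u i := by
    filter_upwards [self_mem_nhdsWithin] with y hy i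
    have e1 := hs.norm_image_sub_le_of_norm_hasFDerivWithin_le (hf i) (hb i) hx hy
    have e2 := (f' i x).le_of_opNorm_le (hb i x hx) (y - x)
    rw [norm_smul, norm_inv, norm_norm]
    rcases (norm_nonneg (y - x)).eq_or_lt with h | h
    · rw [← h, inv_zero, zero_mul]
      linarith [(norm_nonneg _).trans (hb i x hx)]
    · rw [inv_mul_le_iff₀ h]
      refine (norm_sub_le _ _).trans ?_
      linarith
  have h3 := tendsto_tsum_of_dominated_convergence (hu.mul_left 2) h1 h2
  rw [tsum_zero, tendsto_zero_iff_norm_tendsto_zero] at h3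
  refine h3.congr' ?_
  filter_upwards [self_mem_nhdsWithin] with y hy
  rw [tsum_const_smul'', norm_smul, norm_inv, norm_norm]
  congr 2
  have e := (ContinuousLinearMap.apply ℝ F (y - x)).map_tsum hf's
  simp only [ContinuousLinearMap.apply_apply] at e
  have hs' : Summable fun i => f' i x (y - x) :=
    (ContinuousLinearMap.apply ℝ F (y - x)).summable hf's
  rw [e, ← (h0 y hy).tsum_sub (h0 x hx), ← ((h0 y hy).sub (h0 x hx)).tsum_sub hs']

theorem RapidOn.mul_left {T : ℝ} {c : ℝ → (Fin n → ℤ) → ℂ} (hc : RapidOn T c)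
    {μ : (Fin n → ℤ) → ℂ} {C : ℝ} {p : ℕ} (hμ : ∀ k, ‖μ k‖ ≤ C * (1 + ‖kvec k‖) ^ p) :
    RapidOn T fun t k => μ k * c t k := by
  intro m
  obtain ⟨D, hD⟩ := hc (m + p)
  have hC : 0 ≤ C := by
    have := (norm_nonneg _).trans (hμ 0)
    simpa using this
  refine ⟨C * D, fun t ht k => ?_⟩
  calc _ ≤ (1 + ‖kvec k‖) ^ m * ((C * (1 + ‖kvec k‖) ^ p) * ‖c t k‖) := by
        rw [norm_mul]; gcongr; exact hμ k
    _ = C * ((1 + ‖kvec k‖) ^ (m + p) * ‖c t k‖) := by ring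
    _ ≤ _ := by gcongr; exact hD t ht k

theorem RapidOn.add {T : ℝ} {c d : ℝ → (Fin n → ℤ) → ℂ} (hc : RapidOn T c) (hd : RapidOn T d) :
    RapidOn T fun t k => c t k + d t k := by
  intro m
  obtain ⟨C, hC⟩ := hc m
  obtain ⟨D, hD⟩ := hd m
  refine ⟨C + D, fun t ht k => ?_⟩
  calc _ ≤ (1 + ‖kvec k‖) ^ m * (‖c t k‖ + ‖d t k‖) := by gcongr; exact norm_add_le _ _
    _ ≤ _ := by rw [mul_add]; exact add_le_add (hC t ht k) (hD t ht k)

/-- Convolution of two families of Fourier coefficients: the coefficients of the product. -/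
noncomputable def conv (c d : ℝ → (Fin n → ℤ) → ℂ) (t : ℝ) (k : Fin n → ℤ) : ℂ :=
  ∑' l, c t l * d t (k - l)

theorem one_add_norm_kvec_le (k l : Fin n → ℤ) :
    1 + ‖kvec k‖ ≤ (1 + ‖kvec l‖) * (1 + ‖kvec (k - l)‖) := by
  have h : ‖kvec k‖ ≤ ‖kvec l‖ + ‖kvec (k - l)‖ := by
    rw [kvec_sub]
    simpa using norm_add_le (kvec l) (kvec k - kvec l)
  nlinarith [mul_nonneg (norm_nonneg (kvec l)) (norm_nonneg (kvec (k - l)))]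

theorem RapidOn.exists_conv_bound {T : ℝ} {c d : ℝ → (Fin n → ℤ) → ℂ} (hc : RapidOn T c)
    (hd : RapidOn T d) (m : ℕ) : ∃ C : ℝ, ∀ t ∈ Icc 0 T, ∀ k l,
      (1 + ‖kvec k‖) ^ m * ‖c t l * d t (k - l)‖ ≤ C * decayWeight l := by
  obtain ⟨C, hC0, hC⟩ := hc.exists_le_decayWeight m
  obtain ⟨D, hD0, hD⟩ := hd.exists_le_decayWeight m
  refine ⟨C * D, fun t ht k l => ?_⟩
  have h1 : (1 + ‖kvec (k - l)‖) ^ m * ‖d t (k - l)‖ ≤ D :=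
    (hD t ht _).trans (mul_le_of_le_one_right hD0 (decayWeight_le_one _))
  calc _ ≤ ((1 + ‖kvec l‖) * (1 + ‖kvec (k - l)‖)) ^ m * (‖c t l‖ * ‖d t (k - l)‖) := by
        rw [norm_mul]; gcongr; exact one_add_norm_kvec_le k l
    _ = ((1 + ‖kvec l‖) ^ m * ‖c t l‖) * ((1 + ‖kvec (k - l)‖) ^ m * ‖d t (k - l)‖) := by
        rw [mul_pow]; ring
    _ ≤ (C * decayWeight l) * D := mul_le_mul (hC t ht l) h1 (by positivity)
        (mul_nonneg hC0 (decayWeight_pos l).le)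
    _ = _ := by ring

theorem RapidOn.summable_conv {T : ℝ} {c d : ℝ → (Fin n → ℤ) → ℂ} (hc : RapidOn T c)
    (hd : RapidOn T d) {t : ℝ} (ht : t ∈ Icc 0 T) (k : Fin n → ℤ) :
    Summable fun l => c t l * d t (k - l) := by
  obtain ⟨C, hC⟩ := hc.exists_conv_bound hd 0
  refine Summable.of_norm_bounded (summable_decayWeight.mul_left C) fun l => ?_
  simpa using hC t ht k l

theorem RapidOn.conv {T : ℝ} {c d : ℝ → (Fin n → ℤ) → ℂ} (hc : RapidOn T c)
    (hd : RapidOn T d) : RapidOn T (conv c d) := by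
  intro m
  obtain ⟨C, hC⟩ := hc.exists_conv_bound hd m
  refine ⟨∑' l, C * decayWeight (n := n) l, fun t ht k => ?_⟩
  have : (1 + ‖kvec k‖) ^ m * ‖PeriodicNS.conv c d t k‖ =
      ‖∑' l, ((1 + ‖kvec k‖) ^ m : ℝ) • (c t l * d t (k - l))‖ := by
    rw [tsum_const_smul'', norm_smul, Real.norm_of_nonneg (by positivity), PeriodicNS.conv]
  rw [this]
  refine tsum_of_norm_bounded (summable_decayWeight.mul_left C).hasSum fun l => ?_
  rw [norm_smul, Real.norm_of_nonneg (by positivity)]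
  exact hC t ht k l

/-- `c` is `j` times continuously differentiable in time, and it and its derivatives are rapidly
decreasing in frequency. -/
def SmoothFamily (T : ℝ) : ℕ → (ℝ → (Fin n → ℤ) → ℂ) → Prop
  | 0, c => RapidOn T c ∧ ∀ k, ContinuousOn (fun t => c t k) (Icc 0 T)
  | j + 1, c => RapidOn T c ∧ ∃ d, SmoothFamily T j d ∧
      ∀ k, ∀ t ∈ Icc 0 T, HasDerivWithinAt (fun s => c s k) (d t k) (Icc 0 T) t

namespace SmoothFamily

variable {T : ℝ} {c d : ℝ → (Fin n → ℤ) → ℂ}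

theorem rapid {j : ℕ} (h : SmoothFamily T j c) : RapidOn T c := by
  cases j <;> exact h.1

theorem continuousOn {j : ℕ} (h : SmoothFamily T j c) (k : Fin n → ℤ) :
    ContinuousOn (fun t => c t k) (Icc 0 T) := by
  cases j with
  | zero => exact h.2 k
  | succ j =>
    obtain ⟨_, d, _, hd⟩ := h
    exact fun t ht => (hd k t ht).continuousWithinAt

theorem of_succ {j : ℕ} (h : SmoothFamily T (j + 1) c) : SmoothFamily T j c := by
  induction j generalizing c with
  | zero => exact ⟨h.rapid, h.continuousOn⟩
  | succ j ih =>
    obtain ⟨hc, d, hd, hcd⟩ := h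
    exact ⟨hc, d, ih hd, hcd⟩

theorem add {j : ℕ} (hc : SmoothFamily T j c) (hd : SmoothFamily T j d) :
    SmoothFamily T j fun t k => c t k + d t k := by
  induction j generalizing c d with
  | zero => exact ⟨hc.1.add hd.1, fun k => (hc.2 k).add (hd.2 k)⟩
  | succ j ih =>
    obtain ⟨hc, c', hc', hcc⟩ := hc
    obtain ⟨hd, d', hd', hdd⟩ := hd
    exact ⟨hc.add hd, _, ih hc' hd', fun k t ht => (hcc k t ht).add (hdd k t ht)⟩

theorem mul_left {j : ℕ} (hc : SmoothFamily T j c) {μ : (Fin n → ℤ) → ℂ} {C : ℝ} {p : ℕ}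
    (hμ : ∀ k, ‖μ k‖ ≤ C * (1 + ‖kvec k‖) ^ p) : SmoothFamily T j fun t k => μ k * c t k := by
  induction j generalizing c with
  | zero => exact ⟨hc.1.mul_left hμ, fun k => continuousOn_const.mul (hc.2 k)⟩
  | succ j ih =>
    obtain ⟨hc, c', hc', hcc⟩ := hc
    exact ⟨hc.mul_left hμ, _, ih hc', fun k t ht => (hcc k t ht).const_mul _⟩

theorem zero (j : ℕ) : SmoothFamily T j fun _ (_ : Fin n → ℤ) => (0 : ℂ) := by
  have h0 : RapidOn T fun _ (_ : Fin n → ℤ) => (0 : ℂ) := fun m => ⟨0, by simp⟩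
  induction j with
  | zero => exact ⟨h0, fun _ => continuousOn_const⟩
  | succ j ih => exact ⟨h0, _, ih, fun k t _ => hasDerivWithinAt_const _ _ _⟩

theorem sum {j : ℕ} {ι : Type*} (s : Finset ι) {c : ι → ℝ → (Fin n → ℤ) → ℂ}
    (h : ∀ i ∈ s, SmoothFamily T j (c i)) : SmoothFamily T j fun t k => ∑ i ∈ s, c i t k := by
  classical
  induction s using Finset.induction_on with
  | empty => simpa using zero j
  | insert i s hi ih =>
    simp only [Finset.sum_insert hi]
    exact (h i (Finset.mem_insert_self _ _)).add
      (ih fun i hi => h i (Finset.mem_insert_of_mem hi))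

theorem conv {j : ℕ} (hc : SmoothFamily T j c) (hd : SmoothFamily T j d) :
    SmoothFamily T j (conv c d) := by
  induction j generalizing c d with
  | zero =>
    refine ⟨hc.1.conv hd.1, fun k => ?_⟩
    obtain ⟨C, hC⟩ := hc.1.exists_conv_bound hd.1 0
    refine continuousOn_tsum (fun l => (hc.2 l).mul (hd.2 (k - l)))
      (summable_decayWeight.mul_left C) fun l t ht => ?_
    simpa using hC t ht k l
  | succ j ih =>
    have hc0 := hc.of_succ
    have hd0 := hd.of_succ
    obtain ⟨hcr, c', hc', hcc⟩ := hc
    obtain ⟨hdr, d', hd', hdd⟩ := hd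
    refine ⟨hcr.conv hdr, _, (ih hc' hd0).add (ih hc0 hd'), fun k t ht => ?_⟩
    obtain ⟨C, hC⟩ := hc'.rapid.exists_conv_bound hdr 0
    obtain ⟨D, hD⟩ := hcr.exists_conv_bound hd'.rapid 0
    have := hasFDerivWithinAt_tsum_of_convex (convex_Icc 0 T)
      (f := fun l t => c t l * d t (k - l))
      (f' := fun l t => ContinuousLinearMap.toSpanSingleton ℝ
        (c' t l * d t (k - l) + c t l * d' t (k - l)))
      ((summable_decayWeight.mul_left C).add (summable_decayWeight.mul_left D))
      (fun l t ht => ((hcc l t ht).mul (hdd (k - l) t ht)).hasFDerivWithinAt) (fun l t ht => ?_)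
      (fun t ht => hcr.summable_conv hdr ht k) ht
    · have h2 := this.hasDerivWithinAt
      have hs : Summable fun l => ContinuousLinearMap.toSpanSingleton ℝ
          (c' t l * d t (k - l) + c t l * d' t (k - l)) := by
        exact (ContinuousLinearMap.toSpanSingletonCLE (𝕜 := ℝ) (E := ℂ)).summable.2
          ((hc'.rapid.summable_conv hdr ht k).add (hcr.summable_conv hd'.rapid ht k))
      have e := (ContinuousLinearMap.apply ℝ ℂ (1 : ℝ)).map_tsum hs
      simp only [ContinuousLinearMap.apply_apply, ContinuousLinearMap.toSpanSingleton_apply,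
        one_smul] at e
      rw [e, (hc'.rapid.summable_conv hdr ht k).tsum_add (hcr.summable_conv hd'.rapid ht k)] at h2
      exact h2
    · rw [ContinuousLinearMap.norm_toSpanSingleton]
      refine (norm_add_le _ _).trans (add_le_add ?_ ?_)
      · simpa using hC t ht k l
      · simpa using hD t ht k l

end SmoothFamily

/-- The character `e^{i k·x}`. -/
noncomputable def expChar (k : Fin n → ℤ) (x : EuclideanSpace ℝ (Fin n)) : ℂ :=
  Complex.exp (Complex.I * ∑ i, (k i : ℂ) * (x i : ℂ))

theorem norm_expChar (k : Fin n → ℤ) (x : EuclideanSpace ℝ (Fin n)) : ‖expChar k x‖ = 1 := by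
  have : Complex.I * ∑ i, (k i : ℂ) * (x i : ℂ) = ((∑ i, (k i : ℝ) * x i : ℝ) : ℂ) * Complex.I := by
    push_cast; ring
  rw [expChar, this, Complex.norm_exp_ofReal_mul_I]

theorem expChar_add_freq (k l : Fin n → ℤ) (x : EuclideanSpace ℝ (Fin n)) :
    expChar (k + l) x = expChar k x * expChar l x := by
  rw [expChar, expChar, expChar, ← Complex.exp_add, ← mul_add, ← Finset.sum_add_distrib]
  simp [add_mul]

theorem conj_expChar (k : Fin n → ℤ) (x : EuclideanSpace ℝ (Fin n)) :
    conj (expChar k x) = expChar (-k) x := by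
  rw [expChar, expChar, ← Complex.exp_conj]
  simp

theorem isPeriodic_expChar (k : Fin n → ℤ) : IsPeriodic (expChar k) := by
  intro x i
  rw [expChar, expChar]
  have : Complex.I * ∑ j, (k j : ℂ) * ((x + EuclideanSpace.single i (2 * Real.pi)) j : ℂ) =
      Complex.I * ∑ j, (k j : ℂ) * (x j : ℂ) + k i * (2 * Real.pi * Complex.I) := by
    have e : ∀ j, ((x + EuclideanSpace.single i (2 * Real.pi)) j : ℂ) =
        x j + if j = i then (2 * Real.pi : ℂ) else 0 := by
      intro j
      by_cases h : j = i
      · subst h; simp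
      · simp [h]
    simp only [e, mul_add, Finset.sum_add_distrib, mul_ite, mul_zero, Finset.sum_ite_eq',
      Finset.mem_univ, if_true]
    ring
  rw [this, Complex.exp_add, Complex.exp_int_mul_two_pi_mul_I, mul_one]

/-- The derivative of `e^{i k·x}`. -/
noncomputable def expCharDeriv (k : Fin n → ℤ) (x : EuclideanSpace ℝ (Fin n)) :
    EuclideanSpace ℝ (Fin n) →L[ℝ] ℂ :=
  ∑ i, (EuclideanSpace.proj i : EuclideanSpace ℝ (Fin n) →L[ℝ] ℝ).smulRight
    (Complex.I * k i * expChar k x)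

theorem hasFDerivAt_expChar (k : Fin n → ℤ) (x : EuclideanSpace ℝ (Fin n)) :
    HasFDerivAt (expChar k) (expCharDeriv k x) x := by
  have h1 : HasFDerivAt (fun x : EuclideanSpace ℝ (Fin n) => Complex.I * ∑ i, (k i : ℂ) * (x i : ℂ))
      (∑ i, (EuclideanSpace.proj i : EuclideanSpace ℝ (Fin n) →L[ℝ] ℝ).smulRight
        (Complex.I * k i)) x := by
    have e : (fun x : EuclideanSpace ℝ (Fin n) => Complex.I * ∑ i, (k i : ℂ) * (x i : ℂ)) =
        (∑ i, (EuclideanSpace.proj i : EuclideanSpace ℝ (Fin n) →L[ℝ] ℝ).smulRight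
        (Complex.I * k i) : EuclideanSpace ℝ (Fin n) →L[ℝ] ℂ) := by
      ext x
      simp [Finset.mul_sum]
      exact Finset.sum_congr rfl fun i _ => by ring
    rw [e]
    exact ContinuousLinearMap.hasFDerivAt _
  refine h1.cexp.congr_fderiv ?_
  ext v
  simp only [expCharDeriv, expChar, _root_.smul_apply, _root_.sum_apply,
    ContinuousLinearMap.smulRight_apply, Finset.smul_sum, smul_eq_mul, Complex.real_smul]
  exact Finset.sum_congr rfl fun i _ => by ring

theorem norm_expCharDeriv_le (k : Fin n → ℤ) (x : EuclideanSpace ℝ (Fin n)) :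
    ‖expCharDeriv k x‖ ≤ n * ‖kvec k‖ := by
  refine (norm_sum_le _ _).trans ?_
  have h : ∀ i ∈ Finset.univ, ‖(EuclideanSpace.proj i : EuclideanSpace ℝ (Fin n) →L[ℝ] ℝ).smulRight
      (Complex.I * k i * expChar k x)‖ ≤ ‖kvec k‖ := by
    intro i _
    rw [ContinuousLinearMap.norm_smulRight_apply, norm_mul, norm_mul, Complex.norm_I, norm_expChar,
      one_mul, mul_one]
    have h1 : ‖(EuclideanSpace.proj i : EuclideanSpace ℝ (Fin n) →L[ℝ] ℝ)‖ ≤ 1 :=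
      ContinuousLinearMap.opNorm_le_bound _ zero_le_one fun v => by
        rw [one_mul]; exact PiLp.norm_apply_le v i
    have h2 : ‖(k i : ℂ)‖ ≤ ‖kvec k‖ := by
      rw [Complex.norm_intCast]; exact abs_le_norm_kvec k i
    calc _ ≤ 1 * ‖kvec k‖ := by gcongr
      _ = _ := one_mul _
  refine (Finset.sum_le_sum h).trans ?_
  simp

theorem euclideanProj_apply {𝕜 : Type*} [RCLike 𝕜] (i : Fin n) (v : EuclideanSpace 𝕜 (Fin n)) :
    (EuclideanSpace.proj i : EuclideanSpace 𝕜 (Fin n) →L[𝕜] 𝕜) v = v i := rfl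

/-- The function on `ℝ × ℝⁿ` with Fourier coefficients `c`. -/
noncomputable def fourierSeries (c : ℝ → (Fin n → ℤ) → ℂ) (z : ℝ × EuclideanSpace ℝ (Fin n)) : ℂ :=
  ∑' k, c z.1 k * expChar k z.2

/-- The Fourier coefficients of the `i`-th partial derivative. -/
noncomputable def partialCoeff (i : Fin n) (c : ℝ → (Fin n → ℤ) → ℂ) (t : ℝ) (k : Fin n → ℤ) : ℂ :=
  (Complex.I * k i) * c t k

theorem norm_I_mul_le (k : Fin n → ℤ) (i : Fin n) :
    ‖Complex.I * (k i : ℂ)‖ ≤ 1 * (1 + ‖kvec k‖) ^ 1 := by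
  rw [norm_mul, Complex.norm_I, Complex.norm_intCast, one_mul, one_mul, pow_one]
  linarith [abs_le_norm_kvec k i]

theorem SmoothFamily.partialDeriv {T : ℝ} {j : ℕ} {c : ℝ → (Fin n → ℤ) → ℂ}
    (hc : SmoothFamily T j c) (i : Fin n) : SmoothFamily T j (partialCoeff i c) :=
  hc.mul_left (μ := fun k => Complex.I * k i) fun k => norm_I_mul_le k i

theorem RapidOn.summable_norm {T : ℝ} {c : ℝ → (Fin n → ℤ) → ℂ} (hc : RapidOn T c) {t : ℝ}
    (ht : t ∈ Icc 0 T) : Summable fun k => ‖c t k‖ := by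
  obtain ⟨C, _, hC⟩ := hc.exists_le_decayWeight 0
  refine Summable.of_nonneg_of_le (fun _ => norm_nonneg _) (fun k => ?_)
    (summable_decayWeight.mul_left C)
  simpa using hC t ht k

theorem RapidOn.summable_norm_mul_expChar {T : ℝ} {c : ℝ → (Fin n → ℤ) → ℂ} (hc : RapidOn T c)
    {t : ℝ} (ht : t ∈ Icc 0 T) (x : EuclideanSpace ℝ (Fin n)) :
    Summable fun k => ‖c t k * expChar k x‖ := by
  simpa only [norm_mul, norm_expChar, mul_one] using hc.summable_norm ht

theorem fourierSeries_add {T : ℝ} {c d : ℝ → (Fin n → ℤ) → ℂ} (hc : RapidOn T c) (hd : RapidOn T d)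
    {t : ℝ} (ht : t ∈ Icc 0 T) (x : EuclideanSpace ℝ (Fin n)) :
    fourierSeries (fun t k => c t k + d t k) (t, x) = fourierSeries c (t, x) +
      fourierSeries d (t, x) := by
  simp only [fourierSeries, add_mul]
  exact (hc.summable_norm_mul_expChar ht x).of_norm.tsum_add
    (hd.summable_norm_mul_expChar ht x).of_norm

theorem fourierSeries_const_mul (μ : ℂ) (c : ℝ → (Fin n → ℤ) → ℂ)
    (z : ℝ × EuclideanSpace ℝ (Fin n)) :
    fourierSeries (fun t k => μ * c t k) z = μ * fourierSeries c z := by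
  simp only [fourierSeries, mul_assoc]
  exact tsum_mul_left

theorem fourierSeries_sum {T : ℝ} {ι : Type*} (s : Finset ι) {c : ι → ℝ → (Fin n → ℤ) → ℂ}
    (hc : ∀ i, RapidOn T (c i)) {t : ℝ} (ht : t ∈ Icc 0 T) (x : EuclideanSpace ℝ (Fin n)) :
    fourierSeries (fun t k => ∑ i ∈ s, c i t k) (t, x) = ∑ i ∈ s, fourierSeries (c i) (t, x) := by
  simp only [fourierSeries, Finset.sum_mul]
  exact Summable.tsum_finsetSum fun i _ => ((hc i).summable_norm_mul_expChar ht x).of_norm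

theorem fourierSeries_mul {T : ℝ} {c d : ℝ → (Fin n → ℤ) → ℂ} (hc : RapidOn T c) (hd : RapidOn T d)
    {t : ℝ} (ht : t ∈ Icc 0 T) (x : EuclideanSpace ℝ (Fin n)) :
    fourierSeries c (t, x) * fourierSeries d (t, x) = fourierSeries (conv c d) (t, x) := by
  have h1 := hc.summable_norm_mul_expChar ht x
  have h2 := hd.summable_norm_mul_expChar ht x
  simp only [fourierSeries]
  rw [tsum_mul_tsum_of_summable_norm h1 h2]
  -- The pair `(k, l)` is reindexed to the frequencies `(l, k - l)` of the two factors.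
  let e : (Fin n → ℤ) × (Fin n → ℤ) ≃ (Fin n → ℤ) × (Fin n → ℤ) :=
    ⟨fun p => (p.2, p.1 - p.2), fun q => (q.1 + q.2, q.1), fun p => by simp, fun q => by simp⟩
  have hs := summable_mul_of_summable_norm h1 h2
  rw [← e.tsum_eq]
  have hs' := e.summable_iff.2 hs
  refine hs'.tsum_prod.trans (tsum_congr fun k => ?_)
  rw [conv, ← tsum_mul_right]
  refine tsum_congr fun l => ?_
  have : expChar k x = expChar l x * expChar (k - l) x := by
    rw [← expChar_add_freq]; congr 1; abel
  simp only [e, Equiv.coe_fn_mk, Function.comp_apply]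
  rw [this]
  ring

/-- The space-time derivative of a Fourier series with coefficients `c`, if `c'` is the time
derivative of `c`. -/
noncomputable def fourierSeriesDeriv (c c' : ℝ → (Fin n → ℤ) → ℂ)
    (z : ℝ × EuclideanSpace ℝ (Fin n)) : ℝ × EuclideanSpace ℝ (Fin n) →L[ℝ] ℂ :=
  (ContinuousLinearMap.fst ℝ ℝ (EuclideanSpace ℝ (Fin n))).smulRight (fourierSeries c' z) +
    ∑ i, ((EuclideanSpace.proj i : EuclideanSpace ℝ (Fin n) →L[ℝ] ℝ).comp
      (ContinuousLinearMap.snd ℝ ℝ (EuclideanSpace ℝ (Fin n)))).smulRight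
        (fourierSeries (partialCoeff i c) z)

theorem hasFDerivWithinAt_fourierSeries {T : ℝ} {c c' : ℝ → (Fin n → ℤ) → ℂ} (hc : RapidOn T c)
    (hc' : RapidOn T c')
    (h : ∀ k, ∀ t ∈ Icc 0 T, HasDerivWithinAt (fun s => c s k) (c' t k) (Icc 0 T) t)
    {z : ℝ × EuclideanSpace ℝ (Fin n)}
    (hz : z ∈ Icc 0 T ×ˢ (univ : Set (EuclideanSpace ℝ (Fin n)))) :
    HasFDerivWithinAt (fourierSeries c) (fourierSeriesDeriv c c' z)
      (Icc 0 T ×ˢ (univ : Set (EuclideanSpace ℝ (Fin n)))) z := by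
  obtain ⟨C, hC0, hC⟩ := hc.exists_le_decayWeight 1
  obtain ⟨C', hC'0, hC'⟩ := hc'.exists_le_decayWeight 0
  set S := Icc 0 T ×ˢ (univ : Set (EuclideanSpace ℝ (Fin n))) with hS
  let f' : (Fin n → ℤ) → ℝ × EuclideanSpace ℝ (Fin n) → ℝ × EuclideanSpace ℝ (Fin n) →L[ℝ] ℂ :=
    fun k z => c z.1 k • (expCharDeriv k z.2).comp (ContinuousLinearMap.snd ℝ ℝ _) +
      expChar k z.2 • (ContinuousLinearMap.fst ℝ ℝ _).smulRight (c' z.1 k)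
  have hf : ∀ k, ∀ z ∈ S, HasFDerivWithinAt (fun z : ℝ × EuclideanSpace ℝ (Fin n) =>
      c z.1 k * expChar k z.2) (f' k z) S z := by
    intro k z hz
    have h1 : HasFDerivWithinAt (fun z : ℝ × EuclideanSpace ℝ (Fin n) => c z.1 k)
        ((ContinuousLinearMap.fst ℝ ℝ _).smulRight (c' z.1 k)) S z := by
      refine ((h k z.1 hz.1).hasFDerivWithinAt.comp z hasFDerivWithinAt_fst
        fun y hy => hy.1).congr_fderiv ?_
      ext <;> simp
    have h2 : HasFDerivWithinAt (fun z : ℝ × EuclideanSpace ℝ (Fin n) => expChar k z.2)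
        ((expCharDeriv k z.2).comp (ContinuousLinearMap.snd ℝ ℝ _)) S z :=
      ((hasFDerivAt_expChar k z.2).comp z hasFDerivAt_snd).hasFDerivWithinAt
    exact h1.mul h2
  have hb : ∀ k, ∀ z ∈ S, ‖f' k z‖ ≤ n * (C * decayWeight k) + C' * decayWeight k := by
    intro k z hz
    refine (norm_add_le _ _).trans (add_le_add ?_ ?_)
    · rw [norm_smul]
      have h1 : ‖(expCharDeriv k z.2).comp (ContinuousLinearMap.snd ℝ ℝ _)‖ ≤ n * ‖kvec k‖ := by
        refine (ContinuousLinearMap.opNorm_comp_le _ _).trans ?_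
        have := ContinuousLinearMap.norm_snd_le (𝕜 := ℝ) (E := ℝ) (F := EuclideanSpace ℝ (Fin n))
        calc _ ≤ (n * ‖kvec k‖) * 1 := by
              gcongr
              exact norm_expCharDeriv_le _ _
          _ = _ := mul_one _
      have h2 := hC z.1 hz.1 k
      rw [pow_one] at h2
      calc _ ≤ ‖c z.1 k‖ * (n * ‖kvec k‖) := by gcongr
        _ ≤ n * ((1 + ‖kvec k‖) * ‖c z.1 k‖) := by
            have : 0 ≤ (n : ℝ) * ‖c z.1 k‖ := by positivity
            linarith
        _ ≤ _ := by gcongr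
    · rw [norm_smul, norm_expChar, one_mul, ContinuousLinearMap.norm_smulRight_apply]
      have := ContinuousLinearMap.norm_fst_le (𝕜 := ℝ) (E := ℝ) (F := EuclideanSpace ℝ (Fin n))
      have h2 := hC' z.1 hz.1 k
      rw [pow_zero, one_mul] at h2
      calc _ ≤ 1 * ‖c' z.1 k‖ := by gcongr
        _ ≤ _ := by rwa [one_mul]
  have hu : Summable fun k : Fin n → ℤ => n * (C * decayWeight k) + C' * decayWeight k :=
    ((summable_decayWeight.mul_left C).mul_left (n : ℝ)).add (summable_decayWeight.mul_left C')
  have key := hasFDerivWithinAt_tsum_of_convex ((convex_Icc 0 T).prod convex_univ) hu hf hb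
    (fun z hz => (hc.summable_norm_mul_expChar hz.1 z.2).of_norm) hz
  refine HasFDerivWithinAt.congr_fderiv key ?_
  have hsum : Summable fun k => f' k z := Summable.of_norm_bounded hu fun k => hb k z hz
  ext v
  · have e := (ContinuousLinearMap.apply ℝ ℂ ((1, 0) : ℝ × EuclideanSpace ℝ (Fin n))).map_tsum hsum
    simp only [ContinuousLinearMap.apply_apply] at e
    simp only [ContinuousLinearMap.comp_apply, ContinuousLinearMap.inl_apply]
    rw [e]
    simp [f', fourierSeriesDeriv, fourierSeries, mul_comm]
  · have e := (ContinuousLinearMap.apply ℝ ℂ ((0, v) : ℝ × EuclideanSpace ℝ (Fin n))).map_tsum hsum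
    simp only [ContinuousLinearMap.apply_apply] at e
    simp only [ContinuousLinearMap.comp_apply, ContinuousLinearMap.inr_apply]
    rw [e]
    have hp : ∀ i, Summable fun k => (v i : ℂ) * (partialCoeff i c z.1 k * expChar k z.2) :=
      fun i => ((RapidOn.summable_norm_mul_expChar (hc.mul_left (μ := fun k => Complex.I * k i)
        fun k => norm_I_mul_le k i) hz.1 z.2).of_norm).mul_left _
    simp only [f', fourierSeriesDeriv, fourierSeries, _root_.add_apply, _root_.smul_apply,
      ContinuousLinearMap.comp_apply, ContinuousLinearMap.smulRight_apply,
      ContinuousLinearMap.coe_fst', ContinuousLinearMap.coe_snd', zero_smul, mul_zero, add_zero,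
      zero_add, _root_.sum_apply, expCharDeriv, Complex.real_smul, euclideanProj_apply,
      smul_eq_mul, Finset.mul_sum, ← tsum_mul_left]
    rw [← Summable.tsum_finsetSum fun i _ => hp i]
    refine tsum_congr fun k => Finset.sum_congr rfl fun i _ => ?_
    rw [partialCoeff]
    ring

theorem SmoothFamily.contDiffOn_fourierSeries {T : ℝ} (hT : 0 < T) {j : ℕ}
    {c : ℝ → (Fin n → ℤ) → ℂ} (hc : SmoothFamily T j c) :
    ContDiffOn ℝ j (fourierSeries c) (Icc 0 T ×ˢ (univ : Set (EuclideanSpace ℝ (Fin n)))) := by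
  induction j generalizing c with
  | zero =>
    obtain ⟨C, _, hC⟩ := hc.1.exists_le_decayWeight 0
    rw [Nat.cast_zero, contDiffOn_zero]
    refine continuousOn_tsum (fun k => ?_) (summable_decayWeight.mul_left C) fun k z hz => ?_
    · refine ((hc.2 k).comp continuousOn_fst fun z hz => hz.1).mul (Continuous.continuousOn ?_)
      have : Continuous (expChar k) :=
        continuous_iff_continuousAt.2 fun x => (hasFDerivAt_expChar k x).continuousAt
      exact this.comp continuous_snd
    · rw [norm_mul, norm_expChar, mul_one]
      simpa using hC z.1 hz.1 k
  | succ j ih =>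
    have hc0 := hc.of_succ
    obtain ⟨hcr, c', hc', hcc⟩ := hc
    have hu : UniqueDiffOn ℝ (Icc 0 T ×ˢ (univ : Set (EuclideanSpace ℝ (Fin n)))) :=
      (uniqueDiffOn_Icc hT).prod uniqueDiffOn_univ
    have hd := fun z hz => hasFDerivWithinAt_fourierSeries hcr hc'.rapid hcc (z := z) hz
    rw [Nat.cast_add, Nat.cast_one]
    refine contDiffOn_succ_of_fderivWithin (fun z hz => (hd z hz).differentiableWithinAt)
      (fun h => absurd h (by simp)) (ContDiffOn.congr (f := fourierSeriesDeriv c c') ?_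
        fun z hz => (hd z hz).fderivWithin (hu z hz))
    refine ContDiffOn.add ?_ (ContDiffOn.sum fun i _ => ?_)
    · exact (ContinuousLinearMap.smulRightL ℝ _ ℂ (ContinuousLinearMap.fst ℝ ℝ
        (EuclideanSpace ℝ (Fin n)))).contDiff.comp_contDiffOn (ih hc')
    · exact (ContinuousLinearMap.smulRightL ℝ _ ℂ ((EuclideanSpace.proj i :
        EuclideanSpace ℝ (Fin n) →L[ℝ] ℝ).comp (ContinuousLinearMap.snd ℝ ℝ
          (EuclideanSpace ℝ (Fin n))))).contDiff.comp_contDiffOn (ih (hc0.partialDeriv i))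

/-! ### From Fourier coefficients to smooth solutions -/

/-- The real part of the Fourier series with coefficients `c`. -/
noncomputable def realSeries (c : ℝ → (Fin n → ℤ) → ℂ) (t : ℝ) (x : EuclideanSpace ℝ (Fin n)) : ℝ :=
  (fourierSeries c (t, x)).re

/-- The linear form with coordinates `g`. -/
noncomputable def linearForm (g : Fin n → ℝ) : EuclideanSpace ℝ (Fin n) →L[ℝ] ℝ :=
  ∑ i, g i • (EuclideanSpace.proj i : EuclideanSpace ℝ (Fin n) →L[ℝ] ℝ)

theorem linearForm_apply (g : Fin n → ℝ) (v : EuclideanSpace ℝ (Fin n)) :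
    linearForm g v = ∑ i, g i * v i := by
  simp [linearForm]

theorem linearForm_single (g : Fin n → ℝ) (i : Fin n) :
    linearForm g (EuclideanSpace.single i 1) = g i := by
  simp [linearForm_apply]

theorem isPeriodic_realSeries (c : ℝ → (Fin n → ℤ) → ℂ) (t : ℝ) : IsPeriodic (realSeries c t) := by
  intro x i
  simp only [realSeries, fourierSeries, isPeriodic_expChar _ x i]

section

variable {T : ℝ} {c c' : ℝ → (Fin n → ℤ) → ℂ}

theorem SmoothFamily.hasFDerivAt_realSeries (hc : SmoothFamily T 1 c) {t : ℝ} (ht : t ∈ Icc 0 T)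
    (x : EuclideanSpace ℝ (Fin n)) :
    HasFDerivAt (realSeries c t) (linearForm fun i => realSeries (partialCoeff i c) t x) x := by
  obtain ⟨hcr, c', hc', hcc⟩ := hc
  have h1 := hasFDerivWithinAt_fourierSeries hcr hc'.rapid hcc (z := (t, x)) ⟨ht, mem_univ x⟩
  have h2 := h1.comp_hasFDerivAt x (hasFDerivAt_prodMk_right t x)
    (Eventually.of_forall fun y => ⟨ht, mem_univ y⟩)
  refine (Complex.reCLM.hasFDerivAt.comp x h2).congr_fderiv ?_
  ext v
  simp [fourierSeriesDeriv, linearForm_apply, realSeries, mul_comm]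

theorem hasDerivWithinAt_realSeries (hc : RapidOn T c) (hc' : RapidOn T c')
    (h : ∀ k, ∀ t ∈ Icc 0 T, HasDerivWithinAt (fun s => c s k) (c' t k) (Icc 0 T) t)
    {t : ℝ} (ht : t ∈ Icc 0 T) (x : EuclideanSpace ℝ (Fin n)) :
    HasDerivWithinAt (fun s => realSeries c s x) (realSeries c' t x) (Icc 0 T) t := by
  have h1 := hasFDerivWithinAt_fourierSeries hc hc' h (z := (t, x)) ⟨ht, mem_univ x⟩
  have h2 := h1.comp_hasDerivWithinAt (f := fun s => (s, x)) t
    ((hasDerivWithinAt_id t (Icc 0 T)).prodMk (hasDerivWithinAt_const t _ x))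
    (fun s hs => ⟨hs, mem_univ x⟩ : MapsTo (fun s => (s, x)) (Icc 0 T) (Icc 0 T ×ˢ univ))
  refine (Complex.reCLM.hasFDerivAt.comp_hasDerivWithinAt t h2).congr_deriv ?_
  simp [fourierSeriesDeriv, realSeries]

theorem contDiffOn_realSeries (hT : 0 < T) (hc : ∀ j, SmoothFamily T j c) :
    ContDiffOn ℝ ∞ (fun z : ℝ × EuclideanSpace ℝ (Fin n) => realSeries c z.1 z.2)
      (Icc 0 T ×ˢ (univ : Set (EuclideanSpace ℝ (Fin n)))) :=
  contDiffOn_infty.2 fun j => Complex.reCLM.contDiff.comp_contDiffOn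
    ((hc j).contDiffOn_fourierSeries hT)

theorem SmoothFamily.contDiff_realSeries (hT : 0 < T) {j : ℕ} (hc : SmoothFamily T j c) {t : ℝ}
    (ht : t ∈ Icc 0 T) : ContDiff ℝ j (realSeries c t) := by
  rw [← contDiffOn_univ]
  exact (Complex.reCLM.contDiff.comp_contDiffOn (hc.contDiffOn_fourierSeries hT)).comp
    (f := fun x : EuclideanSpace ℝ (Fin n) => (t, x)) (by fun_prop) fun x _ => ⟨ht, mem_univ x⟩

theorem SmoothFamily.laplacian_realSeries (hc : SmoothFamily T 1 c) {t : ℝ} (ht : t ∈ Icc 0 T)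
    (x : EuclideanSpace ℝ (Fin n)) : Laplacian.laplacian (realSeries c t) x =
      ∑ i, realSeries (partialCoeff i (partialCoeff i c)) t x := by
  rw [InnerProductSpace.laplacian_eq_iteratedFDeriv_orthonormalBasis _
    (EuclideanSpace.basisFun (Fin n) ℝ)]
  have h1 : fderiv ℝ (realSeries c t) = fun x => linearForm fun i =>
      realSeries (partialCoeff i c) t x := funext fun x => (hc.hasFDerivAt_realSeries ht x).fderiv
  refine Finset.sum_congr rfl fun i _ => ?_
  rw [iteratedFDeriv_two_apply, h1]
  have h2 : HasFDerivAt (fun x => linearForm fun i => realSeries (partialCoeff i c) t x)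
      (∑ j, (linearForm fun i => realSeries (partialCoeff i (partialCoeff j c)) t x).smulRight
        (EuclideanSpace.proj j : EuclideanSpace ℝ (Fin n) →L[ℝ] ℝ)) x := by
    change HasFDerivAt (fun x => ∑ j, realSeries (partialCoeff j c) t x •
      (EuclideanSpace.proj j : EuclideanSpace ℝ (Fin n) →L[ℝ] ℝ)) _ x
    exact HasFDerivAt.fun_sum fun j _ => ((ContinuousLinearMap.id ℝ ℝ).smulRight
      (EuclideanSpace.proj j : EuclideanSpace ℝ (Fin n) →L[ℝ] ℝ)).hasFDerivAt.comp x
        ((hc.partialDeriv j).hasFDerivAt_realSeries ht x)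
  rw [h2.fderiv]
  simp [_root_.sum_apply, linearForm_single]

theorem realSeries_add (hc : RapidOn T c) (hc' : RapidOn T c') {t : ℝ} (ht : t ∈ Icc 0 T)
    (x : EuclideanSpace ℝ (Fin n)) :
    realSeries (fun t k => c t k + c' t k) t x = realSeries c t x + realSeries c' t x := by
  simp only [realSeries, fourierSeries_add hc hc' ht, Complex.add_re]

theorem realSeries_ofReal_mul (μ : ℝ) (c : ℝ → (Fin n → ℤ) → ℂ) (t : ℝ)
    (x : EuclideanSpace ℝ (Fin n)) :
    realSeries (fun t k => (μ : ℂ) * c t k) t x = μ * realSeries c t x := by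
  simp only [realSeries, fourierSeries_const_mul, Complex.re_ofReal_mul]

theorem realSeries_sum {ι : Type*} (s : Finset ι) {c : ι → ℝ → (Fin n → ℤ) → ℂ}
    (hc : ∀ i, RapidOn T (c i)) {t : ℝ} (ht : t ∈ Icc 0 T) (x : EuclideanSpace ℝ (Fin n)) :
    realSeries (fun t k => ∑ i ∈ s, c i t k) t x = ∑ i ∈ s, realSeries (c i) t x := by
  simp only [realSeries, fourierSeries_sum s hc ht, Complex.re_sum]

theorem fourierSeries_eq_realSeries {t : ℝ} (h : ∀ k, c t (-k) = conj (c t k))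
    (x : EuclideanSpace ℝ (Fin n)) : fourierSeries c (t, x) = (realSeries c t x : ℂ) := by
  refine (Complex.conj_eq_iff_re.1 ?_).symm
  simp only [fourierSeries, Complex.conj_tsum, map_mul, conj_expChar, ← h]
  exact (Equiv.neg (Fin n → ℤ)).tsum_eq fun k => c t k * expChar k x

end

/-- The `j`-th component of a family of vectors. -/
def component (a : ℝ → (Fin n → ℤ) → EuclideanSpace ℂ (Fin n)) (j : Fin n) (t : ℝ)
    (k : Fin n → ℤ) : ℂ :=
  a t k j

/-- The Fourier coefficients of `∑ᵢ ∂ᵢ (uᵢ uⱼ)`. -/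
noncomputable def transportCoeff (a : ℝ → (Fin n → ℤ) → EuclideanSpace ℂ (Fin n)) (j : Fin n) :
    ℝ → (Fin n → ℤ) → ℂ :=
  fun t k => ∑ i, partialCoeff i (conv (component a i) (component a j)) t k

/-- The Fourier coefficients of the pressure, the solution of `-Δp = ∑ᵢⱼ ∂ᵢ ∂ⱼ (uᵢ uⱼ)`
with mean zero: at `k = 0` the quotient by `‖kvec k‖ ^ 2 = 0` is zero. -/
noncomputable def pressureCoeff (a : ℝ → (Fin n → ℤ) → EuclideanSpace ℂ (Fin n)) :
    ℝ → (Fin n → ℤ) → ℂ :=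
  fun t k => ∑ i, (Complex.I * k i / (‖kvec k‖ ^ 2 : ℝ)) * transportCoeff a i t k

/-- The Fourier coefficients of `ν Δ u - (u · ∇) u - ∇ p`. -/
noncomputable def momentumCoeff (ν : ℝ) (a : ℝ → (Fin n → ℤ) → EuclideanSpace ℂ (Fin n))
    (j : Fin n) : ℝ → (Fin n → ℤ) → ℂ :=
  fun t k => (ν : ℂ) * (∑ i, partialCoeff i (partialCoeff i (component a j)) t k) +
    ((-1 : ℝ) : ℂ) * (transportCoeff a j t k + partialCoeff j (pressureCoeff a) t k)

theorem RapidOn.component {T : ℝ} {a : ℝ → (Fin n → ℤ) → EuclideanSpace ℂ (Fin n)}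
    (ha : RapidOn T a) (j : Fin n) : RapidOn T (component a j) := fun m => by
  obtain ⟨C, hC⟩ := ha m
  refine ⟨C, fun t ht k => le_trans ?_ (hC t ht k)⟩
  gcongr
  exact PiLp.norm_apply_le (a t k) j

theorem I_mul_advection_apply {T : ℝ} {a : ℝ → (Fin n → ℤ) → EuclideanSpace ℂ (Fin n)}
    (ha : RapidOn T a) {t : ℝ} (ht : t ∈ Icc 0 T) (k : Fin n → ℤ) (j : Fin n) :
    Complex.I * advection (a t) (a t) k j = transportCoeff a j t k := by
  obtain ⟨C, hC0, hC⟩ := ha.exists_le_decayWeight 0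
  simp only [pow_zero, one_mul] at hC
  have hs : Summable fun l => inner ℂ (kvec k) (a t l) • a t (k - l) :=
    Summable.of_norm_bounded (summable_decayWeight.mul_left _)
      (norm_advection_term_le hC0 (hC t ht) k)
  have e := (EuclideanSpace.proj j : EuclideanSpace ℂ (Fin n) →L[ℂ] ℂ).map_tsum hs
  simp only [euclideanProj_apply, PiLp.smul_apply, smul_eq_mul, inner_kvec,
    Finset.sum_mul] at e
  rw [advection]
  simp only [inner_kvec]
  rw [e, Summable.tsum_finsetSum, Finset.mul_sum, transportCoeff]
  · refine Finset.sum_congr rfl fun i _ => ?_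
    simp only [partialCoeff, conv, component, mul_assoc, tsum_mul_left]
  · intro i _
    simp only [mul_assoc]
    exact ((ha.component i).summable_conv (ha.component j) ht k).mul_left _

/-- The Leray projection is the subtraction of the pressure gradient. -/
theorem nsField_apply {ν T : ℝ} {a : ℝ → (Fin n → ℤ) → EuclideanSpace ℂ (Fin n)}
    (ha : RapidOn T a) {t : ℝ} (ht : t ∈ Icc 0 T) (hdiv : IsDivFreeFamily (a t)) (k : Fin n → ℤ)
    (j : Fin n) : nsField ν (a t) k j = momentumCoeff ν a j t k := by
  have e1 : inner ℂ (kvec k) (Complex.I • advection (a t) (a t) k) =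
      ∑ i, (k i : ℂ) * transportCoeff a i t k := by
    rw [inner_kvec]
    refine Finset.sum_congr rfl fun i _ => ?_
    rw [PiLp.smul_apply, smul_eq_mul, I_mul_advection_apply ha ht]
  have e2 : partialCoeff j (pressureCoeff a) t k =
      -((∑ i, (k i : ℂ) * transportCoeff a i t k) / (‖kvec k‖ ^ 2 : ℝ) * k j) := by
    rw [partialCoeff, pressureCoeff, Finset.mul_sum, Finset.sum_div, Finset.sum_mul,
      ← Finset.sum_neg_distrib]
    refine Finset.sum_congr rfl fun i _ => ?_
    have := Complex.I_mul_I
    linear_combination (k j : ℂ) * (k i : ℂ) / (‖kvec k‖ ^ 2 : ℝ) * transportCoeff a i t k * this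
  have e3 : ∑ i, partialCoeff i (partialCoeff i (component a j)) t k =
      -(‖kvec k‖ ^ 2 : ℝ) * a t k j := by
    rw [norm_kvec_sq, ← Complex.ofReal_neg, ← Finset.sum_neg_distrib, Complex.ofReal_sum,
      Finset.sum_mul]
    refine Finset.sum_congr rfl fun i _ => ?_
    rw [partialCoeff, partialCoeff, component]
    push_cast
    have := Complex.I_mul_I
    linear_combination (k i : ℂ) ^ 2 * a t k j * this
  rw [nsField, momentumCoeff, e2, e3, leray_apply, inner_sub_right, e1, ← Complex.coe_smul,
    inner_smul_right, hdiv k, mul_zero, zero_sub, PiLp.sub_apply, PiLp.sub_apply, PiLp.smul_apply,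
    PiLp.smul_apply, PiLp.smul_apply, smul_eq_mul, smul_eq_mul, smul_eq_mul,
    I_mul_advection_apply ha ht]
  have e4 : kvec k j = k j := rfl
  rw [e4]
  push_cast
  ring

section

variable {T : ℝ} {m : ℕ} {a : ℝ → (Fin n → ℤ) → EuclideanSpace ℂ (Fin n)}

theorem smoothFamily_transportCoeff (h : ∀ j, SmoothFamily T m (component a j)) (j : Fin n) :
    SmoothFamily T m (transportCoeff a j) :=
  SmoothFamily.sum _ fun i _ => ((h i).conv (h j)).partialDeriv i

theorem smoothFamily_pressureCoeff (h : ∀ j, SmoothFamily T m (component a j)) :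
    SmoothFamily T m (pressureCoeff a) := by
  refine SmoothFamily.sum _ fun i _ => (smoothFamily_transportCoeff h i).mul_left
    (μ := fun k => Complex.I * k i / (‖kvec k‖ ^ 2 : ℝ)) (C := 1) (p := 0) fun k => ?_
  rw [pow_zero, mul_one]
  by_cases hk : k = 0
  · simp [hk]
  · have h1 := one_le_norm_kvec hk
    rw [norm_div, norm_mul, Complex.norm_I, one_mul, Complex.norm_intCast, Complex.norm_real,
      Real.norm_of_nonneg (by positivity), div_le_one (by positivity)]
    nlinarith [abs_le_norm_kvec k i]

theorem smoothFamily_momentumCoeff (ν : ℝ) (h : ∀ j, SmoothFamily T m (component a j))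
    (j : Fin n) : SmoothFamily T m (momentumCoeff ν a j) := by
  have hc : ∀ (μ : ℝ) (k : Fin n → ℤ), ‖(μ : ℂ)‖ ≤ |μ| * (1 + ‖kvec k‖) ^ 0 := fun μ k => by simp
  refine SmoothFamily.add ?_ ?_
  · exact (SmoothFamily.sum _ fun i _ => ((h j).partialDeriv i).partialDeriv i).mul_left (hc ν)
  · exact ((smoothFamily_transportCoeff h j).add
      ((smoothFamily_pressureCoeff h).partialDeriv j)).mul_left (hc (-1))

/-- A solution of the equation on the Fourier side is smooth in time, as its time derivative is a
polynomial in the solution. -/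
theorem smoothFamily_component {ν : ℝ} (ha : RapidOn T a)
    (hdiv : ∀ t ∈ Icc 0 T, IsDivFreeFamily (a t))
    (hode : ∀ k, ∀ t ∈ Icc 0 T, HasDerivWithinAt (fun s => a s k) (nsField ν (a t) k) (Icc 0 T) t)
    (m : ℕ) (j : Fin n) : SmoothFamily T m (component a j) := by
  have hj : ∀ j k, ∀ t ∈ Icc 0 T, HasDerivWithinAt (fun s => component a j s k)
      (momentumCoeff ν a j t k) (Icc 0 T) t := fun j k t ht => by
    have := ((EuclideanSpace.proj j : EuclideanSpace ℂ (Fin n) →L[ℂ] ℂ).restrictScalars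
      ℝ).hasFDerivAt.comp_hasDerivWithinAt t (hode k t ht)
    rw [← nsField_apply ha ht (hdiv t ht)]
    exact this
  induction m generalizing j with
  | zero => exact ⟨ha.component j, fun k t ht => (hj j k t ht).continuousWithinAt⟩
  | succ m ih => exact ⟨ha.component j, _, smoothFamily_momentumCoeff ν ih j, hj j⟩

end

theorem timeInterval_ofReal (T : ℝ) : timeInterval (ENNReal.ofReal T) = Ico 0 T := by
  ext t
  simp only [timeInterval, mem_ofPred_eq, mem_Ico]
  refine and_congr_right fun ht => ?_
  rw [ENNReal.ofReal_lt_ofReal_iff']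
  exact ⟨fun h => h.1, fun h => ⟨h, ht.trans_lt h⟩⟩

theorem gradient_apply {f : EuclideanSpace ℝ (Fin n) → ℝ} {x : EuclideanSpace ℝ (Fin n)}
    (i : Fin n) : gradient f x i = fderiv ℝ f x (EuclideanSpace.single i 1) := by
  have : inner ℝ (gradient f x) (EuclideanSpace.single i (1 : ℝ)) =
      fderiv ℝ f x (EuclideanSpace.single i 1) := by
    rw [gradient, InnerProductSpace.toDual_symm_apply]
  rw [← this, EuclideanSpace.inner_single_right]
  simp

theorem hasFDerivAt_euclidean_iff {f : EuclideanSpace ℝ (Fin n) → EuclideanSpace ℝ (Fin n)}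
    {f' : EuclideanSpace ℝ (Fin n) →L[ℝ] EuclideanSpace ℝ (Fin n)} {x : EuclideanSpace ℝ (Fin n)} :
    HasFDerivAt f f' x ↔ ∀ i, HasFDerivAt (fun y => f y i)
      ((EuclideanSpace.proj i : EuclideanSpace ℝ (Fin n) →L[ℝ] ℝ).comp f') x := by
  simp only [← hasFDerivWithinAt_univ]
  exact hasFDerivWithinAt_euclidean

theorem hasDerivWithinAt_euclidean_iff {f : ℝ → EuclideanSpace ℝ (Fin n)}
    {f' : EuclideanSpace ℝ (Fin n)} {s : Set ℝ} {t : ℝ} :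
    HasDerivWithinAt f f' s t ↔ ∀ i, HasDerivWithinAt (fun y => f y i) (f' i) s t := by
  rw [hasDerivWithinAt_iff_hasFDerivWithinAt, hasFDerivWithinAt_euclidean]
  refine forall_congr' fun i => ?_
  rw [hasDerivWithinAt_iff_hasFDerivWithinAt]
  refine iff_of_eq (congrArg (fun L => HasFDerivWithinAt _ L s t) ?_)
  ext
  simp

/-- The Fourier series of a solution on the Fourier side is a smooth solution. -/
theorem isSmoothSolution_of_fourier {ν T : ℝ} (hT : 0 < T)
    {a : ℝ → (Fin n → ℤ) → EuclideanSpace ℂ (Fin n)} (ha : RapidOn T a)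
    (hreal : ∀ t ∈ Icc 0 T, IsRealFamily (a t)) (hdiv : ∀ t ∈ Icc 0 T, IsDivFreeFamily (a t))
    (hode : ∀ k, ∀ t ∈ Icc 0 T, HasDerivWithinAt (fun s => a s k) (nsField ν (a t) k) (Icc 0 T) t)
    {u₀ : EuclideanSpace ℝ (Fin n) → EuclideanSpace ℝ (Fin n)}
    (h0 : ∀ x j, realSeries (component a j) 0 x = u₀ x j) :
    IsSmoothSolution ν u₀ (ENNReal.ofReal T)
      fun t x => WithLp.toLp 2 fun j => realSeries (component a j) t x := by
  have hs : ∀ m j, SmoothFamily T m (component a j) := smoothFamily_component ha hdiv hode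
  have hsub : timeInterval (ENNReal.ofReal T) ⊆ Icc 0 T := by
    rw [timeInterval_ofReal]; exact Ico_subset_Icc_self
  set u : ℝ → EuclideanSpace ℝ (Fin n) → EuclideanSpace ℝ (Fin n) :=
    fun t x => WithLp.toLp 2 fun j => realSeries (component a j) t x with hu
  have hux : ∀ t ∈ Icc 0 T, ∀ x v j, fderiv ℝ (u t) x v j =
      ∑ i, realSeries (partialCoeff i (component a j)) t x * v i := by
    intro t ht x v j
    have hd : HasFDerivAt (u t) ((EuclideanSpace.equiv (Fin n) ℝ).symm.toContinuousLinearMap.comp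
        (ContinuousLinearMap.pi fun j => linearForm fun i =>
          realSeries (partialCoeff i (component a j)) t x)) x := by
      rw [hasFDerivAt_euclidean_iff]
      exact fun j => ((hs 1 j).hasFDerivAt_realSeries ht x).congr_fderiv (by ext; simp)
    rw [hd.fderiv]
    simp [linearForm_apply]
  have hdiv0 : ∀ t ∈ Icc 0 T, ∀ x, ∑ i, realSeries (partialCoeff i (component a i)) t x = 0 := by
    intro t ht x
    rw [← realSeries_sum _ (fun i => ((hs 0 i).partialDeriv i).rapid) ht]
    have : ∀ k, ∑ i, partialCoeff i (component a i) t k = 0 := fun k => by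
      have := hdiv t ht k
      rw [inner_kvec] at this
      simp only [partialCoeff, component, mul_assoc, ← Finset.mul_sum, this, mul_zero]
    simp [realSeries, fourierSeries, this]
  refine ⟨?_, fun t ht x i => ?_, fun t ht x => ?_, fun x => ?_, realSeries (pressureCoeff a),
    ?_, fun t ht => isPeriodic_realSeries _ t, fun t ht x => ?_⟩
  · refine ContDiffOn.mono ?_ (prod_mono_left hsub)
    rw [contDiffOn_euclidean]
    exact fun j => contDiffOn_realSeries hT fun m => hs m j
  · ext j
    exact isPeriodic_realSeries _ t x i
  · simp only [divergence, hux t (hsub ht)]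
    rw [← hdiv0 t (hsub ht) x]
    refine Finset.sum_congr rfl fun i _ => ?_
    simp
  · ext j
    exact h0 x j
  · exact (contDiffOn_realSeries hT fun m => smoothFamily_pressureCoeff (hs m)).mono
      (prod_mono_left hsub)
  · have htI := hsub ht
    have hode' : ∀ j k, ∀ t ∈ Icc 0 T, HasDerivWithinAt (fun s => component a j s k)
        (momentumCoeff ν a j t k) (Icc 0 T) t := fun j k t ht => by
      have := ((EuclideanSpace.proj j : EuclideanSpace ℂ (Fin n) →L[ℂ] ℂ).restrictScalars
        ℝ).hasFDerivAt.comp_hasDerivWithinAt t (hode k t ht)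
      rw [← nsField_apply ha ht (hdiv t ht)]
      exact this
    rw [hasDerivWithinAt_euclidean_iff]
    intro j
    have h1 := (hasDerivWithinAt_realSeries (ha.component j)
      (smoothFamily_momentumCoeff ν (hs 0) j).rapid (hode' j) htI x).mono hsub
    refine h1.congr_deriv ?_
    have hlap : Laplacian.laplacian (u t) x j =
        ∑ i, realSeries (partialCoeff i (partialCoeff i (component a j))) t x := by
      have hu2 : ContDiffAt ℝ 2 (u t) x := by
        refine ContDiff.contDiffAt ?_
        rw [contDiff_euclidean]
        exact fun j => (hs 2 j).contDiff_realSeries hT htI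
      have := hu2.laplacian_CLM_comp_left
        (l := (EuclideanSpace.proj j : EuclideanSpace ℝ (Fin n) →L[ℝ] ℝ))
      rw [← (hs 1 j).laplacian_realSeries htI]
      exact this.symm
    have hgrad : gradient (realSeries (pressureCoeff a) t) x j =
        realSeries (partialCoeff j (pressureCoeff a)) t x := by
      rw [gradient_apply,
        ((smoothFamily_pressureCoeff (hs 1)).hasFDerivAt_realSeries htI x).fderiv,
        linearForm_single]
    -- The product rule, together with `div u = 0`, turns `∑ᵢ ∂ᵢ (uᵢ uⱼ)` into `(u · ∇) uⱼ`.
    have htrans : realSeries (transportCoeff a j) t x =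
        ∑ i, realSeries (partialCoeff i (component a j)) t x * realSeries (component a i) t x := by
      have hprod : ∀ i, realSeries (partialCoeff i (conv (component a i) (component a j))) t x =
          realSeries (component a i) t x * realSeries (partialCoeff i (component a j)) t x +
          realSeries (component a j) t x * realSeries (partialCoeff i (component a i)) t x := by
        intro i
        have e : realSeries (conv (component a i) (component a j)) t = fun y =>
            realSeries (component a i) t y * realSeries (component a j) t y := by
          funext y
          have hr : ∀ i k, component a i t (-k) = conj (component a i t k) := fun i k => by
            simp only [component, hreal t htI k, conjVec_apply]
          rw [realSeries, ← fourierSeries_mul (hs 0 i).rapid (hs 0 j).rapid htI,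
            fourierSeries_eq_realSeries (hr i), fourierSeries_eq_realSeries (hr j),
            ← Complex.ofReal_mul, Complex.ofReal_re]
        have d1 := ((hs 1 i).conv (hs 1 j)).hasFDerivAt_realSeries htI x
        have d2 := ((hs 1 i).hasFDerivAt_realSeries htI x).mul
          ((hs 1 j).hasFDerivAt_realSeries htI x)
        rw [e] at d1
        have := DFunLike.congr_fun (d1.unique d2) (EuclideanSpace.single i 1)
        simpa [linearForm_single] using this
      have : realSeries (transportCoeff a j) t x =
          ∑ i, realSeries (partialCoeff i (conv (component a i) (component a j))) t x :=
        realSeries_sum _ (fun i => (((hs 0 i).conv (hs 0 j)).partialDeriv i).rapid) htI x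
      rw [this]
      simp only [hprod, Finset.sum_add_distrib, ← Finset.mul_sum, hdiv0 t htI x, mul_zero, add_zero]
      exact Finset.sum_congr rfl fun i _ => mul_comm _ _
    have hmom : realSeries (momentumCoeff ν a j) t x =
        ν * ∑ i, realSeries (partialCoeff i (partialCoeff i (component a j))) t x +
        (-1) * (realSeries (transportCoeff a j) t x +
          realSeries (partialCoeff j (pressureCoeff a)) t x) := by
      have hl : ∀ i, RapidOn T (partialCoeff i (partialCoeff i (component a j))) := fun i =>
        (((hs 0 j).partialDeriv i).partialDeriv i).rapid
      have ht0 := (smoothFamily_transportCoeff (hs 0) j).rapid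
      have hp0 := ((smoothFamily_pressureCoeff (hs 0)).partialDeriv j).rapid
      have hc : ∀ (μ : ℝ) (k : Fin n → ℤ), ‖(μ : ℂ)‖ ≤ |μ| * (1 + ‖kvec k‖) ^ 0 :=
        fun μ k => by simp
      rw [← realSeries_sum _ hl htI, ← realSeries_add ht0 hp0 htI, ← realSeries_ofReal_mul,
        ← realSeries_ofReal_mul, ← realSeries_add ?_ ((ht0.add hp0).mul_left (hc (-1))) htI]
      · rfl
      · exact (SmoothFamily.sum (j := 0) _ fun i _ =>
          ((hs 0 j).partialDeriv i).partialDeriv i).rapid.mul_left (hc ν)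
    simp only [PiLp.sub_apply, PiLp.smul_apply, smul_eq_mul]
    rw [hlap, hux t htI, hgrad, hmom, htrans]
    ring

/-! ### Integration over the period cell -/

theorem setIntegral_periodCell {E : Type*} [NormedAddCommGroup E] [NormedSpace ℝ E]
    (f : EuclideanSpace ℝ (Fin n) → E) : ∫ x in periodCell n, f x =
      ∫ y in Icc (0 : Fin n → ℝ) (fun _ => 2 * Real.pi), f (WithLp.toLp 2 y) := by
  have h1 := (PiLp.volume_preserving_toLp (Fin n)).setIntegral_preimage_emb
    (MeasurableEquiv.toLp 2 (Fin n → ℝ)).measurableEmbedding f (periodCell n)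
  have h2 : WithLp.toLp 2 ⁻¹' periodCell n =
      univ.pi fun i => Ico ((0 : Fin n → ℝ) i) (2 * Real.pi) := by
    ext y; simp [periodCell]
  rw [← h1, h2]
  exact setIntegral_congr_set Measure.univ_pi_Ico_ae_eq_Icc

theorem isCompact_toLp_Icc :
    IsCompact (WithLp.toLp 2 '' Icc (0 : Fin n → ℝ) (fun _ => 2 * Real.pi)) :=
  isCompact_Icc.image (by fun_prop)

theorem periodCell_subset :
    periodCell n ⊆ WithLp.toLp 2 '' Icc (0 : Fin n → ℝ) (fun _ => 2 * Real.pi) := fun x hx =>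
  ⟨x.ofLp, ⟨fun i => (hx i).1, fun i => (hx i).2.le⟩, rfl⟩

theorem measurableSet_periodCell : MeasurableSet (periodCell n) := by
  have : periodCell n = ⋂ i, (fun x : EuclideanSpace ℝ (Fin n) => x i) ⁻¹' Ico 0 (2 * Real.pi) := by
    ext x; simp [periodCell]
  rw [this]
  exact MeasurableSet.iInter fun i =>
    (by fun_prop : Continuous fun x : EuclideanSpace ℝ (Fin n) => x i).measurable measurableSet_Ico

theorem volume_periodCell_lt_top : volume (periodCell n) < ⊤ :=
  (measure_mono periodCell_subset).trans_lt isCompact_toLp_Icc.measure_lt_top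

theorem integrableOn_periodCell {E : Type*} [NormedAddCommGroup E]
    {f : EuclideanSpace ℝ (Fin n) → E} (hf : Continuous f) : IntegrableOn f (periodCell n) :=
  (hf.continuousOn.integrableOn_compact isCompact_toLp_Icc).mono_set periodCell_subset

/-- The integral of a divergence over the torus vanishes. -/
theorem setIntegral_periodCell_divergence {E : Type*} [NormedAddCommGroup E] [NormedSpace ℝ E]
    {F : Fin n → EuclideanSpace ℝ (Fin n) → E} (hF : ∀ i, ContDiff ℝ 1 (F i))
    (hp : ∀ i, IsPeriodic (F i)) :
    ∫ x in periodCell n, ∑ i, fderiv ℝ (F i) x (EuclideanSpace.single i 1) = 0 := by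
  cases n with
  | zero => simp
  | succ n =>
    rw [setIntegral_periodCell]
    let Λ : (Fin (n + 1) → ℝ) →L[ℝ] EuclideanSpace ℝ (Fin (n + 1)) :=
      (EuclideanSpace.equiv (Fin (n + 1)) ℝ).symm.toContinuousLinearMap
    have hΛ : ∀ y, Λ y = WithLp.toLp 2 y := fun _ => rfl
    have hsingle : ∀ i, Λ (Pi.single i 1) = EuclideanSpace.single i 1 := fun i => rfl
    have hcont : ∀ i, Continuous fun y => (fderiv ℝ (F i) (Λ y)).comp Λ := fun i =>
      (((hF i).continuous_fderiv one_ne_zero).comp Λ.continuous).clm_comp continuous_const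
    have key := integral_divergence_of_hasFDerivAt_off_countable' (0 : Fin (n + 1) → ℝ)
      (fun _ => 2 * Real.pi) (fun i => by simp [Real.pi_pos.le]) (fun i y => F i (Λ y))
      (fun i y => (fderiv ℝ (F i) (Λ y)).comp Λ) ∅ countable_empty
      (fun i => ((hF i).continuous.comp Λ.continuous).continuousOn)
      (fun y _ i => (((hF i).differentiable one_ne_zero (Λ y)).hasFDerivAt).comp y Λ.hasFDerivAt)
      (Continuous.integrableOn_Icc (continuous_finsetSum _ fun i _ =>
        (hcont i).clm_apply continuous_const))
    simp only [ContinuousLinearMap.comp_apply, hsingle] at key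
    refine key.trans (Finset.sum_eq_zero fun i _ => sub_eq_zero.2 ?_)
    refine integral_congr_ae (Eventually.of_forall fun y => ?_)
    have e : Λ (i.insertNth (2 * Real.pi) y) =
        Λ (i.insertNth 0 y) + EuclideanSpace.single i (2 * Real.pi) := by
      ext j
      rcases eq_or_ne j i with rfl | hj
      · simp [hΛ]
      · obtain ⟨j, rfl⟩ := Fin.exists_succAbove_eq hj
        simp [hΛ]
    simp only [Pi.zero_apply]
    rw [e, hp i]

theorem setIntegral_periodCell_fderiv {E : Type*} [NormedAddCommGroup E] [NormedSpace ℝ E]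
    {f : EuclideanSpace ℝ (Fin n) → E} (hf : ContDiff ℝ 1 f) (hp : IsPeriodic f) (i : Fin n) :
    ∫ x in periodCell n, fderiv ℝ f x (EuclideanSpace.single i 1) = 0 := by
  have := setIntegral_periodCell_divergence (F := fun j => if j = i then f else fun _ => 0)
    (fun j => by split_ifs; exacts [hf, contDiff_const])
    (fun j => by split_ifs; exacts [hp, fun _ _ => rfl])
  rw [← this]
  refine setIntegral_congr_fun measurableSet_periodCell fun x _ => ?_
  beta_reduce
  rw [Finset.sum_eq_single i]
  · rw [if_pos rfl]
  · intro j _ hj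
    rw [if_neg hj]
    simp
  · simp

theorem IsPeriodic.fderiv_apply {E : Type*} [NormedAddCommGroup E] [NormedSpace ℝ E]
    {f : EuclideanSpace ℝ (Fin n) → E} (hp : IsPeriodic f) (v : EuclideanSpace ℝ (Fin n)) :
    IsPeriodic fun x => fderiv ℝ f x v := by
  intro x i
  have h : (fun x => f (x + EuclideanSpace.single i (2 * Real.pi))) = f := funext fun x => hp x i
  have := fderiv_comp_add_right (𝕜 := ℝ) (f := f) (x := x) (EuclideanSpace.single i (2 * Real.pi))
  rw [h] at this
  simp only [this]

/-! ### Fourier coefficients of smooth periodic functions -/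

theorem contDiff_expChar (k : Fin n → ℤ) : ContDiff ℝ ∞ (expChar k) := by
  unfold expChar
  have h : ∀ i, ContDiff ℝ ∞ fun x : EuclideanSpace ℝ (Fin n) => (x i : ℂ) := fun i =>
    Complex.ofRealCLM.contDiff.comp
      (by fun_prop : ContDiff ℝ ∞ fun x : EuclideanSpace ℝ (Fin n) => x i)
  exact (contDiff_const.mul (ContDiff.sum fun i _ => contDiff_const.mul (h i))).cexp

/-- The unnormalised Fourier coefficient of a scalar function. -/
noncomputable def cellCoeff (f : EuclideanSpace ℝ (Fin n) → ℂ) (k : Fin n → ℤ) : ℂ :=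
  ∫ x in periodCell n, expChar (-k) x * f x

/-- Integration by parts. -/
theorem cellCoeff_fderiv {f : EuclideanSpace ℝ (Fin n) → ℂ} (hf : ContDiff ℝ 1 f)
    (hp : IsPeriodic f) (k : Fin n → ℤ) (i : Fin n) :
    cellCoeff (fun x => fderiv ℝ f x (EuclideanSpace.single i 1)) k =
      Complex.I * k i * cellCoeff f k := by
  have he : ContDiff ℝ 1 (expChar (-k)) := (contDiff_expChar (-k)).of_le (by simp)
  have hpp : IsPeriodic fun x => expChar (-k) x * f x := fun x i => by
    simp only [isPeriodic_expChar (-k) x i, hp x i]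
  have h0 := setIntegral_periodCell_fderiv (he.mul hf) hpp i
  have h1 : ∀ x, fderiv ℝ (fun x => expChar (-k) x * f x) x (EuclideanSpace.single i 1) =
      expChar (-k) x * fderiv ℝ f x (EuclideanSpace.single i 1) -
        Complex.I * k i * (expChar (-k) x * f x) := by
    intro x
    have := (hasFDerivAt_expChar (-k) x).mul (hf.differentiable one_ne_zero x).hasFDerivAt
    have e := this.fderiv
    change fderiv ℝ (fun x => expChar (-k) x * f x) x = _ at e
    rw [e]
    simp [expCharDeriv, _root_.sum_apply]
    ring
  have hc1 : Continuous fun x => expChar (-k) x * fderiv ℝ f x (EuclideanSpace.single i 1) :=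
    he.continuous.mul ((hf.continuous_fderiv one_ne_zero).clm_apply continuous_const)
  have hc2 : Continuous fun x => Complex.I * k i * (expChar (-k) x * f x) :=
    continuous_const.mul (he.continuous.mul hf.continuous)
  have h2 : ∫ x in periodCell n, (expChar (-k) x * fderiv ℝ f x (EuclideanSpace.single i 1) -
        Complex.I * k i * (expChar (-k) x * f x)) = 0 := by
    rw [← h0]; exact integral_congr_ae (Eventually.of_forall fun x => (h1 x).symm)
  rw [integral_sub (integrableOn_periodCell hc1) (integrableOn_periodCell hc2), sub_eq_zero,
    integral_const_mul] at h2
  exact h2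

theorem exists_norm_cellCoeff_le {f : EuclideanSpace ℝ (Fin n) → ℂ} (hf : Continuous f) :
    ∃ C, ∀ k, ‖cellCoeff f k‖ ≤ C := by
  obtain ⟨B, hB⟩ := isCompact_toLp_Icc.exists_bound_of_continuousOn (hf.continuousOn (s :=
    WithLp.toLp 2 '' Icc (0 : Fin n → ℝ) (fun _ => 2 * Real.pi)))
  refine ⟨B * volume.real (periodCell n), fun k => ?_⟩
  refine norm_setIntegral_le_of_norm_le_const volume_periodCell_lt_top fun x hx => ?_
  rw [norm_mul, norm_expChar, one_mul]
  exact hB x (periodCell_subset hx)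

theorem exists_pow_mul_norm_cellCoeff_le (i : Fin n) (m : ℕ)
    {f : EuclideanSpace ℝ (Fin n) → ℂ} (hf : ContDiff ℝ ∞ f) (hp : IsPeriodic f) :
    ∃ C, ∀ k, |(k i : ℝ)| ^ m * ‖cellCoeff f k‖ ≤ C := by
  induction m generalizing f with
  | zero => simpa using exists_norm_cellCoeff_le hf.continuous
  | succ m ih =>
    have hf' : ContDiff ℝ ∞ fun x => fderiv ℝ f x (EuclideanSpace.single i 1) :=
      (hf.fderiv_right (by simp)).clm_apply contDiff_const
    obtain ⟨C, hC⟩ := ih hf' (hp.fderiv_apply _)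
    refine ⟨C, fun k => ?_⟩
    have := hC k
    rw [cellCoeff_fderiv (hf.of_le (by simp)) hp, norm_mul, norm_mul, Complex.norm_I, one_mul,
      Complex.norm_intCast] at this
    rw [pow_succ, mul_assoc]
    exact this

theorem norm_le_sum_apply {𝕜 : Type*} [RCLike 𝕜] (v : EuclideanSpace 𝕜 (Fin n)) :
    ‖v‖ ≤ ∑ i, ‖v i‖ := by
  rw [EuclideanSpace.norm_eq, Real.sqrt_le_left (Finset.sum_nonneg fun _ _ => norm_nonneg _)]
  exact Finset.sum_sq_le_sq_sum_of_nonneg fun _ _ => norm_nonneg _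

/-- The Fourier coefficients of a smooth function decrease rapidly, by repeated integration by
parts in the direction of the largest component of `k`. -/
theorem exists_one_add_pow_mul_norm_cellCoeff_le (m : ℕ) {f : EuclideanSpace ℝ (Fin n) → ℂ}
    (hf : ContDiff ℝ ∞ f) (hp : IsPeriodic f) :
    ∃ C, 0 ≤ C ∧ ∀ k, (1 + ‖kvec k‖) ^ m * ‖cellCoeff f k‖ ≤ C := by
  choose D hD using fun i => exists_pow_mul_norm_cellCoeff_le i m hf hp
  obtain ⟨C, hC⟩ := exists_norm_cellCoeff_le hf.continuous
  have hC0 : 0 ≤ C := (norm_nonneg _).trans (hC 0)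
  have hD0 : ∀ i, 0 ≤ D i := fun i => le_trans (by positivity) (hD i 0)
  have hS0 : 0 ≤ ∑ i, D i := Finset.sum_nonneg fun i _ => hD0 i
  refine ⟨C + (2 * n) ^ m * ∑ i, D i, by positivity, fun k => ?_⟩
  by_cases hk : k = 0
  · subst hk
    have := hC 0
    simp only [kvec_zero, norm_zero, add_zero, one_pow, one_mul]
    have : 0 ≤ (2 * n : ℝ) ^ m * ∑ i, D i := by positivity
    linarith
  · have hne : Nonempty (Fin n) := (Function.ne_iff.1 hk).nonempty
    obtain ⟨i, hi⟩ := Finite.exists_max fun i => |(k i : ℝ)|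
    have h1 : ‖kvec k‖ ≤ n * |(k i : ℝ)| := by
      refine (norm_le_sum_apply (kvec k)).trans ?_
      calc ∑ j, ‖kvec k j‖ = ∑ j, |(k j : ℝ)| := by simp [kvec, Complex.norm_intCast]
        _ ≤ ∑ _j : Fin n, |(k i : ℝ)| := Finset.sum_le_sum fun j _ => hi j
        _ = _ := by simp
    have h2 := one_le_norm_kvec hk
    calc (1 + ‖kvec k‖) ^ m * ‖cellCoeff f k‖ ≤ (2 * n * |(k i : ℝ)|) ^ m * ‖cellCoeff f k‖ := by
          gcongr; linarith
      _ = (2 * n) ^ m * (|(k i : ℝ)| ^ m * ‖cellCoeff f k‖) := by rw [mul_pow, mul_assoc]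
      _ ≤ (2 * n) ^ m * ∑ i, D i := by
          gcongr
          exact (hD i k).trans (Finset.single_le_sum (fun j _ => hD0 j) (Finset.mem_univ i))
      _ ≤ _ := le_add_of_nonneg_left hC0

section

/-! ### Fourier inversion -/

theorem IsPeriodic.add_sum_zsmul {F : Type*} {f : EuclideanSpace ℝ (Fin n) → F}
    (hf : IsPeriodic f) (m : Fin n → ℤ) (x : EuclideanSpace ℝ (Fin n)) :
    f (x + ∑ i, m i • EuclideanSpace.single i (2 * Real.pi)) = f x := by
  have h : Function.Periodic f (∑ i, m i • EuclideanSpace.single i (2 * Real.pi)) :=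
    Finset.sum_induction _ (Function.Periodic f) (fun _ _ => Function.Periodic.add_period)
      (fun x => by simp) fun i _ =>
        Function.Periodic.zsmul (fun x => hf x i) (m i)
  exact h x

/-- The covering map `ℝⁿ → (ℝ / ℤ)ⁿ`. -/
def torusCover (n : ℕ) : C(Fin n → ℝ, UnitAddTorus (Fin n)) where
  toFun y i := (y i : UnitAddCircle)
  continuous_toFun := continuous_pi fun i =>
    (AddCircle.continuous_mk' 1).comp (continuous_apply i)

theorem isQuotientMap_torusCover : IsQuotientMap (torusCover n) :=
  (IsOpenQuotientMap.piMap fun _ : Fin n =>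
    (QuotientAddGroup.isOpenQuotientMap_mk :
      IsOpenQuotientMap
        (QuotientAddGroup.mk : ℝ → ℝ ⧸ AddSubgroup.zmultiples (1 : ℝ)))).isQuotientMap

theorem mFourier_torusCover (k : Fin n → ℤ) (y : Fin n → ℝ) :
    UnitAddTorus.mFourier k (torusCover n y) = expChar k (WithLp.toLp 2 ((2 * Real.pi) • y)) := by
  simp only [UnitAddTorus.mFourier, torusCover, ContinuousMap.coe_mk, expChar, fourier_coe_apply,
    ← Complex.exp_sum]
  congr 1
  rw [Finset.mul_sum]
  refine Finset.sum_congr rfl fun i _ => ?_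
  simp
  ring

/-- A continuous periodic function, rescaled and regarded as a function on `(ℝ / ℤ)ⁿ`. -/
theorem IsPeriodic.exists_torusLift {f : EuclideanSpace ℝ (Fin n) → ℂ} (hf : IsPeriodic f)
    (hc : Continuous f) : ∃ G : C(UnitAddTorus (Fin n), ℂ), ∀ y,
      G (torusCover n y) = f (WithLp.toLp 2 ((2 * Real.pi) • y)) := by
  let F : C(Fin n → ℝ, ℂ) := ⟨fun y => f (WithLp.toLp 2 ((2 * Real.pi) • y)), by fun_prop⟩
  have hF : Function.FactorsThrough F (torusCover n) := by
    intro y z hyz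
    have h : ∀ i, ∃ m : ℤ, y i = z i + m := by
      intro i
      have h1 : ((y i - z i : ℝ) : UnitAddCircle) = 0 := by
        rw [AddCircle.coe_sub, sub_eq_zero]; exact congrFun hyz i
      obtain ⟨m, hm⟩ := (AddCircle.coe_eq_zero_iff (1 : ℝ)).1 h1
      refine ⟨m, ?_⟩
      simp at hm
      linarith
    choose m hm using h
    have := hf.add_sum_zsmul m (WithLp.toLp 2 ((2 * Real.pi) • z))
    change f _ = f _
    rw [← this]
    congr 1
    ext j
    simp [hm j, Pi.single_apply]
    ring
  refine ⟨isQuotientMap_torusCover.lift F hF, fun y => ?_⟩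
  exact DFunLike.congr_fun (isQuotientMap_torusCover.lift_comp F hF) y

open scoped Pointwise in
theorem smul_Icc_zero_one : (2 * Real.pi) • Icc (0 : Fin n → ℝ) (fun _ => 1) =
    Icc 0 fun _ => 2 * Real.pi := by
  have hpi : 0 < 2 * Real.pi := by positivity
  ext y
  rw [Set.mem_smul_set_iff_inv_smul_mem₀ hpi.ne']
  simp only [mem_Icc, Pi.le_def, Pi.zero_apply, Pi.smul_apply, smul_eq_mul]
  refine and_congr (forall_congr' fun i => ?_) (forall_congr' fun i => ?_)
  · rw [mul_nonneg_iff_of_pos_left (by positivity)]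
  · rw [inv_mul_le_iff₀ hpi, mul_one]

/-- After rescaling, the Fourier coefficients are those of Mathlib on `(ℝ / ℤ)ⁿ`. -/
theorem mFourierCoeff_torusLift {f : EuclideanSpace ℝ (Fin n) → ℂ} {G : C(UnitAddTorus (Fin n), ℂ)}
    (hG : ∀ y, G (torusCover n y) = f (WithLp.toLp 2 ((2 * Real.pi) • y))) (k : Fin n → ℤ) :
    UnitAddTorus.mFourierCoeff G k = (((2 * Real.pi : ℝ) : ℂ) ^ n)⁻¹ * cellCoeff f k := by
  have hpi : 0 < 2 * Real.pi := by positivity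
  rw [UnitAddTorus.mFourierCoeff_eq_integral _ _ 0, cellCoeff, setIntegral_periodCell]
  have h1 : {x : Fin n → ℝ | ∀ i, x i ∈ Ioc ((0 : Fin n → ℝ) i) ((0 : Fin n → ℝ) i + 1)} =
      univ.pi fun i => Ioc ((0 : Fin n → ℝ) i) 1 := by
    ext x; simp
  have h2 : (univ.pi fun i => Ioc ((0 : Fin n → ℝ) i) 1) =ᵐ[volume]
      Icc (0 : Fin n → ℝ) (fun _ => 1) := Measure.univ_pi_Ioc_ae_eq_Icc
  rw [h1, setIntegral_congr_set h2, ← smul_Icc_zero_one]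
  have h3 := Measure.setIntegral_comp_smul_of_pos (volume : Measure (Fin n → ℝ))
    (fun y => expChar (-k) (WithLp.toLp 2 y) * f (WithLp.toLp 2 y)) (Icc 0 fun _ => 1) hpi
  rw [Module.finrank_fin_fun] at h3
  have h4 : ((((2 * Real.pi : ℝ) : ℂ) ^ n)⁻¹ : ℂ) = (((2 * Real.pi) ^ n)⁻¹ : ℝ) := by push_cast; rfl
  rw [h4, ← Complex.real_smul, ← h3]
  refine integral_congr_ae (Eventually.of_forall fun y => ?_)
  have e1 := mFourier_torusCover (-k) y
  have e2 := hG y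
  change UnitAddTorus.mFourier (-k) (torusCover n y) • G (torusCover n y) = _
  rw [e1, e2, smul_eq_mul]

/-- A smooth periodic function is the sum of its Fourier series. -/
theorem hasSum_cellCoeff {f : EuclideanSpace ℝ (Fin n) → ℂ} (hf : ContDiff ℝ ∞ f)
    (hp : IsPeriodic f) (x : EuclideanSpace ℝ (Fin n)) :
    HasSum (fun k => (((2 * Real.pi : ℝ) : ℂ) ^ n)⁻¹ * cellCoeff f k * expChar k x) (f x) := by
  obtain ⟨G, hG⟩ := hp.exists_torusLift hf.continuous
  have hcoeff : UnitAddTorus.mFourierCoeff G =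
      fun k => (((2 * Real.pi : ℝ) : ℂ) ^ n)⁻¹ * cellCoeff f k :=
    funext (mFourierCoeff_torusLift hG)
  have hsum : Summable (UnitAddTorus.mFourierCoeff G) := by
    rw [hcoeff]
    obtain ⟨C, -, hC⟩ := exists_one_add_pow_mul_norm_cellCoeff_le (0 + 2 * n) hf hp
    refine Summable.mul_left _ (Summable.of_norm_bounded (summable_decayWeight.mul_left C)
      fun k => ?_)
    simpa using mul_norm_le_decayWeight (m := 0) (hC k)
  have hpi : 2 * Real.pi ≠ 0 := by positivity
  have e : (2 * Real.pi) • ((2 * Real.pi)⁻¹ • x.ofLp) = x.ofLp := by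
    rw [smul_smul, mul_inv_cancel₀ hpi, one_smul]
  have := UnitAddTorus.hasSum_mFourier_series_apply_of_summable hsum
    (torusCover n ((2 * Real.pi)⁻¹ • x.ofLp))
  simpa only [hG, mFourier_torusCover, e, hcoeff, smul_eq_mul, WithLp.toLp_ofLp] using this

/-! ### Fourier coefficients of vector fields -/

variable {v : EuclideanSpace ℝ (Fin n) → EuclideanSpace ℝ (Fin n)}

theorem fourierCoefficient_apply (v : EuclideanSpace ℝ (Fin n) → EuclideanSpace ℝ (Fin n))
    (k : Fin n → ℤ) (j : Fin n) : fourierCoefficient v k j =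
      (((2 * Real.pi : ℝ) : ℂ) ^ n)⁻¹ * cellCoeff (fun x => (v x j : ℂ)) k := by
  simp [fourierCoefficient, cellCoeff, expChar]

theorem ContDiff.ofReal_apply (hv : ContDiff ℝ ∞ v) (j : Fin n) :
    ContDiff ℝ ∞ fun x => (v x j : ℂ) :=
  Complex.ofRealCLM.contDiff.comp
    ((EuclideanSpace.proj j : EuclideanSpace ℝ (Fin n) →L[ℝ] ℝ).contDiff.comp hv)

theorem IsPeriodic.ofReal_apply (hp : IsPeriodic v) (j : Fin n) :
    IsPeriodic fun x => (v x j : ℂ) := fun x i => by simp only [hp x i]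

theorem isRealFamily_fourierCoefficient (v : EuclideanSpace ℝ (Fin n) → EuclideanSpace ℝ (Fin n)) :
    IsRealFamily (fourierCoefficient v) := by
  intro k
  ext j
  rw [conjVec_apply, fourierCoefficient_apply, fourierCoefficient_apply, map_mul, cellCoeff,
    cellCoeff, ← integral_conj]
  simp [conj_expChar, map_ofNat]

theorem isDivFreeFamily_fourierCoefficient (hv : ContDiff ℝ ∞ v) (hp : IsPeriodic v)
    (hd : ∀ x, divergence v x = 0) : IsDivFreeFamily (fourierCoefficient v) := by
  intro k
  have h1 : ∀ i, Complex.I * k i * cellCoeff (fun x => (v x i : ℂ)) k =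
      ∫ x in periodCell n, expChar (-k) x * (fderiv ℝ v x (EuclideanSpace.single i 1) i : ℂ) := by
    intro i
    rw [← cellCoeff_fderiv ((ContDiff.ofReal_apply hv i).of_le (by simp)) (hp.ofReal_apply i),
      cellCoeff]
    refine integral_congr_ae (Eventually.of_forall fun x => ?_)
    have := (Complex.ofRealCLM.comp
      (EuclideanSpace.proj i : EuclideanSpace ℝ (Fin n) →L[ℝ] ℝ)).hasFDerivAt.comp x
        (hv.differentiable (by simp) x).hasFDerivAt
    have e : fderiv ℝ (fun x => (v x i : ℂ)) x = _ := this.fderiv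
    simp only [e]
    rfl
  have hc : ∀ i, Continuous fun x =>
      expChar (-k) x * (fderiv ℝ v x (EuclideanSpace.single i 1) i : ℂ) := fun i =>
    (contDiff_expChar (-k)).continuous.mul (Complex.continuous_ofReal.comp
      ((EuclideanSpace.proj i : EuclideanSpace ℝ (Fin n) →L[ℝ] ℝ).continuous.comp
        ((hv.continuous_fderiv (by simp)).clm_apply continuous_const)))
  have h2 : ∑ i, Complex.I * k i * cellCoeff (fun x => (v x i : ℂ)) k = 0 := by
    simp only [h1]
    rw [← integral_finsetSum _ fun i _ => integrableOn_periodCell (hc i)]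
    refine integral_eq_zero_of_ae (Eventually.of_forall fun x => ?_)
    have := hd x
    rw [divergence] at this
    simp only [← Finset.mul_sum, ← Complex.ofReal_sum, this, Complex.ofReal_zero, mul_zero,
      Pi.zero_apply]
  simp only [mul_assoc, ← Finset.mul_sum] at h2
  have h3 := (mul_eq_zero.1 h2).resolve_left Complex.I_ne_zero
  rw [inner_kvec]
  simp only [fourierCoefficient_apply]
  rw [← mul_zero (((2 * Real.pi : ℝ) : ℂ) ^ n)⁻¹, ← h3, Finset.mul_sum]
  exact Finset.sum_congr rfl fun i _ => mul_left_comm _ _ _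

theorem exists_one_add_pow_mul_norm_fourierCoefficient_le (hv : ContDiff ℝ ∞ v)
    (hp : IsPeriodic v) (m : ℕ) :
    ∃ C : ℝ, ∀ k, (1 + ‖kvec k‖) ^ m * ‖fourierCoefficient v k‖ ≤ C := by
  choose C hC0 hC using fun j => exists_one_add_pow_mul_norm_cellCoeff_le m
    (ContDiff.ofReal_apply hv j) (hp.ofReal_apply j)
  refine ⟨‖(((2 * Real.pi : ℝ) : ℂ) ^ n)⁻¹‖ * ∑ j, C j, fun k => ?_⟩
  calc _ ≤ (1 + ‖kvec k‖) ^ m * ∑ j, ‖fourierCoefficient v k j‖ := by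
        gcongr; exact norm_le_sum_apply _
    _ = ‖(((2 * Real.pi : ℝ) : ℂ) ^ n)⁻¹‖ *
        ∑ j, (1 + ‖kvec k‖) ^ m * ‖cellCoeff (fun x => (v x j : ℂ)) k‖ := by
      simp only [fourierCoefficient_apply, norm_mul, ← Finset.mul_sum]
      ring
    _ ≤ _ := by gcongr with j _; exact hC j k

theorem normA0_ne_top (hv : ContDiff ℝ ∞ v) (hp : IsPeriodic v) : normA0 v ≠ ⊤ := by
  obtain ⟨C, hC⟩ := exists_one_add_pow_mul_norm_fourierCoefficient_le hv hp (0 + 2 * n)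
  have : Summable fun k => ‖fourierCoefficient v k‖ :=
    Summable.of_nonneg_of_le (fun _ => norm_nonneg _)
      (fun k => by simpa using mul_norm_le_decayWeight (m := 0) (hC k))
      (summable_decayWeight.mul_left C)
  have h2 := (this.subtype {k | k ≠ 0}).tsum_ofReal_ne_top
  simp only [normA0, ← ofReal_norm]
  exact h2

theorem wsum_zero_le_normA0 (hv : ContDiff ℝ ∞ v) (hp : IsPeriodic v) (K : Finset (Fin n → ℤ)) :
    wsum 0 K (fourierCoefficient v) ≤ (normA0 v).toReal := by
  rw [← ENNReal.ofReal_le_iff_le_toReal (normA0_ne_top hv hp), wsum,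
    ENNReal.ofReal_sum_of_nonneg (fun _ _ => by positivity)]
  simp only [pow_zero, one_mul, ofReal_norm]
  rw [← Finset.sum_subtype_of_mem (fun k => ‖fourierCoefficient v k‖ₑ) (p := fun k => k ≠ 0)
    fun k hk => (Finset.mem_erase.1 hk).1]
  exact ENNReal.sum_le_tsum _

/-- A solution exists at least up to the time `2 ν / ‖u₀‖²`, and up to any time if `‖u₀‖ ≤ ν`. -/
theorem exists_isSmoothSolution {ν T : ℝ} (hν : 0 < ν) (hT : 0 < T) (hv : ContDiff ℝ ∞ v)
    (hp : IsPeriodic v) (hd : ∀ x, divergence v x = 0)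
    (h : normA0 v ≤ ENNReal.ofReal ν ∨ T * (normA0 v).toReal ^ 2 < 2 * ν) :
    ∃ u, IsSmoothSolution ν v (ENNReal.ofReal T) u := by
  have h' : (normA0 v).toReal ≤ ν ∨ T * (normA0 v).toReal ^ 2 < 2 * ν :=
    h.imp_left (ENNReal.toReal_le_of_le_ofReal hν.le)
  obtain ⟨a, h0, hr, hreal, hdiv, hode⟩ := exists_fourier_solution hν hT.le ENNReal.toReal_nonneg h'
    (isRealFamily_fourierCoefficient v) (isDivFreeFamily_fourierCoefficient hv hp hd)
    (exists_one_add_pow_mul_norm_fourierCoefficient_le hv hp) (wsum_zero_le_normA0 hv hp)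
  refine ⟨_, isSmoothSolution_of_fourier hT hr hreal hdiv hode fun x j => ?_⟩
  have := (hasSum_cellCoeff (ContDiff.ofReal_apply hv j) (hp.ofReal_apply j) x).tsum_eq
  simp only [realSeries, fourierSeries, component, h0, fourierCoefficient_apply]
  rw [this, Complex.ofReal_re]

end

section

/-! ### The energy inequality for the difference of two flows -/

theorem map_eq_sum_single {E : Type*} [NormedAddCommGroup E] [NormedSpace ℝ E]
    (L : EuclideanSpace ℝ (Fin n) →L[ℝ] E) (v : EuclideanSpace ℝ (Fin n)) :
    L v = ∑ i, v i • L (EuclideanSpace.single i 1) := by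
  conv_lhs => rw [← (EuclideanSpace.basisFun (Fin n) ℝ).sum_repr v]
  simp

theorem laplacian_eq_sum {E : Type*} [NormedAddCommGroup E] [NormedSpace ℝ E]
    {f : EuclideanSpace ℝ (Fin n) → E} (hf : ContDiff ℝ 2 f) (x : EuclideanSpace ℝ (Fin n)) :
    Laplacian.laplacian f x = ∑ i, fderiv ℝ (fun y => fderiv ℝ f y (EuclideanSpace.single i 1)) x
      (EuclideanSpace.single i 1) := by
  rw [InnerProductSpace.laplacian_eq_iteratedFDeriv_orthonormalBasis _
    (EuclideanSpace.basisFun (Fin n) ℝ)]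
  refine Finset.sum_congr rfl fun i _ => ?_
  have h : DifferentiableAt ℝ (fderiv ℝ f) x :=
    (hf.fderiv_right (m := 1) (by norm_num)).differentiable one_ne_zero x
  rw [iteratedFDeriv_two_apply, fderiv_clm_apply h (by fun_prop)]
  simp

variable {d w u : EuclideanSpace ℝ (Fin n) → EuclideanSpace ℝ (Fin n)}
  {q : EuclideanSpace ℝ (Fin n) → ℝ}

open scoped InnerProductSpace

/-- The viscosity dissipates energy: `∑ᵢ ∂ᵢ ⟪d, ∂ᵢ d⟫ = ⟪d, Δd⟫ + ∑ᵢ ‖∂ᵢ d‖²` has integral zero. -/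
theorem setIntegral_inner_laplacian_nonpos (hd : ContDiff ℝ ∞ d) (hp : IsPeriodic d) :
    ∫ x in periodCell n, ⟪d x, Laplacian.laplacian d x⟫_ℝ ≤ 0 := by
  have hd' : ∀ i, ContDiff ℝ ∞ fun x => fderiv ℝ d x (EuclideanSpace.single i 1) := fun i =>
    (hd.fderiv_right (by simp)).clm_apply contDiff_const
  have h0 := setIntegral_periodCell_divergence
    (F := fun i x => ⟪d x, fderiv ℝ d x (EuclideanSpace.single i 1)⟫_ℝ)
    (fun i => (hd.inner ℝ (hd' i)).of_le (by simp))
    (fun i x j => by simp only [hp x j, hp.fderiv_apply _ x j])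
  have e : ∀ x, ∑ i, fderiv ℝ (fun x => ⟪d x, fderiv ℝ d x (EuclideanSpace.single i 1)⟫_ℝ) x
      (EuclideanSpace.single i 1) = ⟪d x, Laplacian.laplacian d x⟫_ℝ +
        ∑ i, ‖fderiv ℝ d x (EuclideanSpace.single i 1)‖ ^ 2 := by
    intro x
    rw [laplacian_eq_sum (contDiff_infty.1 hd 2), inner_sum, ← Finset.sum_add_distrib]
    refine Finset.sum_congr rfl fun i _ => ?_
    rw [fderiv_inner_apply ℝ (hd.differentiable (by simp) x) ((hd' i).differentiable (by simp) x),
      real_inner_self_eq_norm_sq]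
  have hc : Continuous fun x => ∑ i, ‖fderiv ℝ d x (EuclideanSpace.single i 1)‖ ^ 2 :=
    continuous_finsetSum _ fun i _ => ((hd' i).continuous.norm.pow 2)
  have hl : Continuous fun x => ⟪d x, Laplacian.laplacian d x⟫_ℝ := by
    have : Continuous fun x => Laplacian.laplacian d x := by
      simp only [laplacian_eq_sum (contDiff_infty.1 hd 2)]
      exact continuous_finsetSum _ fun i _ =>
        ((hd' i).continuous_fderiv (by simp)).clm_apply continuous_const
    exact hd.continuous.inner this
  simp only [e] at h0
  rw [integral_add (integrableOn_periodCell hl) (integrableOn_periodCell hc)] at h0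
  have : 0 ≤ ∫ x in periodCell n, ∑ i, ‖fderiv ℝ d x (EuclideanSpace.single i 1)‖ ^ 2 :=
    integral_nonneg fun x => Finset.sum_nonneg fun i _ => by positivity
  linarith

/-- Transport by a divergence free field preserves the energy:
`∑ᵢ ∂ᵢ (wᵢ ‖d‖²) = 2 ⟪d, (w · ∇) d⟫` has integral zero. -/
theorem setIntegral_inner_transport (hd : ContDiff ℝ ∞ d) (hp : IsPeriodic d)
    (hw : ContDiff ℝ ∞ w) (hpw : IsPeriodic w) (hdiv : ∀ x, divergence w x = 0) :
    ∫ x in periodCell n, ⟪d x, fderiv ℝ d x (w x)⟫_ℝ = 0 := by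
  have hw' : ∀ i, ContDiff ℝ ∞ fun x => w x i := fun i => contDiff_euclidean.1 hw i
  have h0 := setIntegral_periodCell_divergence (F := fun i x => w x i * ⟪d x, d x⟫_ℝ)
    (fun i => ((hw' i).mul (hd.inner ℝ hd)).of_le (by simp))
    (fun i x j => by simp only [hp x j, hpw x j])
  have e : ∀ x, ∑ i, fderiv ℝ (fun x => w x i * ⟪d x, d x⟫_ℝ) x (EuclideanSpace.single i 1) =
      2 * ⟪d x, fderiv ℝ d x (w x)⟫_ℝ := by
    intro x
    have hdx := hd.differentiable (by simp) x
    have hwi : ∀ i v, fderiv ℝ (fun x => w x i) x v = fderiv ℝ w x v i := fun i v => by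
      have := ((EuclideanSpace.proj i : EuclideanSpace ℝ (Fin n) →L[ℝ] ℝ).hasFDerivAt.comp x
        (hw.differentiable (by simp) x).hasFDerivAt)
      have e : fderiv ℝ (fun x => w x i) x = _ := this.fderiv
      rw [e]; rfl
    have : ∀ i, fderiv ℝ (fun x => w x i * ⟪d x, d x⟫_ℝ) x (EuclideanSpace.single i 1) =
        2 * (w x i * ⟪d x, fderiv ℝ d x (EuclideanSpace.single i 1)⟫_ℝ) +
          ⟪d x, d x⟫_ℝ * fderiv ℝ w x (EuclideanSpace.single i 1) i := by
      intro i
      rw [fderiv_fun_mul ((hw' i).differentiable (by simp) x) (hdx.inner ℝ hdx)]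
      simp only [_root_.add_apply, _root_.smul_apply, smul_eq_mul,
        fderiv_inner_apply ℝ hdx hdx, hwi, real_inner_comm (d x)]
      ring
    have hdivx := hdiv x
    rw [divergence] at hdivx
    simp only [this, Finset.sum_add_distrib, ← Finset.mul_sum, hdivx, mul_zero, add_zero]
    rw [map_eq_sum_single (fderiv ℝ d x), inner_sum]
    simp only [inner_smul_right]
  simp only [e] at h0
  rw [integral_const_mul] at h0
  simpa using h0

/-- Gradients are orthogonal to divergence free fields: `∑ᵢ ∂ᵢ (q dᵢ) = ⟪d, ∇q⟫` has integral
zero. -/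
theorem setIntegral_inner_gradient (hd : ContDiff ℝ ∞ d) (hp : IsPeriodic d)
    (hq : ContDiff ℝ ∞ q) (hpq : IsPeriodic q) (hdiv : ∀ x, divergence d x = 0) :
    ∫ x in periodCell n, ⟪d x, gradient q x⟫_ℝ = 0 := by
  have hd' : ∀ i, ContDiff ℝ ∞ fun x => d x i := fun i => contDiff_euclidean.1 hd i
  have h0 := setIntegral_periodCell_divergence (F := fun i x => q x * d x i)
    (fun i => (hq.mul (hd' i)).of_le (by simp))
    (fun i x j => by simp only [hp x j, hpq x j])
  rw [← h0]
  congr 1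
  funext x
  have hdi : ∀ i v, fderiv ℝ (fun x => d x i) x v = fderiv ℝ d x v i := fun i v => by
    have := ((EuclideanSpace.proj i : EuclideanSpace ℝ (Fin n) →L[ℝ] ℝ).hasFDerivAt.comp x
      (hd.differentiable (by simp) x).hasFDerivAt)
    have e : fderiv ℝ (fun x => d x i) x = _ := this.fderiv
    rw [e]; rfl
  have : ∀ i, fderiv ℝ (fun x => q x * d x i) x (EuclideanSpace.single i 1) =
      q x * fderiv ℝ d x (EuclideanSpace.single i 1) i +
        d x i * fderiv ℝ q x (EuclideanSpace.single i 1) := by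
    intro i
    rw [fderiv_fun_mul (hq.differentiable (by simp) x) ((hd' i).differentiable (by simp) x)]
    simp [hdi]
  have hdivx := hdiv x
  rw [divergence] at hdivx
  simp only [this, Finset.sum_add_distrib, ← Finset.mul_sum, hdivx, mul_zero, zero_add]
  rw [real_inner_comm, gradient, InnerProductSpace.toDual_symm_apply, map_eq_sum_single]
  rfl

theorem gradient_sub {p q : EuclideanSpace ℝ (Fin n) → ℝ} {x : EuclideanSpace ℝ (Fin n)}
    (hp : DifferentiableAt ℝ p x) (hq : DifferentiableAt ℝ q x) :
    gradient (fun y => p y - q y) x = gradient p x - gradient q x := by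
  rw [gradient, fderiv_fun_sub hp hq, map_sub]
  rfl

/-- In the energy balance of the difference of two flows `w` and `u` the viscosity has a sign and
the transport by `w` and the pressures drop out; only the stretching by `∇u` remains. -/
theorem setIntegral_inner_sub_le {ν M : ℝ} (hν : 0 ≤ ν) {p : EuclideanSpace ℝ (Fin n) → ℝ}
    (hw : ContDiff ℝ ∞ w) (hpw : IsPeriodic w) (hdw : ∀ x, divergence w x = 0)
    (hu : ContDiff ℝ ∞ u) (hpu : IsPeriodic u) (hdu : ∀ x, divergence u x = 0)
    (hp : ContDiff ℝ ∞ p) (hpp : IsPeriodic p) (hq : ContDiff ℝ ∞ q) (hpq : IsPeriodic q)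
    (hM : ∀ x ∈ periodCell n, ‖fderiv ℝ u x‖ ≤ M) :
    ∫ x in periodCell n, ⟪w x - u x,
        (ν • Laplacian.laplacian w x - fderiv ℝ w x (w x) - gradient p x) -
          (ν • Laplacian.laplacian u x - fderiv ℝ u x (u x) - gradient q x)⟫_ℝ ≤
      M * ∫ x in periodCell n, ‖w x - u x‖ ^ 2 := by
  set d : EuclideanSpace ℝ (Fin n) → EuclideanSpace ℝ (Fin n) := fun x => w x - u x with hd
  have hwd := hw.differentiable (by simp)
  have hud := hu.differentiable (by simp)
  have hds : ContDiff ℝ ∞ d := hw.sub hu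
  have hpd : IsPeriodic d := fun x i => by simp only [hd, hpw x i, hpu x i]
  have hdf : ∀ x, fderiv ℝ d x = fderiv ℝ w x - fderiv ℝ u x := fun x =>
    fderiv_fun_sub (hwd x) (hud x)
  have hdd : ∀ x, divergence d x = 0 := fun x => by
    have h1 := hdw x
    have h2 := hdu x
    rw [divergence] at h1 h2 ⊢
    simp only [hdf, _root_.sub_apply, PiLp.sub_apply, Finset.sum_sub_distrib, h1, h2, sub_zero]
  have hsp : ContDiff ℝ ∞ fun x => p x - q x := hp.sub hq
  have h1 := setIntegral_inner_laplacian_nonpos hds hpd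
  have h2 := setIntegral_inner_transport hds hpd hw hpw hdw
  have h3 := setIntegral_inner_gradient (q := fun x => p x - q x) hds hpd hsp
    (fun x i => by simp only [hpp x i, hpq x i]) hdd
  have hcl : Continuous fun x => Laplacian.laplacian d x := by
    simp only [laplacian_eq_sum (contDiff_infty.1 hds 2)]
    exact continuous_finsetSum _ fun i _ => (((hds.fderiv_right (m := ∞) (by simp)).clm_apply
      contDiff_const).continuous_fderiv (by simp)).clm_apply continuous_const
  have i1 : IntegrableOn (fun x => ⟪d x, Laplacian.laplacian d x⟫_ℝ) (periodCell n) :=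
    integrableOn_periodCell (hds.continuous.inner hcl)
  have i2 : IntegrableOn (fun x => ⟪d x, fderiv ℝ d x (w x)⟫_ℝ) (periodCell n) :=
    integrableOn_periodCell (hds.continuous.inner
    ((hds.continuous_fderiv (by simp)).clm_apply hw.continuous))
  have i3 : IntegrableOn (fun x => ⟪d x, gradient (fun x => p x - q x) x⟫_ℝ) (periodCell n) :=
    integrableOn_periodCell (hds.continuous.inner
      ((InnerProductSpace.toDual ℝ _).symm.continuous.comp (hsp.continuous_fderiv (by simp))))
  have i4 : IntegrableOn (fun x => ⟪d x, fderiv ℝ u x (d x)⟫_ℝ) (periodCell n) :=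
    integrableOn_periodCell (hds.continuous.inner
    ((hu.continuous_fderiv (by simp)).clm_apply hds.continuous))
  have h4 : -∫ x in periodCell n, ⟪d x, fderiv ℝ u x (d x)⟫_ℝ ≤
      M * ∫ x in periodCell n, ‖d x‖ ^ 2 := by
    rw [← integral_neg, ← integral_const_mul]
    refine setIntegral_mono_on i4.neg
      ((integrableOn_periodCell (hds.continuous.norm.pow 2)).const_mul M) measurableSet_periodCell
      fun x hx => ?_
    calc -⟪d x, fderiv ℝ u x (d x)⟫_ℝ ≤ ‖d x‖ * ‖fderiv ℝ u x (d x)‖ :=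
          (neg_le_abs _).trans (abs_real_inner_le_norm _ _)
      _ ≤ ‖d x‖ * (M * ‖d x‖) := by
          gcongr
          exact (ContinuousLinearMap.le_opNorm _ _).trans (by gcongr; exact hM x hx)
      _ = M * ‖d x‖ ^ 2 := by ring
  have e : ∀ x, ⟪d x, (ν • Laplacian.laplacian w x - fderiv ℝ w x (w x) - gradient p x) -
      (ν • Laplacian.laplacian u x - fderiv ℝ u x (u x) - gradient q x)⟫_ℝ =
      ν * ⟪d x, Laplacian.laplacian d x⟫_ℝ - ⟪d x, fderiv ℝ d x (w x)⟫_ℝ -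
        ⟪d x, gradient (fun x => p x - q x) x⟫_ℝ - ⟪d x, fderiv ℝ u x (d x)⟫_ℝ := by
    intro x
    have hl : Laplacian.laplacian d x = Laplacian.laplacian w x - Laplacian.laplacian u x :=
      ((contDiff_infty.1 hw 2).contDiffAt).laplacian_sub ((contDiff_infty.1 hu 2).contDiffAt)
    rw [gradient_sub (hp.differentiable (by simp) x) (hq.differentiable (by simp) x), hl, hdf,
      ← inner_smul_right, ← inner_sub_right, ← inner_sub_right, ← inner_sub_right]
    congr 1
    simp only [_root_.sub_apply, hd, map_sub, smul_sub]
    abel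
  rw [show (∫ x in periodCell n, ⟪w x - u x, _⟫_ℝ) = _ from
    integral_congr_ae (Eventually.of_forall e)]
  have i12 : IntegrableOn (fun x => ν * ⟪d x, Laplacian.laplacian d x⟫_ℝ -
      ⟪d x, fderiv ℝ d x (w x)⟫_ℝ) (periodCell n) := (i1.const_mul ν).sub i2
  have i123 : IntegrableOn (fun x => ν * ⟪d x, Laplacian.laplacian d x⟫_ℝ -
      ⟪d x, fderiv ℝ d x (w x)⟫_ℝ - ⟪d x, gradient (fun x => p x - q x) x⟫_ℝ) (periodCell n) :=
    i12.sub i3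
  rw [integral_sub i123 i4, integral_sub i12 i3, integral_sub (i1.const_mul ν) i2,
    integral_const_mul, h2, h3]
  have := mul_nonpos_of_nonneg_of_nonpos hν h1
  linarith

end

section

/-! ### Solutions on a set of times -/

/-- `u` and the pressure `p` solve the Navier–Stokes equation at the times in `I`, and are smooth on
`I × ℝⁿ`; no initial value is prescribed. -/
structure IsSolutionOn (ν : ℝ) (I : Set ℝ)
    (u : ℝ → EuclideanSpace ℝ (Fin n) → EuclideanSpace ℝ (Fin n))
    (p : ℝ → EuclideanSpace ℝ (Fin n) → ℝ) : Prop where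
  smooth : ContDiffOn ℝ ∞ (fun z : ℝ × EuclideanSpace ℝ (Fin n) => u z.1 z.2) (I ×ˢ univ)
  periodic : ∀ t ∈ I, IsPeriodic (u t)
  div_free : ∀ t ∈ I, ∀ x, divergence (u t) x = 0
  smooth_pressure :
    ContDiffOn ℝ ∞ (fun z : ℝ × EuclideanSpace ℝ (Fin n) => p z.1 z.2) (I ×ˢ univ)
  periodic_pressure : ∀ t ∈ I, IsPeriodic (p t)
  momentum : ∀ t ∈ I, ∀ x, HasDerivWithinAt (fun s => u s x)
    (ν • Laplacian.laplacian (u t) x - fderiv ℝ (u t) x (u t x) - gradient (p t) x) I t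

variable {ν : ℝ} {I J : Set ℝ} {u w : ℝ → EuclideanSpace ℝ (Fin n) → EuclideanSpace ℝ (Fin n)}
  {p q : ℝ → EuclideanSpace ℝ (Fin n) → ℝ}
  {u₀ : EuclideanSpace ℝ (Fin n) → EuclideanSpace ℝ (Fin n)}

theorem IsSmoothSolution.exists_isSolutionOn {S : ℝ≥0∞} (h : IsSmoothSolution ν u₀ S u) :
    ∃ p, IsSolutionOn ν (timeInterval S) u p := by
  obtain ⟨p, h1, h2, h3⟩ := h.momentum
  exact ⟨p, h.smooth, h.periodic, h.div_free, h1, h2, h3⟩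

theorem IsSolutionOn.isSmoothSolution {S : ℝ≥0∞} (h : IsSolutionOn ν (timeInterval S) u p)
    (h0 : ∀ x, u 0 x = u₀ x) : IsSmoothSolution ν u₀ S u :=
  ⟨h.smooth, h.periodic, h.div_free, h0, p, h.smooth_pressure, h.periodic_pressure, h.momentum⟩

theorem contDiff_slice {E : Type*} [NormedAddCommGroup E] [NormedSpace ℝ E]
    {f : ℝ → EuclideanSpace ℝ (Fin n) → E}
    (hf : ContDiffOn ℝ ∞ (fun z : ℝ × EuclideanSpace ℝ (Fin n) => f z.1 z.2) (I ×ˢ univ)) {t : ℝ}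
    (ht : t ∈ I) : ContDiff ℝ ∞ (f t) := by
  rw [← contDiffOn_univ]
  exact hf.comp (f := fun x : EuclideanSpace ℝ (Fin n) => (t, x))
    (contDiff_prodMk_right t).contDiffOn fun x _ => ⟨ht, mem_univ x⟩

/-- The space derivative, in terms of the space-time derivative; so it is jointly continuous. -/
theorem fderiv_slice {E : Type*} [NormedAddCommGroup E] [NormedSpace ℝ E]
    {f : ℝ → EuclideanSpace ℝ (Fin n) → E}
    (hf : ContDiffOn ℝ ∞ (fun z : ℝ × EuclideanSpace ℝ (Fin n) => f z.1 z.2) (I ×ˢ univ)) {t : ℝ}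
    (ht : t ∈ I) (x : EuclideanSpace ℝ (Fin n)) : fderiv ℝ (f t) x =
      (fderivWithin ℝ (fun z : ℝ × EuclideanSpace ℝ (Fin n) => f z.1 z.2) (I ×ˢ univ) (t, x)).comp
        (ContinuousLinearMap.inr ℝ ℝ (EuclideanSpace ℝ (Fin n))) := by
  have h1 := (hf.differentiableOn (by simp) (t, x) ⟨ht, mem_univ x⟩).hasFDerivWithinAt
  have h2 := h1.comp (s := univ) (f := fun x : EuclideanSpace ℝ (Fin n) => (t, x)) x
    (hasFDerivAt_prodMk_right t x).hasFDerivWithinAt fun y _ => ⟨ht, mem_univ y⟩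
  exact (hasFDerivWithinAt_univ.1 h2).fderiv

theorem hasDerivWithinAt_slice {E : Type*} [NormedAddCommGroup E] [NormedSpace ℝ E]
    {f : ℝ → EuclideanSpace ℝ (Fin n) → E}
    (hf : ContDiffOn ℝ ∞ (fun z : ℝ × EuclideanSpace ℝ (Fin n) => f z.1 z.2) (I ×ˢ univ)) {t : ℝ}
    (ht : t ∈ I) (x : EuclideanSpace ℝ (Fin n)) : HasDerivWithinAt (fun s => f s x)
      (fderivWithin ℝ (fun z : ℝ × EuclideanSpace ℝ (Fin n) => f z.1 z.2) (I ×ˢ univ) (t, x) (1, 0))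
      I t := by
  have h1 := (hf.differentiableOn (by simp) (t, x) ⟨ht, mem_univ x⟩).hasFDerivWithinAt
  have h2 := h1.comp (s := I) (f := fun s : ℝ => (s, x)) t
    (hasFDerivAt_prodMk_left t x).hasFDerivWithinAt fun y hy => ⟨hy, mem_univ x⟩
  exact h2.hasDerivWithinAt

/-! ### Uniqueness -/

theorem eq_zero_of_setIntegral_norm_sq_eq_zero
    {d : EuclideanSpace ℝ (Fin n) → EuclideanSpace ℝ (Fin n)}
    (hd : Continuous d) (hp : IsPeriodic d) (h : ∫ x in periodCell n, ‖d x‖ ^ 2 ≤ 0)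
    (x : EuclideanSpace ℝ (Fin n)) : d x = 0 := by
  have hpi : 0 < 2 * Real.pi := by positivity
  have h0 : ∫ y in Icc (0 : Fin n → ℝ) (fun _ => 2 * Real.pi), ‖d (WithLp.toLp 2 y)‖ ^ 2 = 0 := by
    rw [← setIntegral_periodCell (fun x => ‖d x‖ ^ 2)]
    exact le_antisymm h (integral_nonneg fun _ => by positivity)
  have hc : Continuous fun y : Fin n → ℝ => ‖d (WithLp.toLp 2 y)‖ ^ 2 := by fun_prop
  rw [integral_eq_zero_iff_of_nonneg (fun _ => by positivity) hc.integrableOn_Icc] at h0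
  have hcl : Icc (0 : Fin n → ℝ) (fun _ => 2 * Real.pi) ⊆
      closure (interior (Icc (0 : Fin n → ℝ) fun _ => 2 * Real.pi)) := by
    rw [← pi_univ_Icc, interior_pi_set finite_univ, closure_pi_set]
    simp [interior_Icc, closure_Ioo hpi.ne]
  have h1 := Measure.eqOn_of_ae_eq h0 hc.continuousOn continuousOn_const hcl
  -- Move the point into the period cell.
  rw [← hp.add_sum_zsmul (fun i => -⌊x i / (2 * Real.pi)⌋) x]
  set y := x + ∑ i, (-⌊x i / (2 * Real.pi)⌋) • EuclideanSpace.single i (2 * Real.pi)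
  have hy : ∀ i, y i = x i - ⌊x i / (2 * Real.pi)⌋ * (2 * Real.pi) := fun i => by
    simp [y, Pi.single_apply]
    ring
  have := h1 (x := y.ofLp) ⟨fun i => by
    rw [hy]; exact Int.sub_floor_div_mul_nonneg _ hpi, fun i => by
    rw [hy]; exact (Int.sub_floor_div_mul_lt _ hpi).le⟩
  simpa using this

open scoped InnerProductSpace

/-- Smooth solutions are determined by their initial values: the energy `E(t) = ∫ ‖w - u‖²` of the
difference satisfies `E' ≤ 2 M E`, where `M` bounds `‖∇u‖` on the compact set `[0, τ] × 𝕋ⁿ`. -/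
theorem IsSolutionOn.eq_of_initial_eq (hν : 0 ≤ ν) {τ : ℝ} (hτ : 0 < τ)
    (hw : IsSolutionOn ν (Icc 0 τ) w p) (hu : IsSolutionOn ν (Icc 0 τ) u q)
    (h0 : ∀ x, w 0 x = u 0 x) {t : ℝ} (ht : t ∈ Icc 0 τ) (x : EuclideanSpace ℝ (Fin n)) :
    w t x = u t x := by
  set I : Set ℝ := Icc 0 τ with hI
  set Ω : Set (ℝ × EuclideanSpace ℝ (Fin n)) := I ×ˢ univ with hΩ
  have hIu : UniqueDiffOn ℝ I := uniqueDiffOn_Icc hτ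
  have hΩu : UniqueDiffOn ℝ Ω := hIu.prod uniqueDiffOn_univ
  set K : Set (EuclideanSpace ℝ (Fin n)) :=
    WithLp.toLp 2 '' Icc (0 : Fin n → ℝ) (fun _ => 2 * Real.pi) with hK
  have hcK : IsCompact (I ×ˢ K) := isCompact_Icc.prod isCompact_toLp_Icc
  have hKΩ : I ×ˢ K ⊆ Ω := prod_mono_right (subset_univ _)
  let d : ℝ → EuclideanSpace ℝ (Fin n) → EuclideanSpace ℝ (Fin n) := fun t x => w t x - u t x
  have hd : ContDiffOn ℝ ∞ (fun z : ℝ × EuclideanSpace ℝ (Fin n) => d z.1 z.2) Ω :=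
    hw.smooth.sub hu.smooth
  let d' : ℝ → EuclideanSpace ℝ (Fin n) → EuclideanSpace ℝ (Fin n) := fun t x =>
    fderivWithin ℝ (fun z : ℝ × EuclideanSpace ℝ (Fin n) => d z.1 z.2) Ω (t, x) (1, 0)
  have hd' : ContinuousOn (fun z : ℝ × EuclideanSpace ℝ (Fin n) => d' z.1 z.2) Ω :=
    (hd.continuousOn_fderivWithin hΩu (by simp)).clm_apply continuousOn_const
  have hdt : ∀ t ∈ I, ∀ x, HasDerivWithinAt (fun s => d s x) (d' t x) I t := fun t ht x =>
    hasDerivWithinAt_slice hd ht x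
  have hdc : ∀ t ∈ I, Continuous (d t) := fun t ht => (contDiff_slice hd ht).continuous
  have hdc' : ∀ t ∈ I, Continuous (d' t) := fun t ht => by
    rw [← continuousOn_univ]
    exact hd'.comp (f := fun x : EuclideanSpace ℝ (Fin n) => (t, x)) (by fun_prop)
      fun x _ => ⟨ht, mem_univ x⟩
  obtain ⟨B, hB⟩ := hcK.exists_bound_of_continuousOn (hd.continuousOn.mono hKΩ)
  obtain ⟨B', hB'⟩ := hcK.exists_bound_of_continuousOn (hd'.mono hKΩ)
  obtain ⟨M, hM⟩ := hcK.exists_bound_of_continuousOn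
    (((hu.smooth.continuousOn_fderivWithin hΩu (by simp)).clm_comp (continuousOn_const
      (c := ContinuousLinearMap.inr ℝ ℝ (EuclideanSpace ℝ (Fin n))))).mono hKΩ)
  have hM' : ∀ t ∈ I, ∀ x ∈ periodCell n, ‖fderiv ℝ (u t) x‖ ≤ M := fun t ht x hx => by
    rw [fderiv_slice hu.smooth ht]
    exact hM (t, x) ⟨ht, periodCell_subset hx⟩
  let E : ℝ → ℝ := fun t => ∫ x in periodCell n, ‖d t x‖ ^ 2
  have hEcont : ContinuousOn E I := by
    refine continuousOn_of_dominated (bound := fun _ => B ^ 2)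
      (fun t ht => ((hdc t ht).norm.pow 2).aestronglyMeasurable)
      (fun t ht => (ae_restrict_iff' measurableSet_periodCell).2
        (Eventually.of_forall fun x hx => ?_))
      (integrableOn_const volume_periodCell_lt_top.ne)
      (Eventually.of_forall fun x t ht => ?_)
    · rw [norm_pow, norm_norm]
      gcongr
      exact hB (t, x) ⟨ht, periodCell_subset hx⟩
    · exact (hdt t ht x).continuousWithinAt.norm.pow 2
  have hEderiv : ∀ t ∈ Ioo 0 τ, HasDerivAt E (∫ x in periodCell n, 2 * ⟪d t x, d' t x⟫_ℝ) t := by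
    intro t ht
    have hs : Ioo 0 τ ∈ 𝓝 t := Ioo_mem_nhds ht.1 ht.2
    have htI : t ∈ I := Ioo_subset_Icc_self ht
    refine (hasDerivAt_integral_of_dominated_loc_of_deriv_le (bound := fun _ => 2 * (B * B'))
      (F := fun t x => ‖d t x‖ ^ 2) (F' := fun t x => 2 * ⟪d t x, d' t x⟫_ℝ) hs
      ?_ (integrableOn_periodCell ((hdc t htI).norm.pow 2))
      (continuous_const.mul ((hdc t htI).inner (hdc' t htI))).aestronglyMeasurable
      ((ae_restrict_iff' measurableSet_periodCell).2 (Eventually.of_forall fun x hx s hs => ?_))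
      (integrableOn_const volume_periodCell_lt_top.ne)
      (Eventually.of_forall fun x s hs => ?_)).2
    · filter_upwards [hs] with s hs
      exact ((hdc s (Ioo_subset_Icc_self hs)).norm.pow 2).aestronglyMeasurable
    · have hsI : s ∈ I := Ioo_subset_Icc_self hs
      have b1 := hB (s, x) ⟨hsI, periodCell_subset hx⟩
      rw [norm_mul, Real.norm_two]
      gcongr
      refine (norm_inner_le_norm _ _).trans ?_
      gcongr
      · exact (norm_nonneg _).trans b1
      · exact hB' (s, x) ⟨hsI, periodCell_subset hx⟩
    · exact ((hdt s (Ioo_subset_Icc_self hs) x).hasDerivAt (Icc_mem_nhds hs.1 hs.2)).norm_sq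
  have hEle : ∀ t ∈ Ioo 0 τ, ∫ x in periodCell n, 2 * ⟪d t x, d' t x⟫_ℝ ≤ 2 * (M * E t) := by
    intro t ht
    have htI : t ∈ I := Ioo_subset_Icc_self ht
    have e : ∀ x, d' t x = (ν • Laplacian.laplacian (w t) x - fderiv ℝ (w t) x (w t x) -
        gradient (p t) x) - (ν • Laplacian.laplacian (u t) x - fderiv ℝ (u t) x (u t x) -
        gradient (q t) x) := fun x =>
      (hIu t htI).eq_deriv _ (hdt t htI x) ((hw.momentum t htI x).sub (hu.momentum t htI x))
    rw [integral_const_mul]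
    simp only [e]
    gcongr
    exact setIntegral_inner_sub_le hν (contDiff_slice hw.smooth htI) (hw.periodic t htI)
      (hw.div_free t htI) (contDiff_slice hu.smooth htI) (hu.periodic t htI) (hu.div_free t htI)
      (contDiff_slice hw.smooth_pressure htI) (hw.periodic_pressure t htI)
      (contDiff_slice hu.smooth_pressure htI) (hu.periodic_pressure t htI) (hM' t htI)
  have hE0 : E 0 = 0 := by simp [E, d, h0]
  have hanti : AntitoneOn (fun t => Real.exp (-(2 * M) * t) * E t) I := by
    have hder : ∀ t ∈ Ioo 0 τ, HasDerivAt (fun t => Real.exp (-(2 * M) * t) * E t)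
        (Real.exp (-(2 * M) * t) * (-(2 * M)) * E t +
          Real.exp (-(2 * M) * t) * ∫ x in periodCell n, 2 * ⟪d t x, d' t x⟫_ℝ) t := fun t ht => by
      have := ((hasDerivAt_id t).const_mul (-(2 * M))).exp
      simp only [mul_one, id] at this
      exact this.mul (hEderiv t ht)
    refine antitoneOn_of_deriv_nonpos (convex_Icc _ _)
      ((by fun_prop : Continuous fun t => Real.exp (-(2 * M) * t)).continuousOn.mul hEcont)
      (fun t ht => ?_) (fun t ht => ?_)
    · rw [interior_Icc] at ht
      exact (hder t ht).differentiableAt.differentiableWithinAt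
    · rw [interior_Icc] at ht
      rw [(hder t ht).deriv]
      have := mul_le_mul_of_nonneg_left (hEle t ht) (Real.exp_pos (-(2 * M) * t)).le
      linarith
  have hEt : E t ≤ 0 := by
    have := hanti (left_mem_Icc.2 hτ.le) ht ht.1
    simp only [hE0, mul_zero] at this
    exact nonpos_of_mul_nonpos_right this (Real.exp_pos _)
  have := eq_zero_of_setIntegral_norm_sq_eq_zero (hdc t ht)
    (fun x i => by simp only [d, hw.periodic t ht x i, hu.periodic t ht x i]) hEt x
  exact sub_eq_zero.1 this

end

section

/-! ### Restriction, translation and gluing of solutions -/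

variable {ν : ℝ} {I J : Set ℝ} {u w : ℝ → EuclideanSpace ℝ (Fin n) → EuclideanSpace ℝ (Fin n)}
  {p q : ℝ → EuclideanSpace ℝ (Fin n) → ℝ}
  {u₀ : EuclideanSpace ℝ (Fin n) → EuclideanSpace ℝ (Fin n)}

namespace IsSolutionOn

theorem mono (h : IsSolutionOn ν I u p) (hJ : J ⊆ I) : IsSolutionOn ν J u p :=
  ⟨h.smooth.mono (prod_mono_left hJ), fun t ht => h.periodic t (hJ ht),
    fun t ht => h.div_free t (hJ ht), h.smooth_pressure.mono (prod_mono_left hJ),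
    fun t ht => h.periodic_pressure t (hJ ht), fun t ht x => (h.momentum t (hJ ht) x).mono hJ⟩

theorem congr (h : IsSolutionOn ν I u p) (hw : ∀ t ∈ I, w t = u t) : IsSolutionOn ν I w p where
  smooth := h.smooth.congr fun z hz => by rw [hw _ hz.1]
  periodic t ht := by rw [hw t ht]; exact h.periodic t ht
  div_free t ht := by rw [hw t ht]; exact h.div_free t ht
  smooth_pressure := h.smooth_pressure
  periodic_pressure := h.periodic_pressure
  momentum t ht x := by
    rw [hw t ht]
    exact (h.momentum t ht x).congr (fun s hs => by rw [hw s hs]) (by rw [hw t ht])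

theorem translate (h : IsSolutionOn ν I u p) (t₀ : ℝ) :
    IsSolutionOn ν ((fun s => s + t₀) ⁻¹' I) (fun s => u (s + t₀)) fun s => p (s + t₀) where
  smooth := h.smooth.comp
    (f := fun z : ℝ × EuclideanSpace ℝ (Fin n) => (z.1 + t₀, z.2)) (by fun_prop)
    fun z hz => ⟨hz.1, mem_univ _⟩
  periodic t ht := h.periodic _ ht
  div_free t ht := h.div_free _ ht
  smooth_pressure := h.smooth_pressure.comp
    (f := fun z : ℝ × EuclideanSpace ℝ (Fin n) => (z.1 + t₀, z.2)) (by fun_prop)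
    fun z hz => ⟨hz.1, mem_univ _⟩
  periodic_pressure t ht := h.periodic_pressure _ ht
  momentum t ht x := by
    have := (h.momentum (t + t₀) ht x).scomp (h := fun s => s + t₀) t
      ((hasDerivWithinAt_id t _).add_const t₀) (fun s hs => hs)
    rw [one_smul] at this
    exact this

end IsSolutionOn

/-- Solving the equation is a local property in time: the local pressures, normalised to vanish at
the origin, agree where both are defined, as their gradients are determined by the flow. -/
theorem exists_isSolutionOn_of_local (hI : UniqueDiffOn ℝ I)
    (h : ∀ t ∈ I, ∃ U, IsOpen U ∧ t ∈ U ∧ ∃ p, IsSolutionOn ν (U ∩ I) u p) :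
    ∃ p, IsSolutionOn ν I u p := by
  choose! U hUo hU p hp using h
  have hmem : ∀ t ∈ I, t ∈ U t ∩ I := fun t ht => ⟨hU t ht, ht⟩
  have hmom : ∀ t ∈ I, ∀ s ∈ U t ∩ I, ∀ x, HasDerivWithinAt (fun s => u s x)
      (ν • Laplacian.laplacian (u s) x - fderiv ℝ (u s) x (u s x) - gradient (p t s) x) I s := by
    intro t ht s hs x
    have := (hp t ht).momentum s hs x
    rwa [inter_comm, hasDerivWithinAt_inter ((hUo t ht).mem_nhds hs.1)] at this
  have hP : ∀ t ∈ I, ∀ s ∈ U t ∩ I, ∀ x, p s s x - p s s 0 = p t s x - p t s 0 := by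
    intro t ht s hs x
    have d1 := (contDiff_slice (hp s hs.2).smooth_pressure (hmem s hs.2)).differentiable (by simp)
    have d2 := (contDiff_slice (hp t ht).smooth_pressure hs).differentiable (by simp)
    have hg : ∀ y, fderiv ℝ (fun y => p s s y - p t s y) y = 0 := by
      intro y
      have h1 := (hI s hs.2).eq_deriv _ (hmom s hs.2 s (hmem s hs.2) y) (hmom t ht s hs y)
      have h2 := sub_right_injective h1
      rw [fderiv_fun_sub (d1 y) (d2 y), sub_eq_zero]
      exact (InnerProductSpace.toDual ℝ _).symm.injective h2
    have := is_const_of_fderiv_eq_zero (d1.sub d2) hg x 0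
    simp only [Pi.sub_apply] at this
    linarith
  have hPt : ∀ t ∈ I, ContDiffOn ℝ ∞
      (fun z : ℝ × EuclideanSpace ℝ (Fin n) => p t z.1 z.2 - p t z.1 0) ((U t ∩ I) ×ˢ univ) :=
    fun t ht => (hp t ht).smooth_pressure.sub ((hp t ht).smooth_pressure.comp
      (f := fun z : ℝ × EuclideanSpace ℝ (Fin n) => (z.1, (0 : EuclideanSpace ℝ (Fin n))))
      (by fun_prop) fun z hz => ⟨hz.1, mem_univ _⟩)
  have hnhds : ∀ t ∈ I, ∀ x : EuclideanSpace ℝ (Fin n),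
      (U t ∩ I) ×ˢ univ ∈ 𝓝[I ×ˢ univ] (t, x) := by
    intro t ht x
    have : (U t ∩ I) ×ˢ (univ : Set (EuclideanSpace ℝ (Fin n))) =
        (I ×ˢ univ) ∩ (U t ×ˢ univ) := by
      rw [prod_inter_prod, inter_comm, inter_univ]
    rw [this]
    exact inter_mem_nhdsWithin _ (((hUo t ht).prod isOpen_univ).mem_nhds ⟨hU t ht, mem_univ x⟩)
  refine ⟨fun t x => p t t x - p t t 0, ?_, ?_, ?_, ?_, ?_, ?_⟩
  · rintro ⟨t, x⟩ ⟨ht, -⟩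
    exact ((hp t ht).smooth (t, x) ⟨hmem t ht, mem_univ x⟩).mono_of_mem_nhdsWithin (hnhds t ht x)
  · exact fun t ht => (hp t ht).periodic t (hmem t ht)
  · exact fun t ht => (hp t ht).div_free t (hmem t ht)
  · rintro ⟨t, x⟩ ⟨ht, -⟩
    exact ((hPt t ht (t, x) ⟨hmem t ht, mem_univ x⟩).congr (fun z hz => hP t ht z.1 hz.1 z.2)
      (hP t ht t (hmem t ht) x)).mono_of_mem_nhdsWithin (hnhds t ht x)
  · intro t ht x i
    simp only [(hp t ht).periodic_pressure t (hmem t ht) x i]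
  · intro t ht x
    have : gradient (fun x => p t t x - p t t 0) x = gradient (p t t) x := by
      rw [gradient, gradient, fderiv_sub_const]
    simp only [this]
    exact hmom t ht t (hmem t ht) x

theorem timeInterval_top : timeInterval ⊤ = Ici 0 := by
  ext t; simp [timeInterval]

theorem uniqueDiffOn_timeInterval (S : ℝ≥0∞) : UniqueDiffOn ℝ (timeInterval S) := by
  rcases eq_or_ne S ⊤ with rfl | hS
  · rw [timeInterval_top]; exact uniqueDiffOn_Ici 0
  · rw [← ENNReal.ofReal_toReal hS, timeInterval_ofReal]; exact uniqueDiffOn_Ico _ _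

theorem IsSmoothSolution.eq {S S' : ℝ≥0∞} (hν : 0 ≤ ν) (hw : IsSmoothSolution ν u₀ S w)
    (hu : IsSmoothSolution ν u₀ S' u) {t : ℝ} (ht : t ∈ timeInterval S)
    (ht' : t ∈ timeInterval S') : w t = u t := by
  funext x
  rcases ht.1.eq_or_lt with rfl | h
  · rw [hw.initial, hu.initial]
  have hsub : ∀ {S : ℝ≥0∞}, t ∈ timeInterval S → Icc 0 t ⊆ timeInterval S := fun hS s hs =>
    ⟨hs.1, (ENNReal.ofReal_le_ofReal hs.2).trans_lt hS.2⟩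
  obtain ⟨p, hp⟩ := hw.exists_isSolutionOn
  obtain ⟨q, hq⟩ := hu.exists_isSolutionOn
  exact (hp.mono (hsub ht)).eq_of_initial_eq hν h (hq.mono (hsub ht'))
    (fun x => by rw [hw.initial, hu.initial]) ⟨h.le, le_rfl⟩ x

/-! ### The maximal solution -/

/-- The supremum of the `S` such that a smooth solution exists on `[0, S)`. -/
noncomputable def maximalTime (ν : ℝ) (u₀ : EuclideanSpace ℝ (Fin n) → EuclideanSpace ℝ (Fin n)) :
    ℝ≥0∞ :=
  sSup {S | ∃ w, IsSmoothSolution ν u₀ S w}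

theorem IsSmoothSolution.le_maximalTime {S : ℝ≥0∞} (h : IsSmoothSolution ν u₀ S w) :
    S ≤ maximalTime ν u₀ := le_sSup ⟨w, h⟩

theorem isOpen_setOf_ofReal_lt (S : ℝ≥0∞) : IsOpen {t | ENNReal.ofReal t < S} :=
  isOpen_Iio.preimage ENNReal.continuous_ofReal

/-- By uniqueness the solutions on all intervals fit together. -/
theorem exists_isSmoothSolution_maximalTime (hν : 0 ≤ ν) (h0 : 0 < maximalTime ν u₀) :
    ∃ u, IsSmoothSolution ν u₀ (maximalTime ν u₀) u := by
  have h : ∀ t ∈ timeInterval (maximalTime ν u₀), ∃ S w, IsSmoothSolution ν u₀ S w ∧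
      ENNReal.ofReal t < S := by
    intro t ht
    obtain ⟨S, ⟨w, hw⟩, hS⟩ := lt_sSup_iff.1 ht.2
    exact ⟨S, w, hw, hS⟩
  choose! S w hw hS using h
  have hzero : (0 : ℝ) ∈ timeInterval (maximalTime ν u₀) := ⟨le_rfl, by simpa using h0⟩
  obtain ⟨p, hp⟩ := exists_isSolutionOn_of_local (ν := ν) (u := fun t => w t t)
    (uniqueDiffOn_timeInterval (maximalTime ν u₀)) fun t ht => by
      obtain ⟨p, hp⟩ := (hw t ht).exists_isSolutionOn
      refine ⟨_, isOpen_setOf_ofReal_lt (S t), hS t ht, p,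
        (hp.mono fun s hs => ⟨hs.2.1, hs.1⟩).congr fun s hs => ?_⟩
      exact (hw s hs.2).eq hν (hw t ht) ⟨hs.2.1, hS s hs.2⟩ ⟨hs.2.1, hs.1⟩
  exact ⟨_, hp.isSmoothSolution fun x => (hw 0 hzero).initial x⟩

/-- A solution on `[0, τ)` can be continued by a solution on `[0, δ)` started from it at `t₀`. -/
theorem IsSmoothSolution.exists_extension {t₀ τ δ : ℝ} (hν : 0 ≤ ν) (ht₀ : 0 ≤ t₀) (hτ : t₀ < τ)
    {v : ℝ → EuclideanSpace ℝ (Fin n) → EuclideanSpace ℝ (Fin n)}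
    (hu : IsSmoothSolution ν u₀ (ENNReal.ofReal τ) u)
    (hv : IsSmoothSolution ν (u t₀) (ENNReal.ofReal δ) v) :
    ∃ w, IsSmoothSolution ν u₀ (ENNReal.ofReal (t₀ + δ)) w := by
  obtain ⟨p, hp⟩ := hu.exists_isSolutionOn
  obtain ⟨q, hq⟩ := hv.exists_isSolutionOn
  have hshift : IsSmoothSolution ν (u t₀) (ENNReal.ofReal (τ - t₀)) fun s => u (s + t₀) := by
    refine ((hp.translate t₀).mono fun s hs => ?_).isSmoothSolution (fun x => by rw [zero_add])
    rw [timeInterval_ofReal] at hs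
    rw [mem_preimage, timeInterval_ofReal]
    exact ⟨by linarith [hs.1], by linarith [hs.2]⟩
  let w : ℝ → EuclideanSpace ℝ (Fin n) → EuclideanSpace ℝ (Fin n) := fun t =>
    if t < τ then u t else v (t - t₀)
  obtain ⟨r, hr⟩ := exists_isSolutionOn_of_local (ν := ν) (u := w)
    (uniqueDiffOn_timeInterval (ENNReal.ofReal (t₀ + δ))) fun t ht => by
      rw [timeInterval_ofReal] at *
      rcases lt_or_ge t τ with h | h
      · exact ⟨Iio τ, isOpen_Iio, h, p, (hp.mono fun s hs => ⟨hs.2.1, hs.1⟩).congr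
          fun s hs => if_pos hs.1⟩
      · refine ⟨Ioi t₀, isOpen_Ioi, hτ.trans_le h, _, ((hq.translate (-t₀)).mono
          fun s hs => ?_).congr fun s hs => ?_⟩
        · have h1 : t₀ < s := hs.1
          exact ⟨by linarith, by linarith [hs.2.2]⟩
        · have h1 : t₀ < s := hs.1
          simp only [w, ← sub_eq_add_neg]
          split_ifs with hsτ
          · have := hshift.eq hν hv (t := s - t₀)
              (by rw [timeInterval_ofReal]; exact ⟨by linarith, by linarith⟩)
              (by rw [timeInterval_ofReal]; exact ⟨by linarith, by linarith [hs.2.2]⟩)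
            simpa using this
          · rfl
  exact ⟨w, hr.isSmoothSolution fun x => by
    simp only [w, if_pos (ht₀.trans_lt hτ), hu.initial]⟩

theorem maximalTime_eq_top (hν : 0 < ν) (hs : ContDiff ℝ ∞ u₀) (hp : IsPeriodic u₀)
    (hd : ∀ x, divergence u₀ x = 0)
    (h : normA0 u₀ ≤ ENNReal.ofReal ν) : maximalTime ν u₀ = ⊤ := by
  refine ENNReal.eq_top_of_forall_nnreal_le fun r => ?_
  obtain ⟨w, hw⟩ := exists_isSmoothSolution hν (T := r + 1) (by positivity) hs hp hd (.inl h)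
  refine le_trans ?_ hw.le_maximalTime
  rw [← ENNReal.ofReal_coe_nnreal]
  exact ENNReal.ofReal_le_ofReal (by linarith)

/-- If `normA0 u₀ = 0`, the left-hand side is `⊤`. -/
theorem div_sq_le_maximalTime (hν : 0 < ν) (hs : ContDiff ℝ ∞ u₀) (hp : IsPeriodic u₀)
    (hd : ∀ x, divergence u₀ x = 0) :
    ENNReal.ofReal (2 * ν) / normA0 u₀ ^ 2 ≤ maximalTime ν u₀ := by
  refine le_of_forall_lt fun c hc => ?_
  obtain ⟨T, hcT, hT⟩ := exists_between hc
  have hTtop : T ≠ ⊤ := hT.ne_top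
  have hT0 : 0 < T.toReal := ENNReal.toReal_pos (pos_of_gt hcT).ne' hTtop
  have h1 : T * normA0 u₀ ^ 2 < ENNReal.ofReal (2 * ν) := ENNReal.mul_lt_of_lt_div hT
  have h2 : T.toReal * (normA0 u₀).toReal ^ 2 < 2 * ν := by
    have := (ENNReal.toReal_lt_toReal h1.ne_top ENNReal.ofReal_ne_top).2 h1
    rwa [ENNReal.toReal_mul, ENNReal.toReal_pow, ENNReal.toReal_ofReal (by positivity)] at this
  obtain ⟨w, hw⟩ := exists_isSmoothSolution hν hT0 hs hp hd (.inr h2)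
  rw [ENNReal.ofReal_toReal hTtop] at hw
  exact hcT.trans_le hw.le_maximalTime

theorem maximalTime_pos (hν : 0 < ν) (hs : ContDiff ℝ ∞ u₀) (hp : IsPeriodic u₀)
    (hd : ∀ x, divergence u₀ x = 0) : 0 < maximalTime ν u₀ := by
  refine lt_of_lt_of_le ?_ (div_sq_le_maximalTime hν hs hp hd)
  exact ENNReal.div_pos (by simpa using hν) (ENNReal.pow_ne_top (normA0_ne_top hs hp))

/-- The solution can be restarted with a life span that depends only on the bound `C`; restarting
shortly before the maximal time would lead beyond it. -/
theorem lt_maximalTime_of_normA0_le (hν : 0 < ν) (hpos : 0 < maximalTime ν u₀)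
    (hu : IsSmoothSolution ν u₀ (maximalTime ν u₀) u) {T : ℝ} {C : ℝ≥0}
    (hC : ∀ t ∈ Icc 0 T, t ∈ timeInterval (maximalTime ν u₀) → normA0 (u t) ≤ C) :
    ENNReal.ofReal T < maximalTime ν u₀ := by
  by_contra! hle
  have htop : maximalTime ν u₀ ≠ ⊤ := ne_top_of_le_ne_top ENNReal.ofReal_ne_top hle
  set τ := (maximalTime ν u₀).toReal with hτ
  have hτ' : maximalTime ν u₀ = ENNReal.ofReal τ := (ENNReal.ofReal_toReal htop).symm
  have hτ0 : 0 < τ := ENNReal.toReal_pos hpos.ne' htop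
  have hτT : τ ≤ T := by
    rw [hτ', ENNReal.ofReal_le_ofReal_iff'] at hle
    exact hle.resolve_right hτ0.not_ge
  -- The norm is at most `C` up to time `τ`, and `δ C² ≤ ν < 2 ν`, so `δ` is an admissible life
  -- span.
  set δ := ν / ((C : ℝ) ^ 2 + 1)
  have hδ : 0 < δ := by positivity
  have hmin : 0 < min δ τ := lt_min hδ hτ0
  -- The restarting time `t₀` is in `(0, τ)` and less than `δ` before `τ`.
  set t₀ := τ - min δ τ / 2
  have ht₀ : 0 ≤ t₀ := by
    have := min_le_right δ τ
    simp only [t₀]; linarith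
  have ht₀τ : t₀ < τ := by simp only [t₀]; linarith
  have hlt : τ < t₀ + δ := by
    have := min_le_left δ τ
    simp only [t₀]; linarith
  have hmem : t₀ ∈ timeInterval (maximalTime ν u₀) := by
    rw [hτ', timeInterval_ofReal]; exact ⟨ht₀, ht₀τ⟩
  have hnorm := hC t₀ ⟨ht₀, by linarith⟩ hmem
  have hδC : δ * (normA0 (u t₀)).toReal ^ 2 < 2 * ν := by
    have h1 : (normA0 (u t₀)).toReal ≤ C := ENNReal.toReal_le_coe_of_le_coe hnorm
    have h2 : δ * ((C : ℝ) ^ 2 + 1) = ν := div_mul_cancel₀ _ (by positivity)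
    have h3 : δ * (normA0 (u t₀)).toReal ^ 2 ≤ δ * (C : ℝ) ^ 2 := by gcongr
    linarith
  obtain ⟨v, hv⟩ := exists_isSmoothSolution hν hδ (contDiff_slice hu.smooth hmem)
    (hu.periodic t₀ hmem) (hu.div_free t₀ hmem) (.inr hδC)
  rw [hτ'] at hu
  obtain ⟨w, hw⟩ := hu.exists_extension hν.le ht₀ ht₀τ hv
  have := hw.le_maximalTime
  rw [hτ', ENNReal.ofReal_le_ofReal_iff hτ0.le] at this
  linarith

end

end PeriodicNS

theorem mainTheorem1 (n : ℕ) (hn : 2 ≤ n) (ν : ℝ) (hν : 0 < ν)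
    (u₀ : EuclideanSpace ℝ (Fin n) → EuclideanSpace ℝ (Fin n))
    (hu₀_smooth : ContDiff ℝ ∞ u₀) (hu₀_periodic : PeriodicNS.IsPeriodic u₀)
    (hu₀_div : ∀ x, PeriodicNS.divergence u₀ x = 0) :
    ∃ (Tstar : ℝ≥0∞) (u : ℝ → EuclideanSpace ℝ (Fin n) → EuclideanSpace ℝ (Fin n)),
      -- the lower bounds on the existence time
      (PeriodicNS.normA0 u₀ ≤ ENNReal.ofReal ν → Tstar = ⊤) ∧
      (ENNReal.ofReal ν < PeriodicNS.normA0 u₀ →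
        ENNReal.ofReal (2 * ν) / PeriodicNS.normA0 u₀ ^ 2 ≤ Tstar) ∧
      0 < Tstar ∧
      -- existence on `[0, Tstar)`
      PeriodicNS.IsSmoothSolution ν u₀ Tstar u ∧
      -- uniqueness on `[0, Tstar)`, also among solutions on other intervals `[0, S)`
      (∀ (S : ℝ≥0∞) (w : ℝ → EuclideanSpace ℝ (Fin n) → EuclideanSpace ℝ (Fin n)),
        PeriodicNS.IsSmoothSolution ν u₀ S w →
          ∀ t ∈ PeriodicNS.timeInterval S, t ∈ PeriodicNS.timeInterval Tstar →
            ∀ x, w t x = u t x) ∧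
      -- an a priori bound on `[0, T]`, as far as the solution exists, implies `T < Tstar`
      (∀ (T : ℝ) (C : ℝ≥0), 0 ≤ T →
        (∀ t ∈ Set.Icc 0 T, t ∈ PeriodicNS.timeInterval Tstar →
          PeriodicNS.normA0 (u t) ≤ (C : ℝ≥0∞)) →
        ENNReal.ofReal T < Tstar) := by
  have hpos := PeriodicNS.maximalTime_pos hν hu₀_smooth hu₀_periodic hu₀_div
  obtain ⟨u, hu⟩ := PeriodicNS.exists_isSmoothSolution_maximalTime hν.le hpos
  exact ⟨PeriodicNS.maximalTime ν u₀, u,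
    PeriodicNS.maximalTime_eq_top hν hu₀_smooth hu₀_periodic hu₀_div,
    fun _ => PeriodicNS.div_sq_le_maximalTime hν hu₀_smooth hu₀_periodic hu₀_div, hpos, hu,
    fun S w hw t ht ht' x => congrFun (hw.eq hν.le hu ht ht') x,
    fun T C _ hC => PeriodicNS.lt_maximalTime_of_normA0_le hν hpos hu hC⟩
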